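/- **Setting.** Let $\mathcal F_{NS}$ be the Fock space of the Neveu–Schwarz fermion algebra $[\psi_m,\psi_n]_+=\delta_{m+n,0}\,\mathrm{Id}$ ($m,n\in\mathbb Z+\tfrac12$): the complex vector space generated freely by $\Omega$ subject to $\psi_m\Omega=0$ for $m>0$, with basis $\psi_{-m_1}\cdots\psi_{-m_r}\Omega$ ($0<m_1<\dots<m_r$), and with the scalar product for which $\|\Omega\|=1$ and $\psi_n^*=\psi_{-n}$. Let $D$ and $T$ be the operators with $D\Omega=T\Omega=0$, $[D,\psi_{-m}]=m\,\psi_{-m}$ and $[T,\psi_{-m}]=(m+\tfrac12)\psi_{-m-1}$ for $m\in\mathbb N+\tfrac12$. A formal field on a prehilbert space $H$ is $A(z)=\sum_{n\in\mathbb Z}A(n)z^{-n-1}$ with $A(n)\in\mathrm{End}(H)$, and $A'(z)=\sum_n(-n)A(n-1)z^{-n-1}$. Fields $A,B$ are local with sign $\varepsilon\in\mathbb Z/2$ if there is $N\in\mathbb N$ such that for all $c,d\in H$ there is $X\in(z-w)^{-N}\mathbb C[z^{\pm1},w^{\pm1}]$ whose expansion for $|z|>|w|$ is $(A(z)B(w)c,d)$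 and whose expansion for $|w|>|z|$ is $(-1)^\varepsilon(B(w)A(z)c,d)$. Their products $A_nB$, $n\in\mathbb Z$, have the modes $$(A_nB)(m)=\sum_{p=0}^n(-1)^p\binom np[A(n-p),B(m+p)]_\varepsilon\quad(n\ge0),$$ $$(A_nB)(m)=\sum_{p\ge0}\binom{p-n-1}{p}\bigl(A(n-p)B(m+p)-(-1)^{\varepsilon+n}B(m+n-p)A(p)\bigr)\quad(n<0),$$ where $[X,Y]_\varepsilon=XY-(-1)^\varepsilon YX$. Put $\psi(z)=\sum_{n\in\mathbb Z}\psi_{n+1/2}z^{-n-1}$. Let $\mathcal S$ be the linear span of the smallest set of fields on $\mathcal F_{NS}$ that contains $\mathrm{Id}$ and $\psi$ and is stable under $A\mapsto A'$ and under all products $(A,B)\mapsto A_nB$. A vertex operator superalgebra $(H,V,\Omega,\omega)$ consists of a nonzero prehilbert superspace $H=H_{\bar0}\oplus H_{\bar1}$, a linear map $V$ from $H$ to the formal fields on $H$, written $V(a,z)=\sum_nV(a)(n)z^{-n-1}$, and vectors $\Omega,\omega\in H$, such that: 1. $V(a)(n)\Omega=0$ for $n\ge0$, $V(a)(-1)\Omega=a$,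 and $V(\Omega,z)=\mathrm{Id}$; 2. the operators $V(a)(n)$ act irreducibly on $H$, and $H$ is the smallest subspace that contains $\Omega$ and is stable under them; 3. for $a\in H_{\varepsilon_1}$ and $b\in H_{\varepsilon_2}$, the fields $V(a)$ and $V(b)$ are local with sign $\varepsilon_1\varepsilon_2$, and $V(a)_nV(b)\in V(H_{\varepsilon_1+\varepsilon_2})$ for all $n\in\mathbb Z$; 4. with $V(\omega,z)=\sum_nL_nz^{-n-2}$ one has $L_0\Omega=L_{-1}\Omega=0$, $L_{-2}\Omega=\omega$ and $[L_m,L_n]=(m-n)L_{m+n}+\tfrac{c}{12}m(m^2-1)\delta_{m+n,0}\mathrm{Id}$ with $c=2\|\omega\|^2$; 5. $H$ is the orthogonal direct sum of the spaces $H_n=\ker(L_0-n)$, $n\in\tfrac12\mathbb N$, with $\dim H_n<\infty$, $H_\varepsilon=\bigoplus_{n\in\mathbb N+\varepsilon/2}H_n$, $\Omega\in H_0$, $\omega\in H_2$, and $[L_0,V(a,z)]=zV'(a,z)+\alpha V(a,z)$ for $a\in H_\alpha$; 6. $[L_{-1},V(a,z)]=V'(a,z)=V(L_{-1}a,z)$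 for all $a\in H$. **Statement.** The field $\psi$ generates a vertex operator superalgebra on $\mathcal F_{NS}$. That is, there is a linear map $V$ from $\mathcal F_{NS}$ onto $\mathcal S$, inverse to $A\mapsto A(-1)\Omega$, with $V(\psi_{-1/2}\Omega,z)=\psi(z)$, and $(\mathcal F_{NS},V,\Omega,\omega)$ is a vertex operator superalgebra with Virasoro vector $\omega=\tfrac12\psi_{-3/2}\psi_{-1/2}\Omega$, where $H_\varepsilon$ is the sum of the eigenspaces of $D$ with eigenvalues in $\mathbb N+\varepsilon/2$. The modes $L_n$ of $V(\omega,z)=\sum_nL_nz^{-n-2}$ satisfy $$[L_m,L_n]=(m-n)L_{m+n}+\tfrac{1/2}{12}\,m(m^2-1)\,\delta_{m+n,0}\,\mathrm{Id},\qquad L_0=D,\quad L_{-1}=T,\quad L_n^*=L_{-n}.$$ Hence the Virasoro algebra, with basis $(L_n)_{n\in\mathbb Z}$, $C$, where $C$ is central and $[L_m,L_n]=(m-n)L_{m+n}+\tfrac{m^3-m}{12}\delta_{m+n,0}C$, acts on $\mathcal F_{NS}$ through these modes with $C$ acting as $\tfrac12\mathrm{Id}$. The minimal submodule containing $\Omega$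 is isomorphic, by an isomorphism that takes the highest weight vector to $\Omega$, to $L(\tfrac12,0)$. Here $L(c,h)$ is the quotient by its maximal proper submodule of the Verma module $V(c,h)$, the module freely generated by a vector $v$ with $L_nv=0$ for $n>0$, $L_0v=hv$ and $Cv=cv$. -/

import Mathlib

open scoped BigOperators

attribute [local instance] LieRing.ofAssociativeRing

noncomputable section

/-! ## Formal fields on a prehilbert space -/

/-- A formal series `A(z) = ∑ A(n) z^{-n-1}` in `(End H)[[z, z⁻¹]]`, given by its modes `A(n)`. -/
abbrev FormalField (H : Type*) [AddCommGroup H] [Module ℂ H] : Type _ := ℤ → Module.End ℂ H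

namespace FormalField

section Algebraic

variable {H : Type*} [AddCommGroup H] [Module ℂ H]

/-- The constant field `Id`, whose only nonzero mode is the one of index `-1`. -/
def one : FormalField H := fun n => if n = -1 then 1 else 0

/-- `A'(z) = ∑ (-n) A(n-1) z^{-n-1}`. -/
def derivative (A : FormalField H) : FormalField H := fun n => (-(n : ℂ)) • A (n - 1)

/-- `[X, Y]_ε`: the commutator for `ε = 0`, the anticommutator for `ε = 1`. -/
def superBracket (ε : ZMod 2) (X Y : Module.End ℂ H) : Module.End ℂ H :=
  X * Y - ((-1 : ℂ) ^ ε.val) • (Y * X)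

/-- `C = A_n B`, the `n`-th product of two fields that are local with sign `ε`.  For `n < 0` the
defining sum over `p ∈ ℕ` is locally finite: on every vector its partial sums are eventually
constant. -/
def IsNthProduct (ε : ZMod 2) (n : ℤ) (A B C : FormalField H) : Prop :=
  (0 ≤ n → ∀ m : ℤ, C m = ∑ p ∈ Finset.range (n.toNat + 1),
      ((-1 : ℂ) ^ p * (n.toNat.choose p : ℂ)) • superBracket ε (A (n - p)) (B (m + p))) ∧
  (n < 0 → ∀ (m : ℤ) (v : H), ∀ᶠ M : ℕ in Filter.atTop,
      C m v = ∑ p ∈ Finset.range M, (((p + (-n - 1).toNat).choose p : ℕ) : ℂ) •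
        (A (n - p) (B (m + p) v)
          - ((-1 : ℂ) ^ ε.val * (-1 : ℂ) ^ n) • B (m + n - p) (A p v)))

end Algebraic

/-- The coefficient of `z^i w^j` in the expansion of `(z - w)^{-N}` for `|z| > |w|`, namely
`∑_p C(p+N-1, p) w^p z^{-p-N}`. -/
def expandOuter (N : ℕ) (i j : ℤ) : ℂ :=
  if 0 ≤ j ∧ i = -j - N then ((j.toNat + N - 1).choose j.toNat : ℂ) else 0

/-- The coefficient of `z^i w^j` in the expansion of `(z - w)^{-N}` for `|w| > |z|`, namely
`(-1)^N ∑_p C(p+N-1, p) z^p w^{-p-N}`. -/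
def expandInner (N : ℕ) (i j : ℤ) : ℂ := (-1 : ℂ) ^ N * expandOuter N j i

section Prehilbert

variable {H : Type*} [NormedAddCommGroup H] [InnerProductSpace ℂ H]

/-- Locality with sign `ε`: there is `N` such that for all `c, d` there is
`X = P(z, w) / (z - w)^N`, with `P` a Laurent polynomial (with coefficients `P (i, j)` at
`z^i w^j`), whose expansion for `|z| > |w|` is `(A(z)B(w)c, d)` and whose expansion for
`|w| > |z|` is `(-1)^ε (B(w)A(z)c, d)`.  Here `(u, v)`, linear in `u`, is `inner ℂ v u`, and the
equalities are written coefficientwise, at `z^{-m-1} w^{-n-1}`. -/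
def IsLocalWith (ε : ZMod 2) (A B : FormalField H) : Prop :=
  ∃ N : ℕ, ∀ c d : H, ∃ P : ℤ × ℤ →₀ ℂ, ∀ m n : ℤ,
    inner ℂ d (A m (B n c))
        = P.sum (fun q a => a * expandOuter N (-m - 1 - q.1) (-n - 1 - q.2)) ∧
    (-1 : ℂ) ^ ε.val * inner ℂ d (B n (A m c))
        = P.sum (fun q a => a * expandInner N (-m - 1 - q.1) (-n - 1 - q.2))

/-- The smallest set of fields containing `Id` and the fields in `G` and stable under
`A ↦ A'` and under all products `(A, B) ↦ A_n B` (of local fields), `n ∈ ℤ`. -/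
inductive Generated (G : Set (FormalField H)) : FormalField H → Prop
  | one : Generated G one
  | base {A : FormalField H} : A ∈ G → Generated G A
  | derivative {A : FormalField H} : Generated G A → Generated G (derivative A)
  | product {A B C : FormalField H} {ε : ZMod 2} {n : ℤ} : Generated G A → Generated G B →
      IsLocalWith ε A B → IsNthProduct ε n A B C → Generated G C

/-- The linear space of fields generated by `G`. -/
def generatedSpace (G : Set (FormalField H)) : Submodule ℂ (FormalField H) :=
  Submodule.span ℂ {A | Generated G A}

end Prehilbert

end FormalField

/-! ## Vertex operator superalgebras -/

section VOSA

variable {H : Type*} [NormedAddCommGroup H] [InnerProductSpace ℂ H]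

/-- The modes `L_n = L(n+1)` of `V(ω, z) = ∑ L_n z^{-n-2}`. -/
def virasoroMode (V : H →ₗ[ℂ] FormalField H) (ω : H) (n : ℤ) : Module.End ℂ H := V ω (n + 1)

/-- `(H, V, Ω, ω)` is a vertex operator superalgebra on the prehilbert superspace
`H = P 0 ⊕ P 1`. -/
structure IsVertexOperatorSuperalgebra (P : ZMod 2 → Submodule ℂ H)
    (V : H →ₗ[ℂ] FormalField H) (Ω ω : H) : Prop where
  superspace : DirectSum.IsInternal P
  -- vacuum axioms
  vacuum_annihilated : ∀ (a : H) (n : ℤ), 0 ≤ n → V a n Ω = 0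
  vacuum_creation : ∀ a : H, V a (-1) Ω = a
  vacuum_field : V Ω = FormalField.one
  -- irreducibility axiom
  nontrivial : Nontrivial H
  irreducible : ∀ W : Submodule ℂ H, (∀ (a : H) (n : ℤ), ∀ w ∈ W, V a n w ∈ W) → W = ⊥ ∨ W = ⊤
  cyclic : ∀ W : Submodule ℂ H, Ω ∈ W → (∀ (a : H) (n : ℤ), ∀ w ∈ W, V a n w ∈ W) → W = ⊤
  -- locality axiom
  locality : ∀ (ε₁ ε₂ : ZMod 2), ∀ a ∈ P ε₁, ∀ b ∈ P ε₂,
    FormalField.IsLocalWith (ε₁ * ε₂) (V a) (V b)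
  products : ∀ (ε₁ ε₂ : ZMod 2), ∀ a ∈ P ε₁, ∀ b ∈ P ε₂, ∀ n : ℤ,
    ∃ c ∈ P (ε₁ + ε₂), FormalField.IsNthProduct (ε₁ * ε₂) n (V a) (V b) (V c)
  -- Virasoro axiom, with central charge `2 ‖ω‖²`
  virasoro_vacuum_zero : virasoroMode V ω 0 Ω = 0
  virasoro_vacuum_neg_one : virasoroMode V ω (-1) Ω = 0
  virasoro_vacuum_neg_two : virasoroMode V ω (-2) Ω = ω
  virasoro_bracket : ∀ m n : ℤ, ⁅virasoroMode V ω m, virasoroMode V ω n⁆ =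
    ((m : ℂ) - n) • virasoroMode V ω (m + n) +
      (if m + n = 0 then
        (((2 * ‖ω‖ ^ 2 : ℝ) : ℂ) / 12 * ((m : ℂ) * ((m : ℂ) ^ 2 - 1))) • (1 : Module.End ℂ H)
       else 0)
  -- `L₀` axioms: `H` is the orthogonal sum of the eigenspaces `H_n`, `n ∈ ½ℕ`
  energy_decomposition :
    DirectSum.IsInternal fun k : ℕ => (virasoroMode V ω 0).eigenspace ((k : ℂ) / 2)
  energy_finite : ∀ k : ℕ, FiniteDimensional ℂ ((virasoroMode V ω 0).eigenspace ((k : ℂ) / 2))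
  energy_orthogonal : ∀ j k : ℕ, j ≠ k →
    (virasoroMode V ω 0).eigenspace ((j : ℂ) / 2) ⟂ (virasoroMode V ω 0).eigenspace ((k : ℂ) / 2)
  parity : ∀ ε : ZMod 2,
    P ε = ⨆ k : ℕ, (virasoroMode V ω 0).eigenspace ((k : ℂ) + (ε.val : ℂ) / 2)
  vacuum_energy : Ω ∈ (virasoroMode V ω 0).eigenspace 0
  virasoro_energy : ω ∈ (virasoroMode V ω 0).eigenspace 2
  -- `[L₀, V(a, z)] = z V'(a, z) + α V(a, z)` for `a ∈ H_α`
  energy_bracket : ∀ (k : ℕ), ∀ a ∈ (virasoroMode V ω 0).eigenspace ((k : ℂ) / 2), ∀ n : ℤ,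
    ⁅virasoroMode V ω 0, V a n⁆ =
      FormalField.derivative (V a) (n + 1) + ((k : ℂ) / 2) • V a n
  -- `L₋₁` axioms: `[L₋₁, V(a, z)] = V'(a, z) = V(L₋₁ a, z)`
  translation_bracket : ∀ (a : H) (n : ℤ),
    ⁅virasoroMode V ω (-1), V a n⁆ = FormalField.derivative (V a) n
  translation_field : ∀ a : H,
    FormalField.derivative (V a) = V (virasoroMode V ω (-1) a)

end VOSA

/-! ## The Virasoro algebra and its modules `L(c, h)` -/

/-- The underlying space of the Virasoro algebra: basis `(L_n)_{n ∈ ℤ}` and the central `C`. -/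
def Virasoro : Type := (ℤ →₀ ℂ) × ℂ

namespace Virasoro

instance : AddCommGroup Virasoro := inferInstanceAs (AddCommGroup ((ℤ →₀ ℂ) × ℂ))

instance : Module ℂ Virasoro := inferInstanceAs (Module ℂ ((ℤ →₀ ℂ) × ℂ))

/-- The basis element `L_n`. -/
def L (n : ℤ) : Virasoro := ((Finsupp.single n 1, 0) : (ℤ →₀ ℂ) × ℂ)

/-- The central element `C`. -/
def C : Virasoro := ((0, 1) : (ℤ →₀ ℂ) × ℂ)

/-- The Witt bracket `[L_m, L_n] = (m - n) L_{m+n}`, extended bilinearly. -/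
def wittBracket : (ℤ →₀ ℂ) →ₗ[ℂ] (ℤ →₀ ℂ) →ₗ[ℂ] (ℤ →₀ ℂ) :=
  Finsupp.linearCombination ℂ fun m : ℤ =>
    Finsupp.linearCombination ℂ fun n : ℤ => Finsupp.single (m + n) ((m : ℂ) - n)

/-- The Virasoro cocycle `(L_m, L_n) ↦ (m³ - m)/12 δ_{m+n}`, extended bilinearly. -/
def cocycle : (ℤ →₀ ℂ) →ₗ[ℂ] (ℤ →₀ ℂ) →ₗ[ℂ] ℂ :=
  Finsupp.linearCombination ℂ fun m : ℤ =>
    Finsupp.linearCombination ℂ fun n : ℤ => if m + n = 0 then ((m : ℂ) ^ 3 - m) / 12 else 0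

theorem wittBracket_single (m n : ℤ) (a b : ℂ) :
    wittBracket (Finsupp.single m a) (Finsupp.single n b) =
      Finsupp.single (m + n) (a * b * ((m : ℂ) - n)) := by
  simp only [wittBracket, Finsupp.linearCombination_single, LinearMap.smul_apply,
    Finsupp.smul_single, smul_eq_mul, mul_assoc]

theorem cocycle_single (m n : ℤ) (a b : ℂ) :
    cocycle (Finsupp.single m a) (Finsupp.single n b) =
      if m + n = 0 then a * b * (((m : ℂ) ^ 3 - m) / 12) else 0 := by
  simp [cocycle, Finsupp.linearCombination_single, mul_assoc]

theorem wittBracket_skew (f g : ℤ →₀ ℂ) : wittBracket f g = -wittBracket g f := by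
  induction f using Finsupp.induction_linear with
  | zero => simp
  | add f₁ f₂ h₁ h₂ => simp only [map_add, LinearMap.add_apply, h₁, h₂]; abel
  | single m a =>
    induction g using Finsupp.induction_linear with
    | zero => simp
    | add g₁ g₂ h₁ h₂ => simp only [map_add, LinearMap.add_apply, h₁, h₂]; abel
    | single n b =>
      rw [wittBracket_single, wittBracket_single, ← Finsupp.single_neg, add_comm m n]
      congr 1; ring

theorem cocycle_skew (f g : ℤ →₀ ℂ) : cocycle f g = -cocycle g f := by
  induction f using Finsupp.induction_linear with
  | zero => simp
  | add f₁ f₂ h₁ h₂ => simp only [map_add, LinearMap.add_apply, h₁, h₂]; abel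
  | single m a =>
    induction g using Finsupp.induction_linear with
    | zero => simp
    | add g₁ g₂ h₁ h₂ => simp only [map_add, LinearMap.add_apply, h₁, h₂]; abel
    | single n b =>
      rw [cocycle_single, cocycle_single, add_comm n m]
      split_ifs with h
      · obtain rfl : n = -m := by omega
        push_cast; ring
      · simp

theorem wittBracket_jacobi (f g k : ℤ →₀ ℂ) :
    wittBracket f (wittBracket g k) =
      wittBracket (wittBracket f g) k + wittBracket g (wittBracket f k) := by
  induction f using Finsupp.induction_linear with
  | zero => simp
  | add f₁ f₂ h₁ h₂ => simp only [map_add, LinearMap.add_apply, h₁, h₂]; abel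
  | single m a =>
    induction g using Finsupp.induction_linear with
    | zero => simp
    | add g₁ g₂ h₁ h₂ => simp only [map_add, LinearMap.add_apply, h₁, h₂]; abel
    | single n b =>
      induction k using Finsupp.induction_linear with
      | zero => simp
      | add g₁ g₂ h₁ h₂ => simp only [map_add, h₁, h₂]; abel
      | single p c =>
        simp only [wittBracket_single]
        rw [show n + (m + p) = m + (n + p) by ring, show m + n + p = m + (n + p) by ring,
          ← Finsupp.single_add]
        congr 1
        push_cast; ring

theorem cocycle_jacobi (f g k : ℤ →₀ ℂ) :
    cocycle f (wittBracket g k) =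
      cocycle (wittBracket f g) k + cocycle g (wittBracket f k) := by
  induction f using Finsupp.induction_linear with
  | zero => simp
  | add f₁ f₂ h₁ h₂ => simp only [map_add, LinearMap.add_apply, h₁, h₂]; abel
  | single m a =>
    induction g using Finsupp.induction_linear with
    | zero => simp
    | add g₁ g₂ h₁ h₂ => simp only [map_add, LinearMap.add_apply, h₁, h₂]; abel
    | single n b =>
      induction k using Finsupp.induction_linear with
      | zero => simp
      | add g₁ g₂ h₁ h₂ => simp only [map_add, h₁, h₂]; abel
      | single p c =>
        simp only [wittBracket_single, cocycle_single]
        rw [show n + (m + p) = m + (n + p) by ring, show m + n + p = m + (n + p) by ring]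
        split_ifs with h
        · obtain rfl : p = -m - n := by omega
          push_cast; ring
        · simp

instance : Bracket Virasoro Virasoro where
  bracket x y :=
    let x' : (ℤ →₀ ℂ) × ℂ := x
    let y' : (ℤ →₀ ℂ) × ℂ := y
    ((wittBracket x'.1 y'.1, cocycle x'.1 y'.1) : (ℤ →₀ ℂ) × ℂ)

instance : LieRing Virasoro where
  add_lie x y z := Prod.ext (by change wittBracket (_ + _) _ = _; rw [map_add]; rfl)
    (by change cocycle (_ + _) _ = _; rw [map_add]; rfl)
  lie_add x y z := Prod.ext (by change wittBracket _ (_ + _) = _; rw [map_add]; rfl)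
    (by change cocycle _ (_ + _) = _; rw [map_add]; rfl)
  lie_self x := Prod.ext (self_eq_neg.mp (wittBracket_skew _ _))
    (self_eq_neg.mp (cocycle_skew _ _))
  leibniz_lie x y z := Prod.ext (wittBracket_jacobi _ _ _) (cocycle_jacobi _ _ _)

instance : LieAlgebra ℂ Virasoro where
  lie_smul t x y := Prod.ext (by change wittBracket _ (_ • _) = _; rw [map_smul]; rfl)
    (by change cocycle _ (_ • _) = _; rw [map_smul]; rfl)

/-- The universal enveloping algebra of the Virasoro algebra. -/
abbrev Enveloping : Type := UniversalEnvelopingAlgebra ℂ Virasoro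

/-- The left ideal generated by `L_n` (`n > 0`), `L_0 - h` and `C - c`. -/
def vermaIdeal (c h : ℂ) : Submodule Enveloping Enveloping :=
  Submodule.span Enveloping
    ({x | ∃ n : ℤ, 0 < n ∧ x = UniversalEnvelopingAlgebra.ι ℂ (L n)} ∪
      {UniversalEnvelopingAlgebra.ι ℂ (L 0) - algebraMap ℂ Enveloping h,
        UniversalEnvelopingAlgebra.ι ℂ C - algebraMap ℂ Enveloping c})

/-- The Verma module `V(c, h)`, freely generated by a vector `Ω` (the class of `1`) with
`L_n Ω = 0` for `n > 0`, `L_0 Ω = h Ω` and `C Ω = c Ω`. -/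
abbrev Verma (c h : ℂ) : Type := Enveloping ⧸ vermaIdeal c h

/-- The maximal proper submodule `K(c, h)` of `V(c, h)`. -/
def vermaMaximal (c h : ℂ) : Submodule Enveloping (Verma c h) :=
  sSup {W : Submodule Enveloping (Verma c h) | W ≠ ⊤}

/-- The irreducible highest weight module `L(c, h) = V(c, h) / K(c, h)`. -/
abbrev HighestWeight (c h : ℂ) : Type := Verma c h ⧸ vermaMaximal c h

/-- The highest weight vector of `L(c, h)`. -/
def highestWeightVector (c h : ℂ) : HighestWeight c h :=
  Submodule.Quotient.mk (Submodule.Quotient.mk 1)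

/-- The minimal submodule containing `v`, for an action `ρ` of the Virasoro algebra on `H`. -/
def submoduleGenerated {H : Type*} [AddCommGroup H] [Module ℂ H]
    (ρ : Virasoro →ₗ⁅ℂ⁆ Module.End ℂ H) (v : H) : Submodule ℂ H :=
  sInf {W | v ∈ W ∧ ∀ (x : Virasoro), ∀ w ∈ W, ρ x w ∈ W}

theorem submoduleGenerated_stable {H : Type*} [AddCommGroup H] [Module ℂ H]
    (ρ : Virasoro →ₗ⁅ℂ⁆ Module.End ℂ H) (v : H) (x : Virasoro) (w : H)
    (hw : w ∈ submoduleGenerated ρ v) : ρ x w ∈ submoduleGenerated ρ v := by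
  simp only [submoduleGenerated, Submodule.mem_sInf] at hw ⊢
  exact fun W hW => hW.2 x w (hw W hW)

theorem lie_L_L (m n : ℤ) : ⁅L m, L n⁆ =
    ((m : ℂ) - n) • L (m + n) + (if m + n = 0 then ((m : ℂ) ^ 3 - m) / 12 else 0 : ℂ) • C := by
  refine Prod.ext ?_ ?_
  · change wittBracket (Finsupp.single m 1) (Finsupp.single n 1) =
      ((m : ℂ) - n) • Finsupp.single (m + n) (1 : ℂ) + _ • (0 : ℤ →₀ ℂ)
    rw [wittBracket_single]; simp
  · change cocycle (Finsupp.single m 1) (Finsupp.single n 1) =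
      ((m : ℂ) - n) • (0 : ℂ) + _ • (1 : ℂ)
    rw [cocycle_single]; simp

theorem lie_C (x : Virasoro) : ⁅x, C⁆ = 0 := by
  refine Prod.ext ?_ ?_
  · change wittBracket _ 0 = 0
    simp
  · change cocycle _ 0 = 0
    simp

end Virasoro

/-! ## The fermion Fock space `F_NS` -/

/-- The Fock space `F_NS`: the Verma module of the fermion algebra
`[ψ_m, ψ_n]_+ = δ_{m+n}` (`m, n ∈ ℤ + 1/2`), freely generated by `Ω` subject to `ψ_m Ω = 0` for
`m > 0`, realized on its basis of ordered monomials: the basis vector of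
`S = {k₁ < ⋯ < k_r} ⊂ ℕ` is `ψ_{-k₁-1/2} ⋯ ψ_{-k_r-1/2} Ω`. -/
def FockNS : Type := Finset ℕ →₀ ℂ

namespace FockNS

instance : AddCommGroup FockNS := inferInstanceAs (AddCommGroup (Finset ℕ →₀ ℂ))

instance : Module ℂ FockNS := inferInstanceAs (Module ℂ (Finset ℕ →₀ ℂ))

/-- The coordinates in the standard basis. -/
def coord : FockNS ≃ₗ[ℂ] (Finset ℕ →₀ ℂ) := LinearEquiv.refl ℂ (Finset ℕ →₀ ℂ)

/-- The basis vector `ψ_{-k₁-1/2} ⋯ ψ_{-k_r-1/2} Ω` for `S = {k₁ < ⋯ < k_r}`. -/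
def basisVector (S : Finset ℕ) : FockNS := coord.symm (Finsupp.single S 1)

/-- The linear map with given values on the basis vectors. -/
def lift {M : Type*} [AddCommGroup M] [Module ℂ M] (f : Finset ℕ → M) : FockNS →ₗ[ℂ] M :=
  (Finsupp.linearCombination ℂ f).comp coord.toLinearMap

theorem lift_basisVector {M : Type*} [AddCommGroup M] [Module ℂ M] (f : Finset ℕ → M)
    (S : Finset ℕ) : lift f (basisVector S) = f S := by
  simp [lift, basisVector]

theorem hom_ext {M : Type*} [AddCommGroup M] [Module ℂ M] {f g : FockNS →ₗ[ℂ] M}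
    (h : ∀ S, f (basisVector S) = g (basisVector S)) : f = g :=
  Finsupp.lhom_ext' fun S => LinearMap.ext_ring (h S)

/-- The scalar product for which the basis vectors are orthonormal. -/
@[reducible]
def innerCore : InnerProductSpace.Core ℂ FockNS where
  inner u v := (coord u).sum fun S a => (starRingEnd ℂ) a * coord v S
  conj_inner_symm u v := by
    rw [Finsupp.sum_of_support_subset (coord u) Finset.subset_union_left _ (by simp),
      Finsupp.sum_of_support_subset (coord v) (Finset.subset_union_right (s₁ := (coord u).support))
        _ (by simp), map_sum]
    refine Finset.sum_congr rfl fun S _ => ?_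
    simp [mul_comm]
  re_inner_nonneg u := by
    rw [Finsupp.sum, map_sum]
    refine Finset.sum_nonneg fun S _ => ?_
    simp only [RCLike.re_to_complex, Complex.mul_re, Complex.conj_re, Complex.conj_im]
    nlinarith [mul_self_nonneg (coord u S).re, mul_self_nonneg (coord u S).im]
  add_left u v w := by
    rw [map_add]
    exact Finsupp.sum_add_index' (by simp) (by intros; simp [add_mul])
  smul_left u v r := by
    rw [map_smul, Finsupp.sum_smul_index' (by simp), Finsupp.sum, Finsupp.sum, Finset.mul_sum]
    refine Finset.sum_congr rfl fun S _ => ?_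
    simp [mul_assoc]
  definite u hu := by
    have h0 : ∀ S ∈ (coord u).support, Complex.normSq (coord u S) = 0 := by
      rw [← Finset.sum_eq_zero_iff_of_nonneg (fun S _ => Complex.normSq_nonneg _)]
      have : ((∑ S ∈ (coord u).support, Complex.normSq (coord u S) : ℝ) : ℂ) = 0 := by
        rw [← hu, Finsupp.sum, Complex.ofReal_sum]
        exact Finset.sum_congr rfl fun S _ => Complex.normSq_eq_conj_mul_self
      exact_mod_cast this
    refine coord.map_eq_zero_iff.mp (Finsupp.ext fun S => ?_)
    by_cases hS : S ∈ (coord u).support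
    · simpa using h0 S hS
    · simpa using hS

instance : NormedAddCommGroup FockNS := innerCore.toNormedAddCommGroup

instance : InnerProductSpace ℂ FockNS := InnerProductSpace.ofCore innerCore.toCore

/-- The vacuum vector. -/
def Ω : FockNS := basisVector ∅

/-- The sign `(-1)^{#{j ∈ S : j < k}}`. -/
def sign (k : ℕ) (S : Finset ℕ) : ℂ := (-1) ^ (S.filter (· < k)).card

/-- The creation operator `ψ_{-k-1/2}`. -/
def create (k : ℕ) : Module.End ℂ FockNS :=
  lift fun S => if k ∈ S then 0 else sign k S • basisVector (insert k S)

/-- The annihilation operator `ψ_{k+1/2}`. -/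
def annihilate (k : ℕ) : Module.End ℂ FockNS :=
  lift fun S => if k ∈ S then sign k S • basisVector (S.erase k) else 0

/-- The fermion field `ψ(z) = ∑ ψ_{n+1/2} z^{-n-1}`: its mode of index `n` is `ψ_{n+1/2}`. -/
def psi : FormalField FockNS
  | Int.ofNat k => annihilate k
  | Int.negSucc k => create k

/-- The Virasoro vector `ω = ½ ψ_{-3/2} ψ_{-1/2} Ω`. -/
def ω : FockNS := (1 / 2 : ℂ) • psi (-2) (psi (-1) Ω)

/-- The energy operator `D`: it multiplies `ψ_{-m₁} ⋯ ψ_{-m_r} Ω` by `m₁ + ⋯ + m_r`. -/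
def D : Module.End ℂ FockNS :=
  lift fun S => (∑ k ∈ S, ((k : ℂ) + 1 / 2)) • basisVector S

/-- The translation operator `T = ∑_{k ≥ 0} (k+1) ψ_{-k-3/2} ψ_{k+1/2}`. -/
def T : Module.End ℂ FockNS :=
  lift fun S => ∑ k ∈ S, ((k : ℂ) + 1) • create (k + 1) (annihilate k (basisVector S))

/-- The even and odd parts `H_ε = ⨁_{n ∈ ℕ + ε/2} H_n`, where `H_n` is the `n`-eigenspace
of `D`. -/
def parityPart (ε : ZMod 2) : Submodule ℂ FockNS :=
  ⨆ k : ℕ, D.eigenspace ((k : ℂ) + (ε.val : ℂ) / 2)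

/-! Verification of the defining relations. -/

theorem create_basisVector (k : ℕ) (S : Finset ℕ) : create k (basisVector S) =
    if k ∈ S then 0 else sign k S • basisVector (insert k S) := lift_basisVector _ _

theorem annihilate_basisVector (k : ℕ) (S : Finset ℕ) : annihilate k (basisVector S) =
    if k ∈ S then sign k S • basisVector (S.erase k) else 0 := lift_basisVector _ _

theorem sign_mul_self (k : ℕ) (S : Finset ℕ) : sign k S * sign k S = 1 := by
  rw [sign, ← pow_add, ← two_mul, pow_mul]; simp

theorem sign_insert (k j : ℕ) (S : Finset ℕ) (h : j ∉ S) :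
    sign k (insert j S) = if j < k then -sign k S else sign k S := by
  unfold sign
  rw [Finset.filter_insert]
  split_ifs
  · rw [Finset.card_insert_of_notMem (by simp [h]), pow_succ]; ring
  · rfl

theorem sign_erase (k j : ℕ) (S : Finset ℕ) (h : j ∈ S) :
    sign k (S.erase j) = if j < k then -sign k S else sign k S := by
  have := sign_insert k j (S.erase j) (Finset.notMem_erase j S)
  rw [Finset.insert_erase h] at this
  rw [this]; split_ifs <;> simp

theorem create_create (j k : ℕ) : create j * create k + create k * create j = 0 := by
  refine hom_ext fun S => ?_
  simp only [LinearMap.add_apply, Module.End.mul_apply, create_basisVector, LinearMap.zero_apply]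
  by_cases hj : j ∈ S <;> by_cases hk : k ∈ S <;>
    simp [hj, hk, create_basisVector, sign_insert]
  rcases lt_trichotomy j k with h | h | h
  · rw [if_neg h.ne, if_neg h.ne', if_neg h.not_gt, if_pos h, Finset.insert_comm j k]
    module
  · simp [h]
  · rw [if_neg h.ne', if_neg h.ne, if_neg h.not_gt, if_pos h, Finset.insert_comm j k]
    module

theorem annihilate_annihilate (j k : ℕ) :
    annihilate j * annihilate k + annihilate k * annihilate j = 0 := by
  refine hom_ext fun S => ?_
  simp only [LinearMap.add_apply, Module.End.mul_apply, annihilate_basisVector,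
    LinearMap.zero_apply]
  by_cases hj : j ∈ S <;> by_cases hk : k ∈ S <;>
    simp [hj, hk, annihilate_basisVector, sign_erase]
  rcases lt_trichotomy j k with h | h | h
  · rw [if_neg h.ne, if_neg h.ne', if_neg h.not_gt, if_pos h, Finset.erase_right_comm]
    module
  · simp [h]
  · rw [if_neg h.ne', if_neg h.ne, if_neg h.not_gt, if_pos h, Finset.erase_right_comm]
    module

theorem annihilate_create (j k : ℕ) :
    annihilate j * create k + create k * annihilate j = if j = k then 1 else 0 := by
  refine hom_ext fun S => ?_
  simp only [LinearMap.add_apply, Module.End.mul_apply, annihilate_basisVector,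
    create_basisVector]
  rcases eq_or_ne j k with rfl | hne
  · by_cases hj : j ∈ S
    · simp [hj, create_basisVector, sign_erase, smul_smul, sign_mul_self]
    · simp [hj, annihilate_basisVector, sign_insert, smul_smul, sign_mul_self]
  · rw [if_neg hne]
    by_cases hj : j ∈ S <;> by_cases hk : k ∈ S <;>
      simp [hj, hk, hne, hne.symm, create_basisVector, annihilate_basisVector, sign_insert,
        sign_erase]
    rw [Finset.erase_insert_of_ne hne.symm]
    rcases lt_or_gt_of_ne hne with h | h
    · rw [if_neg h.not_gt, if_pos h]; module
    · rw [if_pos h, if_neg h.not_gt]; module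

/-- `[ψ_{m+1/2}, ψ_{n+1/2}]_+ = δ_{m+n+1}`. -/
theorem psi_anticommute (m n : ℤ) :
    psi m * psi n + psi n * psi m = if m + n = -1 then 1 else 0 := by
  rcases m with m | m <;> rcases n with n | n
  · rw [if_neg (by simp only [Int.ofNat_eq_natCast]; omega)]
    exact annihilate_annihilate m n
  · refine (annihilate_create m n).trans (if_congr ?_ rfl rfl)
    simp only [Int.ofNat_eq_natCast]; omega
  · refine (add_comm _ _).trans ((annihilate_create n m).trans (if_congr ?_ rfl rfl))
    simp only [Int.ofNat_eq_natCast]; omega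
  · rw [if_neg (by omega)]
    exact create_create m n

/-- `ψ_{n+1/2} Ω = 0` for `n ≥ 0`. -/
theorem psi_vacuum (n : ℤ) (hn : 0 ≤ n) : psi n Ω = 0 := by
  obtain ⟨k, rfl⟩ := Int.eq_ofNat_of_zero_le hn
  change annihilate k (basisVector ∅) = 0
  simp [annihilate_basisVector]

/-- `ψ_{-k-1/2}` applied to an ordered monomial with larger indices is an ordered monomial. -/
theorem create_ordered (k : ℕ) (S : Finset ℕ) (h : ∀ j ∈ S, k < j) :
    create k (basisVector S) = basisVector (insert k S) := by
  rw [create_basisVector, if_neg fun hk => lt_irrefl _ (h k hk), sign,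
    Finset.filter_false_of_mem fun j hj => (h j hj).not_gt]
  simp

theorem inner_basisVector (S R : Finset ℕ) :
    inner ℂ (basisVector S) (basisVector R) = if S = R then 1 else 0 := by
  change (coord (basisVector S)).sum (fun S a => (starRingEnd ℂ) a * coord (basisVector R) S) = _
  simp [basisVector, Finsupp.single_apply, eq_comm]

theorem norm_vacuum : ‖Ω‖ = 1 := by
  rw [norm_eq_sqrt_re_inner (𝕜 := ℂ), Ω, inner_basisVector, if_pos rfl]
  simp

theorem span_basisVector : Submodule.span ℂ (Set.range basisVector) = ⊤ := by
  refine top_unique fun u _ => ?_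
  have : u = (coord u).sum fun S a => a • basisVector S := by
    apply coord.injective
    simp [Finsupp.sum, basisVector, map_sum]
    exact (Finsupp.sum_single (coord u)).symm
  rw [this]
  exact Submodule.sum_mem _ fun S _ => Submodule.smul_mem _ _ (Submodule.subset_span ⟨S, rfl⟩)

theorem inner_create (k : ℕ) (u v : FockNS) :
    inner ℂ (create k u) v = inner ℂ u (annihilate k v) := by
  have hu : u ∈ Submodule.span ℂ (Set.range basisVector) := span_basisVector ▸ Submodule.mem_top
  have hv : v ∈ Submodule.span ℂ (Set.range basisVector) := span_basisVector ▸ Submodule.mem_top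
  induction hu using Submodule.span_induction with
  | zero => simp
  | add x y _ _ hx hy => rw [map_add, inner_add_left, inner_add_left, hx, hy]
  | smul a x _ hx => rw [map_smul, inner_smul_left, inner_smul_left, hx]
  | mem x hx =>
    obtain ⟨S, rfl⟩ := hx
    induction hv using Submodule.span_induction with
    | zero => simp
    | add x y _ _ hx hy => rw [map_add, inner_add_right, inner_add_right, hx, hy]
    | smul a x _ hx => rw [map_smul, inner_smul_right, inner_smul_right, hx]
    | mem y hy =>
      obtain ⟨R, rfl⟩ := hy
      have hs : ∀ (j : ℕ) (Q : Finset ℕ), (starRingEnd ℂ) (sign j Q) = sign j Q := by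
        intro j Q; simp [sign]
      rw [create_basisVector, annihilate_basisVector]
      by_cases hS : k ∈ S <;> by_cases hR : k ∈ R
      · have : S ≠ R.erase k := fun h => by simp [h] at hS
        rw [if_pos hS, if_pos hR, inner_zero_left, inner_smul_right, inner_basisVector,
          if_neg this, mul_zero]
      · rw [if_pos hS, if_neg hR, inner_zero_left, inner_zero_right]
      · rw [if_neg hS, if_pos hR, inner_smul_left, inner_smul_right, inner_basisVector,
          inner_basisVector, hs]
        by_cases h : insert k S = R
        · subst h
          rw [if_pos rfl, if_pos (Finset.erase_insert hS).symm, sign_insert _ _ _ hS,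
            if_neg (lt_irrefl k)]
        · have h' : S ≠ R.erase k := fun h' => h (by rw [h', Finset.insert_erase hR])
          rw [if_neg h, if_neg h', mul_zero, mul_zero]
      · have : insert k S ≠ R := fun h => hR (by simp [← h])
        rw [if_neg hS, if_neg hR, inner_smul_left, inner_basisVector, if_neg this, mul_zero,
          inner_zero_right]

/-- `ψ_{n+1/2}^* = ψ_{-n-1/2}`. -/
theorem inner_psi (n : ℤ) (u v : FockNS) :
    inner ℂ (psi n u) v = inner ℂ u (psi (-n - 1) v) := by
  rcases n with k | k
  · have : -(Int.ofNat k) - 1 = Int.negSucc k := by simp only [Int.ofNat_eq_natCast]; omega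
    rw [this]
    change inner ℂ (annihilate k u) v = inner ℂ u (create k v)
    rw [← inner_conj_symm, ← inner_create, inner_conj_symm]
  · have : -(Int.negSucc k) - 1 = Int.ofNat k := by simp only [Int.ofNat_eq_natCast]; omega
    rw [this]
    exact inner_create k u v

theorem D_vacuum : D Ω = 0 := by simp [D, Ω, lift_basisVector]

/-- `D ψ_{-m} a = ψ_{-m} D a + m ψ_{-m} a` for `m = k + 1/2`. -/
theorem D_create (k : ℕ) (a : FockNS) :
    D (create k a) = create k (D a) + ((k : ℂ) + 1 / 2) • create k a := by
  have : D * create k = create k * D + ((k : ℂ) + 1 / 2) • create k := by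
    refine hom_ext fun S => ?_
    simp only [LinearMap.add_apply, Module.End.mul_apply, LinearMap.smul_apply,
      create_basisVector]
    by_cases hk : k ∈ S
    · simp [hk, D, lift_basisVector, create_basisVector]
    · simp only [hk, if_false, D, lift_basisVector, map_smul, create_basisVector,
        Finset.sum_insert hk]
      module
  exact LinearMap.congr_fun this a

theorem T_vacuum : T Ω = 0 := by simp [T, Ω, lift_basisVector]

theorem T_basisVector (S R : Finset ℕ) (h : S ⊆ R) : T (basisVector S) =
    ∑ k ∈ R, ((k : ℂ) + 1) • create (k + 1) (annihilate k (basisVector S)) := by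
  rw [T, lift_basisVector]
  refine Finset.sum_subset h fun k _ hk => ?_
  simp [annihilate_basisVector, hk]

/-- `T ψ_{-m} a = ψ_{-m} T a + (m + 1/2) ψ_{-m-1} a` for `m = k + 1/2`. -/
theorem T_create (k : ℕ) (a : FockNS) :
    T (create k a) = create k (T a) + ((k : ℂ) + 1) • create (k + 1) a := by
  have : T * create k = create k * T + ((k : ℂ) + 1) • create (k + 1) := by
    refine hom_ext fun S => ?_
    have h1 : T (create k (basisVector S)) = ∑ j ∈ insert k S,
        ((j : ℂ) + 1) • create (j + 1) (annihilate j (create k (basisVector S))) := by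
      rw [create_basisVector]
      split_ifs with hk
      · simp
      · rw [map_smul, T_basisVector _ _ subset_rfl, Finset.smul_sum]
        refine Finset.sum_congr rfl fun j _ => ?_
        simp only [map_smul]
        module
    have h2 : ∀ j, create (j + 1) (annihilate j (create k (basisVector S))) =
        create k (create (j + 1) (annihilate j (basisVector S))) +
          if j = k then create (j + 1) (basisVector S) else 0 := by
      intro j
      have e1 := LinearMap.congr_fun (annihilate_create j k) (basisVector S)
      have e2 := LinearMap.congr_fun (create_create (j + 1) k) (annihilate j (basisVector S))
      simp only [LinearMap.add_apply, Module.End.mul_apply, LinearMap.zero_apply] at e1 e2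
      rw [eq_sub_of_add_eq e1, map_sub, eq_neg_of_add_eq_zero_left e2]
      split_ifs <;> simp [add_comm]
    simp only [LinearMap.add_apply, Module.End.mul_apply, LinearMap.smul_apply]
    rw [h1, T_basisVector S (insert k S) (Finset.subset_insert _ _), map_sum]
    simp only [h2, smul_add, Finset.sum_add_distrib, map_smul, smul_ite, smul_zero]
    simp
  exact LinearMap.congr_fun this a

end FockNS

end

/-! Fields are handled through their modes: multiplication by `z - w` becomes a difference of two
index shifts, `diff`, and `(z - w)^n` expanded in one domain becomes `expand`. On families that
vanish far out in the direction of expansion, negative powers invert positive ones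
(`expand_neg_diff_pow`). Locality can therefore be replaced by the algebraic condition
`CommutesAfterPower`, for which Dong's lemma is a computation with commuting shifts;
`CommutesAfterPower.isLocalWith` recovers the Laurent polynomials in the definition of locality.

The state-field correspondence rests on the class `IsVertexField`: translation-covariant fields of
definite parity and bounded energy spread that are regular on the vacuum and local with `psi`. A
member is determined by the vector `A(-1)Ω`: if this is zero, covariance kills every `A(n)Ω`, and
locality with `psi` carries the vanishing to all monomials. Since `A_n B` creates `A(n)B(-1)Ω` from
the vacuum, iterated products of `psi` reach every basis vector. Uniqueness then gives `V(a)_n V(b)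
= V(a(n)b)`, the translation axiom and the equality of the range of `V` with the generated space.

For the Virasoro part, the brackets of `L_n` with the fermions are computed from the explicit
series. An operator that commutes with all fermions is a scalar, so these brackets identify `L_0 =
D` and `L_{-1} = T` and fix `[L_m, L_n]` up to a vacuum expectation value.

Finally, the vacuum defines a homomorphism from the Verma module to the Fock space. A proper
submodule has no component along the highest weight vector, so its image is orthogonal to `Ω`; by
`L_n^* = L_{-n}` it is orthogonal to the whole image, hence to itself, and positive definiteness
makes it zero. The kernel is thus the maximal proper submodule. -/

namespace FormalField

/-! ## Powers of `z - w` acting on doubly infinite families -/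

/-- The coefficient `(-1)^p * binom(n, p)` of `w^p z^{n-p}` in `(z - w)^n`, for `n ∈ ℤ`. -/
noncomputable def signedChoose (n : ℤ) (p : ℕ) : ℂ :=
  ∏ i ∈ Finset.range p, ((i : ℂ) - n) / (i + 1)

@[simp] theorem signedChoose_zero_right (n : ℤ) : signedChoose n 0 = 1 := by simp [signedChoose]

/-- The factors `i - n` absorb the sign `(-1)^p`. This one-step recurrence drives every later
identity between the coefficients, after cancelling `p + 1`. -/
theorem succ_mul_signedChoose (n : ℤ) (p : ℕ) :
    ((p : ℂ) + 1) * signedChoose n (p + 1) = (p - n) * signedChoose n p := by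
  rw [signedChoose, Finset.prod_range_succ, ← signedChoose]
  have : (p : ℂ) + 1 ≠ 0 := by exact_mod_cast p.succ_ne_zero
  field_simp

/-- Pascal's rule for integer exponents: it expresses `(z - w)^(n+1) = (z - w)^n (z - w)` and is
what `expand_succ` needs. -/
theorem signedChoose_succ_succ (n : ℤ) (p : ℕ) :
    signedChoose (n + 1) (p + 1) = signedChoose n (p + 1) - signedChoose n p := by
  induction p with
  | zero => simp [signedChoose]; ring
  | succ p ih =>
    have h0 : (p : ℂ) + 1 + 1 ≠ 0 := by exact_mod_cast (p + 1).succ_ne_zero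
    apply mul_left_cancel₀ h0
    have h1 := succ_mul_signedChoose (n + 1) (p + 1)
    have h2 := succ_mul_signedChoose n (p + 1)
    have h3 := succ_mul_signedChoose n p
    push_cast at h1 h2 h3
    rw [h1, mul_sub, h2, ih]
    linear_combination h3

theorem signedChoose_natCast (n p : ℕ) : signedChoose n p = (-1) ^ p * n.choose p := by
  induction p with
  | zero => simp
  | succ p ih =>
    have h0 : (p : ℂ) + 1 ≠ 0 := by exact_mod_cast p.succ_ne_zero
    apply mul_left_cancel₀ h0
    rw [succ_mul_signedChoose, ih]
    have h := Nat.choose_succ_right_eq n p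
    have h' : (n.choose (p + 1) : ℂ) * (p + 1) = n.choose p * ((n : ℂ) - p) := by
      rcases le_or_gt p n with hp | hp
      · rw [← Nat.cast_sub hp]; exact_mod_cast h
      · simp [Nat.choose_eq_zero_of_lt hp, Nat.choose_eq_zero_of_lt (hp.trans p.lt_succ_self)]
    push_cast
    rw [pow_succ]
    linear_combination (-1 : ℂ) ^ p * h'

/-- For negative exponents all signs cancel, which gives the binomials in the negative case of
`IsNthProduct`. -/
theorem signedChoose_neg (n p : ℕ) :
    signedChoose (-(n : ℤ) - 1) p = ((p + n).choose p : ℕ) := by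
  induction p with
  | zero => simp
  | succ p ih =>
    have h0 : (p : ℂ) + 1 ≠ 0 := by exact_mod_cast p.succ_ne_zero
    apply mul_left_cancel₀ h0
    rw [succ_mul_signedChoose, ih]
    have h := Nat.add_one_mul_choose_eq (p + n) p
    have h' : ((p : ℂ) + n + 1) * (p + n).choose p = (p + n + 1).choose (p + 1) * (p + 1) := by
      exact_mod_cast h
    rw [show p + 1 + n = p + n + 1 by ring]
    push_cast
    linear_combination h'

theorem signedChoose_zero_succ (p : ℕ) : signedChoose 0 (p + 1) = 0 := by
  simpa using signedChoose_natCast 0 (p + 1)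

section Truncated

variable {I M : Type*} [AddCommGroup I] [AddCommGroup M]

/-- The family vanishes far out in the direction of expansion of negative powers of `z - w` in
the domain `|z| > |w|`. -/
def Truncated (e f : I) (F : I → M) : Prop :=
  ∀ i, ∀ᶠ p : ℕ in Filter.atTop, F (i + (-(p : ℤ)) • e + (p : ℤ) • f) = 0

theorem Truncated.sub {e f : I} {F G : I → M} (hF : Truncated e f F) (hG : Truncated e f G) :
    Truncated e f (F - G) := fun i => by
  filter_upwards [hF i, hG i] with p hp hp'
  rw [Pi.sub_apply, hp, hp', sub_zero]

theorem Truncated.eventually {e f : I} {F : I → M} (h : Truncated e f F) (n : ℤ) (i : I) :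
    ∀ᶠ p : ℕ in Filter.atTop, F (i + (n - p) • e + (p : ℤ) • f) = 0 := by
  filter_upwards [h (i + n • e)] with p hp
  rw [← hp]
  congr 1
  rw [sub_smul, neg_smul]; abel

end Truncated

section Shift

variable {I J M M' : Type*} [AddCommGroup I] [AddCommGroup J] [AddCommGroup M] [Module ℂ M]
  [AddCommGroup M'] [Module ℂ M']

/-- Translation of the argument by `e`. -/
def shift (e : I) : Module.End ℂ (I → M) := LinearMap.funLeft ℂ M (· + e)

@[simp] theorem shift_apply (e : I) (F : I → M) (i : I) : shift e F i = F (i + e) := rfl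

/-- The difference of two translations: multiplication by `z - w` if `e` and `f` are the
translations corresponding to multiplication by `z` and `w`. -/
def diff (e f : I) : Module.End ℂ (I → M) := shift e - shift f

@[simp] theorem diff_apply (e f : I) (F : I → M) (i : I) :
    diff e f F i = F (i + e) - F (i + f) := rfl

theorem shift_comm (e f : I) : Commute (shift e : Module.End ℂ (I → M)) (shift f) := by
  refine LinearMap.ext fun F => funext fun i => ?_
  simp [add_right_comm]

theorem diff_comm (a b e f : I) : Commute (diff a b : Module.End ℂ (I → M)) (diff e f) :=
  ((shift_comm a e).sub_left (shift_comm b e)).sub_right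
    ((shift_comm a f).sub_left (shift_comm b f))

/-- Serves to swap the two variables, or to freeze one of three, while a power of `z - w` acts on
the others. -/
theorem diff_pow_comp (g : J → I) (a b : J) (e f : I) (ha : ∀ j, g (j + a) = g j + e)
    (hb : ∀ j, g (j + b) = g j + f) (N : ℕ) (F : I → M) :
    (diff a b ^ N) (F ∘ g) = (diff e f ^ N) F ∘ g := by
  induction N generalizing F with
  | zero => rfl
  | succ N ih =>
    rw [pow_succ, pow_succ, Module.End.mul_apply, Module.End.mul_apply, ← ih]
    congr 1
    funext j
    simp [ha, hb]

theorem diff_pow_linearMap (L : M →ₗ[ℂ] M') (e f : I) (N : ℕ) (F : I → M) :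
    (diff e f ^ N) (fun i => L (F i)) = fun i => L ((diff e f ^ N) F i) := by
  induction N generalizing F with
  | zero => rfl
  | succ N ih =>
    rw [pow_succ, pow_succ, Module.End.mul_apply, Module.End.mul_apply, ← ih]
    congr 1
    funext j
    simp

theorem diff_pow_eq_zero_of_le {e f : I} {F : I → M} {N N' : ℕ} (h : (diff e f ^ N) F = 0)
    (hN : N ≤ N') : (diff e f ^ N') F = 0 := by
  rw [← Nat.sub_add_cancel hN, pow_add, Module.End.mul_apply, h, map_zero]

/-- In each term of the binomial expansion either `a` has exponent at least `p` or `b` has exponent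
at least `q`. In Dong's lemma it is applied to `w - x = -(z - w) + (z - x)`. -/
theorem add_pow_apply_eq_zero {a b : Module.End ℂ M} (hab : Commute a b) {x : M} {p q : ℕ}
    (ha : (a ^ p) x = 0) (hb : (b ^ q) x = 0) : ((a + b) ^ (p + q)) x = 0 := by
  rw [hab.add_pow, LinearMap.sum_apply]
  refine Finset.sum_eq_zero fun i hi => ?_
  have hc : ∀ k, Commute (a ^ k * b ^ (p + q - k)) ((p + q).choose k : Module.End ℂ M) :=
    fun k => Nat.commute_cast _ _
  rw [(hc i).eq, Module.End.mul_apply]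
  suffices (a ^ i * b ^ (p + q - i)) x = 0 by rw [this, map_zero]
  rcases le_or_gt p i with h | h
  · rw [(hab.pow_pow i _).eq, Module.End.mul_apply, ← Nat.sub_add_cancel h, pow_add,
      Module.End.mul_apply, ha, map_zero, map_zero]
  · rw [Module.End.mul_apply, ← Nat.sub_add_cancel (show q ≤ p + q - i by omega), pow_add,
      Module.End.mul_apply, hb, map_zero, map_zero]

theorem Truncated.shift {e f : I} {F : I → M} (h : Truncated e f F) (a : I) :
    Truncated e f (shift a F) := fun i => by
  filter_upwards [h (i + a)] with p hp
  rw [shift_apply, ← hp]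
  congr 1; abel

theorem Truncated.diff {e f : I} {F : I → M} (h : Truncated e f F) (a b : I) :
    Truncated e f (diff a b F) := (h.shift a).sub (h.shift b)

theorem Truncated.diff_pow {e f : I} {F : I → M} (h : Truncated e f F) (a b : I) (N : ℕ) :
    Truncated e f ((FormalField.diff a b ^ N) F) := by
  induction N with
  | zero => exact h
  | succ N ih => rw [pow_succ', Module.End.mul_apply]; exact ih.diff a b

theorem Truncated.linearMap {e f : I} {F : I → M} (h : Truncated e f F) (L : M →ₗ[ℂ] M') :
    Truncated e f (fun i => L (F i)) := fun i => by
  filter_upwards [h i] with p hp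
  rw [hp, map_zero]

theorem neg_pow_apply_eq_zero {a : Module.End ℂ M} {x : M} {p : ℕ} (h : (a ^ p) x = 0) :
    ((-a) ^ p) x = 0 := by
  have : (-a) ^ p = (-1) ^ p * a ^ p := neg_pow a p
  rw [this, Module.End.mul_apply, h, map_zero]

/-- Multiplication by `(z - w)^n`, expanded for `|z| > |w|`. -/
noncomputable def expand (e f : I) (n : ℤ) (F : I → M) : I → M := fun i =>
  ∑ᶠ p : ℕ, signedChoose n p • F (i + (n - p) • e + (p : ℤ) • f)

/-- A `finsum` with infinite support is zero by convention; truncation excludes this case.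
Identities for `expand` are therefore checked on one partial sum, long enough for all the terms
involved. -/
theorem Truncated.expand_eq {e f : I} {F : I → M} (h : Truncated e f F) (n : ℤ) (i : I) :
    ∀ᶠ K : ℕ in Filter.atTop, expand e f n F i =
      ∑ p ∈ Finset.range K, signedChoose n p • F (i + (n - p) • e + (p : ℤ) • f) := by
  obtain ⟨K₀, hK₀⟩ := Filter.eventually_atTop.mp (h.eventually n i)
  filter_upwards [Filter.eventually_ge_atTop K₀] with K hK
  refine finsum_eq_sum_of_support_subset _ fun p hp => ?_
  by_contra hp'
  refine hp ?_
  rw [Finset.coe_range, Set.mem_Iio, not_lt] at hp'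
  exact (congrArg _ (hK₀ p (hK.trans hp'))).trans (smul_zero _)

theorem expand_zero_right (e f : I) (n : ℤ) : expand e f n (0 : I → M) = 0 := by
  funext i
  simp [expand]

theorem expand_zero (e f : I) (F : I → M) : expand e f 0 F = F := by
  funext i
  rw [expand, finsum_eq_single _ 0]
  · simp
  · intro p hp
    obtain ⟨q, rfl⟩ := Nat.exists_eq_succ_of_ne_zero hp
    rw [signedChoose_zero_succ, zero_smul]

/-- Summation by parts: Pascal's rule moves one factor `z - w` from the coefficients to the family,
and truncation removes the boundary term. -/
theorem expand_succ {e f : I} {F : I → M} (h : Truncated e f F) (n : ℤ) :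
    expand e f (n + 1) F = expand e f n (diff e f F) := by
  funext i
  -- The bound is taken of the form `K + 1` so that both the first and the last summand can be split
  -- off.
  obtain ⟨K, hK, hK', hK0⟩ := ((Filter.tendsto_add_atTop_nat 1).eventually
    (h.expand_eq (n + 1) i) |>.and (((Filter.tendsto_add_atTop_nat 1).eventually
      ((h.diff e f).expand_eq n i)).and ((Filter.tendsto_add_atTop_nat 1).eventually
        (h.eventually (n + 1) i)))).exists
  obtain ⟨x, hx⟩ : ∃ x : ℕ → M, ∀ p : ℕ, x p = F (i + (n + 1 - p) • e + (p : ℤ) • f) :=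
    ⟨_, fun _ => rfl⟩
  have e1 : ∀ p : ℕ, diff e f F (i + (n - p) • e + (p : ℤ) • f) = x p - x (p + 1) := fun p => by
    rw [diff_apply, hx, hx]
    congr 2
    · rw [add_sub_right_comm, add_smul, one_smul]; abel
    · push_cast
      rw [show n + 1 - ((p : ℤ) + 1) = n - p by ring, add_smul _ _ f, one_smul]; abel
  rw [hK, hK']
  have hK0' : x (K + 1) = 0 := by rw [hx]; exact hK0
  simp only [e1, ← hx]
  rw [Finset.sum_range_succ']
  simp only [signedChoose_succ_succ, sub_smul, smul_sub, Finset.sum_sub_distrib]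
  rw [Finset.sum_range_succ' (fun p => signedChoose n p • x p),
    Finset.sum_range_succ (fun p => signedChoose n p • x (p + 1)), hK0']
  simp only [signedChoose_zero_right, smul_zero]
  abel

theorem expand_linearMap {e f : I} {F : I → M} (h : Truncated e f F) (L : M →ₗ[ℂ] M') (n : ℤ) :
    expand e f n (fun i => L (F i)) = fun i => L (expand e f n F i) := by
  funext i
  obtain ⟨K, hK, hK'⟩ := ((h.expand_eq n i).and ((h.linearMap L).expand_eq n i)).exists
  rw [hK, hK', map_sum]
  simp

theorem expand_sub {e f : I} {F G : I → M} (hF : Truncated e f F) (hG : Truncated e f G) (n : ℤ) :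
    expand e f n (F - G) = expand e f n F - expand e f n G := by
  funext i
  obtain ⟨K, hK, hK', hK''⟩ := ((hF.expand_eq n i).and ((hG.expand_eq n i).and
    ((hF.sub hG).expand_eq n i))).exists
  rw [Pi.sub_apply, hK, hK', hK'', ← Finset.sum_sub_distrib]
  simp [smul_sub]

theorem expand_comp (g : J → I) (a b : J) (e f : I)
    (hg : ∀ (j : J) (x y : ℤ), g (j + x • a + y • b) = g j + x • e + y • f) (n : ℤ) (F : I → M) :
    expand a b n (F ∘ g) = expand e f n F ∘ g := by
  funext j
  simp only [expand, Function.comp_apply, hg]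

theorem expand_shift (e f : I) (n : ℤ) (F : I → M) (a : I) :
    expand e f n (shift a F) = shift a (expand e f n F) := by
  funext i
  rw [shift_apply, expand, expand]
  congr 1
  funext p
  rw [shift_apply]
  congr 2; abel

theorem expand_diff {e f : I} {F : I → M} (h : Truncated e f F) (n : ℤ) (a b : I) :
    expand e f n (diff a b F) = diff a b (expand e f n F) := by
  rw [diff, LinearMap.sub_apply, expand_sub (h.shift a) (h.shift b), expand_shift, expand_shift]
  rfl

theorem expand_diff_pow {e f : I} {F : I → M} (h : Truncated e f F) (n : ℤ) (a b : I) (N : ℕ) :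
    expand e f n ((diff a b ^ N) F) = (diff a b ^ N) (expand e f n F) := by
  induction N with
  | zero => rfl
  | succ N ih =>
    rw [pow_succ', Module.End.mul_apply, expand_diff (h.diff_pow a b N), ih]; rfl

/-- A truncated family can be recovered from its product with `(z - w)^N`; in particular it vanishes
if that product does. Without truncation this fails for the delta distribution. -/
theorem expand_neg_diff_pow {e f : I} {F : I → M} (h : Truncated e f F) (N : ℕ) :
    expand e f (-N) ((diff e f ^ N) F) = F := by
  induction N with
  | zero => simpa using expand_zero e f F
  | succ N ih =>
    rw [pow_succ', Module.End.mul_apply, ← expand_succ (h.diff_pow e f N)]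
    rw [show -((N + 1 : ℕ) : ℤ) + 1 = -N by push_cast; ring, ih]

end Shift

end FormalField

namespace FormalField

/-! ## Products of fields -/

section Products

variable {H : Type*} [AddCommGroup H] [Module ℂ H]

/-- Every vector is annihilated by the modes of large index. -/
def IsField (A : FormalField H) : Prop := ∀ v, ∃ N : ℤ, ∀ n, N ≤ n → A n v = 0

/-- The family `A(k) B(m) v`. -/
def pairing (A B : FormalField H) (v : H) : ℤ × ℤ → H := fun i => A i.1 (B i.2 v)

theorem IsField.truncated_pairing {B : FormalField H} (hB : IsField B) (A : FormalField H)
    (v : H) : Truncated (1, 0) (0, 1) (pairing A B v) := fun i => by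
  obtain ⟨N, hN⟩ := hB v
  filter_upwards [Filter.eventually_ge_atTop (N - i.2).toNat] with p hp
  simp only [pairing]
  rw [hN, map_zero]
  simp
  omega

open Classical in
/-- The modes of `i_{z,w} (z - w)^n A(z) B(w)`. -/
noncomputable def halfProduct (n : ℤ) (A B : FormalField H) (k m : ℤ) : Module.End ℂ H :=
  -- Linearity in `v` needs the sums to be finite, hence the case distinction. Outside fields the
  -- value is zero by convention.
  if hB : IsField B then
    { toFun := fun v => expand (1, 0) (0, 1) n (pairing A B v) (k, m)
      map_add' := fun u v => by
        obtain ⟨K, h1, h2, h3⟩ := (((hB.truncated_pairing A (u + v)).expand_eq n (k, m)).and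
          (((hB.truncated_pairing A u).expand_eq n (k, m)).and
            ((hB.truncated_pairing A v).expand_eq n (k, m)))).exists
        rw [h1, h2, h3, ← Finset.sum_add_distrib]
        simp [pairing]
      map_smul' := fun a v => by
        obtain ⟨K, h1, h2⟩ := (((hB.truncated_pairing A (a • v)).expand_eq n (k, m)).and
          ((hB.truncated_pairing A v).expand_eq n (k, m))).exists
        rw [h1, h2, Finset.smul_sum]
        simp [pairing, smul_comm a] }
  else 0

theorem halfProduct_apply (n : ℤ) (A : FormalField H) {B : FormalField H} (hB : IsField B)
    (k m : ℤ) (v : H) :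
    halfProduct n A B k m v = expand (1, 0) (0, 1) n (pairing A B v) (k, m) := by
  rw [halfProduct, dif_pos hB]; rfl

theorem halfProduct_eventually (n : ℤ) (A : FormalField H) {B : FormalField H} (hB : IsField B)
    (k m : ℤ) (v : H) : ∀ᶠ K : ℕ in Filter.atTop, halfProduct n A B k m v =
      ∑ p ∈ Finset.range K, signedChoose n p • A (k + n - p) (B (m + p) v) := by
  filter_upwards [(hB.truncated_pairing A v).expand_eq n (k, m)] with K hK
  rw [halfProduct_apply n A hB, hK]
  simp [pairing, add_sub_assoc]

/-- The `n`-th product of two fields that are local with sign `s`. -/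
noncomputable def nthProduct (s : ℂ) (n : ℤ) (A B : FormalField H) : FormalField H := fun m =>
  -- The index `0` takes the residue in `z`. The second half expands `(w - z)^n`, and `(-1)^n` turns
  -- this into `(z - w)^n` in the domain `|w| > |z|`.
  halfProduct n A B 0 m - (s * (-1) ^ n) • halfProduct n B A m 0

theorem nthProduct_eventually (s : ℂ) (n : ℤ) {A B : FormalField H} (hA : IsField A)
    (hB : IsField B) (m : ℤ) (v : H) : ∀ᶠ K : ℕ in Filter.atTop, nthProduct s n A B m v =
      ∑ p ∈ Finset.range K, signedChoose n p •
        (A (n - p) (B (m + p) v) - (s * (-1) ^ n) • B (m + n - p) (A p v)) := by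
  filter_upwards [halfProduct_eventually n A hB 0 m v, halfProduct_eventually n B hA m 0 v]
    with K h1 h2
  simp only [nthProduct, LinearMap.sub_apply, LinearMap.smul_apply, h1, h2, zero_add, smul_sub,
    Finset.sum_sub_distrib, Finset.smul_sum, smul_comm (s * (-1) ^ n)]

theorem isNthProduct_nthProduct (ε : ZMod 2) (n : ℤ) {A B : FormalField H} (hA : IsField A)
    (hB : IsField B) : IsNthProduct ε n A B (nthProduct ((-1) ^ ε.val) n A B) := by
  refine ⟨fun hn m => LinearMap.ext fun v => ?_, fun hn m v => ?_⟩
  · obtain ⟨n, rfl⟩ := Int.eq_ofNat_of_zero_le hn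
    obtain ⟨K, hK, hnK⟩ := ((nthProduct_eventually ((-1) ^ ε.val) n hA hB m v).and
      (Filter.eventually_ge_atTop (n + 1))).exists
    rw [hK, ← Finset.sum_subset (Finset.range_subset_range.mpr hnK)]
    · simp only [smul_sub, Finset.sum_sub_distrib, Int.toNat_natCast, superBracket,
        LinearMap.sum_apply, LinearMap.sub_apply, LinearMap.smul_apply, Module.End.mul_apply,
        signedChoose_natCast, zpow_natCast]
      congr 1
      -- Under `p ↦ n - p` the terms `B(m+n-p) A(p)` become `B(m+p) A(n-p)`, and the signs `(-1)^n`
      -- and `(-1)^(n-p)` combine to `(-1)^p`.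
      rw [← Finset.sum_range_reflect]
      refine Finset.sum_congr rfl fun p hp => ?_
      have hp' : p ≤ n := by simpa [Nat.lt_succ_iff] using hp
      rw [Nat.add_sub_cancel, Nat.choose_symm hp', Nat.cast_sub hp', smul_smul, smul_smul,
        show m + (n : ℤ) - (n - p) = m + p by ring]
      congr 1
      obtain ⟨q, rfl⟩ := Nat.exists_eq_add_of_le hp'
      rw [Nat.add_sub_cancel_left, pow_add]
      have h2 : ((-1 : ℂ) ^ q) * (-1) ^ q = 1 := by rw [← mul_pow]; simp
      linear_combination ((-1 : ℂ) ^ p * (p + q).choose p * (-1) ^ ε.val) * h2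
    · intro p _ hp
      have hp' : n < p := by simpa [Nat.lt_succ_iff] using hp
      rw [signedChoose_natCast, Nat.choose_eq_zero_of_lt hp']
      simp
  · filter_upwards [nthProduct_eventually ((-1) ^ ε.val) n hA hB m v] with K hK
    rw [hK]
    refine Finset.sum_congr rfl fun p _ => ?_
    rw [← signedChoose_neg, show -((-n - 1).toNat : ℤ) - 1 = n by omega]

theorem IsNthProduct.unique {ε : ZMod 2} {n : ℤ} {A B C C' : FormalField H}
    (h : IsNthProduct ε n A B C) (h' : IsNthProduct ε n A B C') : C = C' := by
  rcases le_or_gt 0 n with hn | hn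
  · exact funext fun m => (h.1 hn m).trans (h'.1 hn m).symm
  · refine funext fun m => LinearMap.ext fun v => ?_
    obtain ⟨K, hK, hK'⟩ := ((h.2 hn m v).and (h'.2 hn m v)).exists
    rw [hK, hK']

/-! ## Locality and Dong's lemma -/

/-- `(z - w)^N (A(z) B(w) - s B(w) A(z)) = 0` for some `N`. -/
def CommutesAfterPower (s : ℂ) (A B : FormalField H) : Prop :=
  ∃ N : ℕ, ∀ v, (diff (1, 0) (0, 1) ^ N)
    (fun i : ℤ × ℤ => A i.1 (B i.2 v) - s • B i.2 (A i.1 v)) = 0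

theorem CommutesAfterPower.exists_le {s : ℂ} {A B : FormalField H}
    (h : CommutesAfterPower s A B) : ∃ N₀ : ℕ, ∀ N, N₀ ≤ N → ∀ v, (diff (1, 0) (0, 1) ^ N)
      (fun i : ℤ × ℤ => A i.1 (B i.2 v) - s • B i.2 (A i.1 v)) = 0 := by
  obtain ⟨N₀, h⟩ := h
  exact ⟨N₀, fun N hN v => diff_pow_eq_zero_of_le (h v) hN⟩

theorem CommutesAfterPower.symm {s : ℂ} (hs : s * s = 1) {A B : FormalField H}
    (h : CommutesAfterPower s A B) : CommutesAfterPower s B A := by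
  obtain ⟨N, h⟩ := h
  refine ⟨N, fun v => ?_⟩
  have h1 := diff_pow_comp (M := H) Prod.swap ((1, 0) : ℤ × ℤ) (0, 1) ((0, 1) : ℤ × ℤ) (1, 0)
    (fun j => by simp) (fun j => by simp) N
    (fun i : ℤ × ℤ => B i.2 (A i.1 v) - s • A i.1 (B i.2 v))
  refine h1.trans ?_
  have h2 : (diff (0, 1) (1, 0) : Module.End ℂ (ℤ × ℤ → H)) = -diff (1, 0) (0, 1) := by
    simp [diff]
  -- Because `s² = 1`, the bracket in the opposite order is `-s` times the original one.
  have h3 : (fun i : ℤ × ℤ => B i.2 (A i.1 v) - s • A i.1 (B i.2 v)) = fun i =>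
      ((-s) • LinearMap.id : H →ₗ[ℂ] H) (A i.1 (B i.2 v) - s • B i.2 (A i.1 v)) := by
    funext i
    simp only [LinearMap.smul_apply, LinearMap.id_apply, smul_sub, smul_smul, neg_mul, hs]
    module
  rw [h3, diff_pow_linearMap, h2, neg_pow_apply_eq_zero (h v)]
  funext j
  simp

theorem CommutesAfterPower.add_left {s : ℂ} {A A' B : FormalField H}
    (h : CommutesAfterPower s A B) (h' : CommutesAfterPower s A' B) :
    CommutesAfterPower s (A + A') B := by
  obtain ⟨N, h⟩ := h.exists_le
  obtain ⟨N', h'⟩ := h'.exists_le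
  refine ⟨N + N', fun v => ?_⟩
  rw [← add_zero (0 : ℤ × ℤ → H)]
  nth_rewrite 1 [← h (N + N') le_self_add v]
  rw [← h' (N + N') le_add_self v, ← map_add]
  congr 1
  funext i
  simp only [Pi.add_apply, LinearMap.add_apply, map_add, smul_add]
  abel

theorem CommutesAfterPower.smul_left {s : ℂ} {A B : FormalField H}
    (h : CommutesAfterPower s A B) (a : ℂ) : CommutesAfterPower s (a • A) B := by
  obtain ⟨N, h⟩ := h
  refine ⟨N, fun v => ?_⟩
  have : a • (diff (1, 0) (0, 1) ^ N)
      (fun i : ℤ × ℤ => A i.1 (B i.2 v) - s • B i.2 (A i.1 v)) = 0 := by rw [h v, smul_zero]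
  rw [← this, ← map_smul]
  congr 1
  funext i
  simp only [Pi.smul_apply, LinearMap.smul_apply, map_smul, smul_sub, smul_comm a]

theorem CommutesAfterPower.zero_left (s : ℂ) (B : FormalField H) :
    CommutesAfterPower s 0 B := ⟨0, fun v => by funext i; simp⟩

/-- Dong's lemma. -/
theorem CommutesAfterPower.product {s t u : ℂ} {A B C : FormalField H} (hA : IsField A)
    (hB : IsField B) (hAB : CommutesAfterPower s A B) (hAC : CommutesAfterPower t A C)
    (hBC : CommutesAfterPower u B C) (n : ℤ) :
    CommutesAfterPower (t * u) (nthProduct s n A B) C := by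
  obtain ⟨r₁, h₁⟩ := hAB.exists_le
  obtain ⟨r₂, h₂⟩ := hAC.exists_le
  obtain ⟨r₃, h₃⟩ := hBC.exists_le
  obtain ⟨r, hr⟩ : ∃ r, r = r₁ + r₂ + r₃ := ⟨_, rfl⟩
  replace h₁ := h₁ r (by omega)
  replace h₂ := h₂ r (by omega)
  replace h₃ := h₃ r (by omega)
  -- One factor `(w - x)^r` is kept for moving `C` past `B`. The remaining `r + |n| + r` factors are
  -- distributed over `(z - w)^(r+|n|)` and `(z - x)^r`.
  refine ⟨r + n.natAbs + r + r, fun v => ?_⟩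
  let e₁ : ℤ × ℤ × ℤ := (1, 0, 0)
  let e₂ : ℤ × ℤ × ℤ := (0, 1, 0)
  let e₃ : ℤ × ℤ × ℤ := (0, 0, 1)
  let U : ℤ × ℤ × ℤ → H := fun i =>
    A i.1 (B i.2.1 (C i.2.2 v)) - (t * u) • C i.2.2 (A i.1 (B i.2.1 v))
  let U' : ℤ × ℤ × ℤ → H := fun i =>
    B i.2.1 (A i.1 (C i.2.2 v)) - (t * u) • C i.2.2 (B i.2.1 (A i.1 v))
  have hU : Truncated e₁ e₂ U := fun i => by
    obtain ⟨N, hN⟩ := hB (C i.2.2 v)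
    obtain ⟨N', hN'⟩ := hB v
    filter_upwards [Filter.eventually_ge_atTop (N - i.2.1).toNat,
      Filter.eventually_ge_atTop (N' - i.2.1).toNat] with p hp hp'
    simp only [U, e₁, e₂, Prod.fst_add, Prod.snd_add, Prod.smul_fst, Prod.smul_snd,
      add_zero, smul_eq_mul, mul_one, mul_zero]
    rw [hN _ (by omega), hN' _ (by omega)]
    simp
  have hU' : Truncated e₂ e₁ U' := fun i => by
    obtain ⟨N, hN⟩ := hA (C i.2.2 v)
    obtain ⟨N', hN'⟩ := hA v
    filter_upwards [Filter.eventually_ge_atTop (N - i.1).toNat,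
      Filter.eventually_ge_atTop (N' - i.1).toNat] with p hp hp'
    simp only [U', e₁, e₂, Prod.fst_add, Prod.snd_add, Prod.smul_fst, Prod.smul_snd,
      add_zero, smul_eq_mul, mul_one, mul_zero]
    rw [hN _ (by omega), hN' _ (by omega)]
    simp
  -- the effect of `(z - x)^r (w - x)^r`
  have key₂₃ : ∀ F : ℤ × ℤ × ℤ → H, (∀ k, (diff (1, 0) (0, 1) ^ r)
      (fun j : ℤ × ℤ => F (k, j.1, j.2)) = 0) → (diff e₂ e₃ ^ r) F = 0 := fun F hF => by
    funext i
    have := diff_pow_comp (M := H) (fun j : ℤ × ℤ => (i.1, j.1, j.2)) (1, 0) (0, 1) e₂ e₃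
      (fun j => by simp [e₂, Prod.ext_iff]) (fun j => by simp [e₃, Prod.ext_iff]) r F
    exact (congrFun this i.2).symm.trans (congrFun (hF i.1) i.2)
  have key₁₃ : ∀ F : ℤ × ℤ × ℤ → H, (∀ m, (diff (1, 0) (0, 1) ^ r)
      (fun j : ℤ × ℤ => F (j.1, m, j.2)) = 0) → (diff e₁ e₃ ^ r) F = 0 := fun F hF => by
    funext i
    have := diff_pow_comp (M := H) (fun j : ℤ × ℤ => (j.1, i.2.1, j.2)) (1, 0) (0, 1) e₁ e₃
      (fun j => by simp [e₁]) (fun j => by simp [e₃]) r F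
    exact (congrFun this (i.1, i.2.2)).symm.trans (congrFun (hF i.2.1) (i.1, i.2.2))
  have key₁₂ : ∀ F : ℤ × ℤ × ℤ → H, (∀ l, (diff (1, 0) (0, 1) ^ r)
      (fun j : ℤ × ℤ => F (j.1, j.2, l)) = 0) → (diff e₁ e₂ ^ r) F = 0 := fun F hF => by
    funext i
    have := diff_pow_comp (M := H) (fun j : ℤ × ℤ => (j.1, j.2, i.2.2)) (1, 0) (0, 1) e₁ e₂
      (fun j => by simp [e₁]) (fun j => by simp [e₂]) r F
    exact (congrFun this (i.1, i.2.1)).symm.trans (congrFun (hF i.2.2) (i.1, i.2.1))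
  have comm : ∀ F, (diff e₁ e₃ ^ r) ((diff e₂ e₃ ^ r) F) =
      (diff e₂ e₃ ^ r) ((diff e₁ e₃ ^ r) F) := fun F =>
    LinearMap.congr_fun (((diff_comm (M := H) e₁ e₃ e₂ e₃).pow_pow r r).eq) F
  have kill : ∀ F F' : ℤ × ℤ × ℤ → H, (diff e₂ e₃ ^ r) F = 0 → (diff e₁ e₃ ^ r) F' = 0 →
      (diff e₁ e₃ ^ r) ((diff e₂ e₃ ^ r) (F + F')) = 0 := fun F F' hF hF' => by
    rw [map_add, map_add, hF, comm F', hF', map_zero, map_zero, add_zero]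
  -- Moving `C` past `B` and past `A` writes `U` as a sum of two brackets, one killed by `(w - x)^r`
  -- and the other by `(z - x)^r`.
  have hkU : (diff e₁ e₃ ^ r) ((diff e₂ e₃ ^ r) U) = 0 := by
    have : U = (fun i => A i.1 (B i.2.1 (C i.2.2 v) - u • C i.2.2 (B i.2.1 v))) +
        (fun i => (u • LinearMap.id : H →ₗ[ℂ] H)
          (A i.1 (C i.2.2 (B i.2.1 v)) - t • C i.2.2 (A i.1 (B i.2.1 v)))) := by
      funext i
      simp only [U, Pi.add_apply, map_sub, map_smul, LinearMap.smul_apply, LinearMap.id_apply]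
      module
    rw [this]
    refine kill _ _ (key₂₃ _ fun k => ?_) (key₁₃ _ fun m => ?_)
    · rw [diff_pow_linearMap (A k) (1, 0) (0, 1) r
        (fun j : ℤ × ℤ => B j.1 (C j.2 v) - u • C j.2 (B j.1 v)), h₃ v]
      funext j; simp
    · rw [diff_pow_linearMap (u • LinearMap.id : H →ₗ[ℂ] H) (1, 0) (0, 1) r
        (fun j : ℤ × ℤ => A j.1 (C j.2 (B m v)) - t • C j.2 (A j.1 (B m v))), h₂]
      funext j; simp
  have hkU' : (diff e₁ e₃ ^ r) ((diff e₂ e₃ ^ r) U') = 0 := by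
    have : U' = (fun i => (t • LinearMap.id : H →ₗ[ℂ] H)
          (B i.2.1 (C i.2.2 (A i.1 v)) - u • C i.2.2 (B i.2.1 (A i.1 v)))) +
        (fun i => B i.2.1 (A i.1 (C i.2.2 v) - t • C i.2.2 (A i.1 v))) := by
      funext i
      simp only [U', Pi.add_apply, map_sub, map_smul, LinearMap.smul_apply, LinearMap.id_apply]
      module
    rw [this]
    refine kill _ _ (key₂₃ _ fun k => ?_) (key₁₃ _ fun m => ?_)
    · rw [diff_pow_linearMap (t • LinearMap.id : H →ₗ[ℂ] H) (1, 0) (0, 1) r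
        (fun j : ℤ × ℤ => B j.1 (C j.2 (A k v)) - u • C j.2 (B j.1 (A k v))), h₃]
      funext j; simp
    · rw [diff_pow_linearMap (B m) (1, 0) (0, 1) r
        (fun j : ℤ × ℤ => A j.1 (C j.2 v) - t • C j.2 (A j.1 v)), h₂ v]
      funext j; simp
  -- This is the bracket of `A_n B` with `C` before the residue in `z` is taken. The sign `(-1)^n`
  -- makes multiplication by `z - w` raise `n` by one.
  let G : ℤ → ℤ × ℤ × ℤ → H := fun n =>
    expand e₁ e₂ n U - (s * (-1) ^ n) • expand e₂ e₁ n U'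
  have hG : ∀ n, (diff e₁ e₃ ^ r) ((diff e₂ e₃ ^ r) (G n)) = 0 := fun n => by
    simp only [G, map_sub, map_smul]
    rw [← expand_diff_pow hU, ← expand_diff_pow hU', ← expand_diff_pow (hU.diff_pow _ _ _),
      ← expand_diff_pow (hU'.diff_pow _ _ _), hkU, hkU', expand_zero_right, expand_zero_right]
    simp
  have hGsucc : ∀ n, diff e₁ e₂ (G n) = G (n + 1) := fun n => by
    simp only [G, map_sub, map_smul]
    rw [expand_succ hU, expand_succ hU', expand_diff hU, expand_diff hU', zpow_add₀ (by simp),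
      show (diff e₂ e₁ : Module.End ℂ (ℤ × ℤ × ℤ → H)) = -diff e₁ e₂ by simp [diff]]
    simp
  have hGadd : ∀ (j : ℕ) (n : ℤ), (diff e₁ e₂ ^ j) (G n) = G (n + j) := fun j => by
    induction j with
    | zero => intro n; simp
    | succ j ih =>
      intro n
      rw [pow_succ, Module.End.mul_apply, hGsucc, ih]
      congr 1; push_cast; ring
  have hG0 : (diff e₁ e₂ ^ r) (G 0) = 0 := by
    have : G 0 = fun i => (A i.1 (B i.2.1 (C i.2.2 v)) - s • B i.2.1 (A i.1 (C i.2.2 v))) -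
        ((t * u) • C i.2.2) (A i.1 (B i.2.1 v) - s • B i.2.1 (A i.1 v)) := by
      funext i
      simp only [G, expand_zero, U, U', Pi.sub_apply, Pi.smul_apply, map_sub, map_smul,
        LinearMap.smul_apply, zpow_zero, mul_one, smul_sub]
      module
    rw [this]
    refine key₁₂ _ fun l => ?_
    have h : (fun j : ℤ × ℤ => (A j.1 (B j.2 (C l v)) - s • B j.2 (A j.1 (C l v))) -
        ((t * u) • C l) (A j.1 (B j.2 v) - s • B j.2 (A j.1 v))) =
        (fun j : ℤ × ℤ => A j.1 (B j.2 (C l v)) - s • B j.2 (A j.1 (C l v))) -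
        (fun j : ℤ × ℤ => ((t * u) • C l) (A j.1 (B j.2 v) - s • B j.2 (A j.1 v))) := rfl
    rw [h, map_sub, h₁, diff_pow_linearMap ((t * u) • C l) (1, 0) (0, 1) r
        (fun j : ℤ × ℤ => A j.1 (B j.2 v) - s • B j.2 (A j.1 v)), h₁]
    funext j; simp
  -- The summand `|n|` compensates a negative `n`, so that at least `r` factors `z - w` are left to
  -- act on `G 0`, where locality of `A` and `B` applies.
  have hGn : (diff e₁ e₂ ^ (r + n.natAbs)) (G n) = 0 := by
    rw [hGadd]
    obtain ⟨q, hq⟩ : ∃ q : ℕ, n + ((r + n.natAbs : ℕ) : ℤ) = 0 + (q : ℤ) ∧ r ≤ q :=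
      ⟨(n + (r + n.natAbs : ℕ)).toNat, by omega, by omega⟩
    rw [hq.1, ← hGadd]
    exact diff_pow_eq_zero_of_le hG0 hq.2
  have hfin : (diff e₂ e₃ ^ (r + n.natAbs + r + r)) (G n) = 0 := by
    have hd : -diff e₁ e₂ + diff e₁ e₃ = (diff e₂ e₃ : Module.End ℂ (ℤ × ℤ × ℤ → H)) := by
      simp [diff]
    rw [pow_add, Module.End.mul_apply, ← hd]
    refine add_pow_apply_eq_zero ((diff_comm (M := H) e₁ e₂ e₁ e₃).neg_left) ?_ ?_
    · refine neg_pow_apply_eq_zero ?_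
      rw [hd]
      have : (diff e₁ e₂ ^ (r + n.natAbs)) ((diff e₂ e₃ ^ r) (G n)) =
          (diff e₂ e₃ ^ r) ((diff e₁ e₂ ^ (r + n.natAbs)) (G n)) :=
        LinearMap.congr_fun (((diff_comm (M := H) e₁ e₂ e₂ e₃).pow_pow _ r).eq) _
      rw [this, hGn, map_zero]
    · rw [hd]
      exact hG n
  have hval : (fun j : ℤ × ℤ => nthProduct s n A B j.1 (C j.2 v) -
      (t * u) • C j.2 (nthProduct s n A B j.1 v)) = G n ∘ fun j : ℤ × ℤ => (0, j.1, j.2) := by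
    funext j
    obtain ⟨m, l⟩ := j
    have c1 := congrFun (expand_comp (M := H) (fun j : ℤ × ℤ => (j.1, j.2, l)) (1, 0) (0, 1) e₁ e₂
      (fun j x y => by simp [e₁, e₂]) n U) (0, m)
    have c2 := congrFun (expand_comp (M := H) (fun j : ℤ × ℤ => (j.2, j.1, l)) (1, 0) (0, 1) e₂ e₁
      (fun j x y => by simp [e₁, e₂]) n U') (m, 0)
    have d1 : U ∘ (fun j : ℤ × ℤ => (j.1, j.2, l)) = pairing A B (C l v) -
        fun i => ((t * u) • C l) (pairing A B v i) := rfl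
    have d2 : U' ∘ (fun j : ℤ × ℤ => (j.2, j.1, l)) = pairing B A (C l v) -
        fun i => ((t * u) • C l) (pairing B A v i) := rfl
    have t1 := hB.truncated_pairing A (C l v)
    have t2 := hB.truncated_pairing A v
    have t3 := hA.truncated_pairing B (C l v)
    have t4 := hA.truncated_pairing B v
    rw [d1, expand_sub t1 (t2.linearMap _), expand_linearMap t2] at c1
    rw [d2, expand_sub t3 (t4.linearMap _), expand_linearMap t4] at c2
    simp only [Pi.sub_apply, Function.comp_apply] at c1 c2
    simp only [G, Function.comp_apply, Pi.sub_apply, Pi.smul_apply, ← c1, ← c2,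
      FormalField.nthProduct, LinearMap.sub_apply, LinearMap.smul_apply,
      halfProduct_apply _ _ hA, halfProduct_apply _ _ hB, map_sub, map_smul]
    module
  rw [hval, diff_pow_comp (fun j : ℤ × ℤ => (0, j.1, j.2)) (1, 0) (0, 1) e₂ e₃
      (fun j => by simp [e₂, Prod.ext_iff]) (fun j => by simp [e₃, Prod.ext_iff]), hfin]
  rfl

end Products

end FormalField

/-! ### How products of fields interact with translation, the vacuum, parity and the identity field.
-/

namespace FormalField

section Covariance

variable {H : Type*} [AddCommGroup H] [Module ℂ H]

/-- Since `(z - w)^n` is killed by `∂_z + ∂_w`, the derivation property of `T` passes through it. In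
modes this is the telescoping sum of `h`, whose upper end vanishes because `B` is a field. -/
theorem halfProduct_covariant {T : Module.End ℂ H} (n : ℤ) {A B : FormalField H} (hB : IsField B)
    (hAT : ∀ n, ⁅T, A n⁆ = derivative A n) (hBT : ∀ n, ⁅T, B n⁆ = derivative B n) (k m : ℤ)
    (v : H) : T (halfProduct n A B k m v) - halfProduct n A B k m (T v) =
      -(k : ℂ) • halfProduct n A B (k - 1) m v - (m : ℂ) • halfProduct n A B k (m - 1) v := by
  obtain ⟨N, hN⟩ := hB v
  obtain ⟨K, h1, h2, h3, h4, h5⟩ := ((halfProduct_eventually n A hB k m v).and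
    ((halfProduct_eventually n A hB k m (T v)).and
      ((halfProduct_eventually n A hB (k - 1) m v).and
        ((halfProduct_eventually n A hB k (m - 1) v).and
          (Filter.eventually_ge_atTop (N - m + 1).toNat))))).exists
  have hA' : ∀ n v, T (A n v) = A n (T v) + -(n : ℂ) • A (n - 1) v := fun n v => by
    have := LinearMap.congr_fun (hAT n) v
    rw [Ring.lie_def, derivative] at this
    exact eq_add_of_sub_eq' this
  have hB' : ∀ n v, T (B n v) = B n (T v) + -(n : ℂ) • B (n - 1) v := fun n v => by
    have := LinearMap.congr_fun (hBT n) v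
    rw [Ring.lie_def, derivative] at this
    exact eq_add_of_sub_eq' this
  let h : ℕ → H := fun p => ((p : ℂ) * signedChoose n p) • A (k + n - p) (B (m + p - 1) v)
  have hsum : ∑ p ∈ Finset.range K, (h (p + 1) - h p) = 0 := by
    rw [Finset.sum_range_sub]
    simp only [h]
    rw [hN _ (by omega)]
    simp
  rw [h1, h2, h3, h4, map_sum, Finset.smul_sum, Finset.smul_sum, ← Finset.sum_sub_distrib,
    ← Finset.sum_sub_distrib, ← sub_eq_zero, ← Finset.sum_sub_distrib, ← hsum]
  refine Finset.sum_congr rfl fun p _ => ?_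
  have e := succ_mul_signedChoose n p
  simp only [h, map_smul, hA', hB', map_add]
  push_cast
  rw [e, show k + n - (p + 1 : ℤ) = k + n - p - 1 by ring,
    show m + (p + 1 : ℤ) - 1 = m + p by ring, show k - 1 + n - (p : ℤ) = k + n - p - 1 by ring,
    show m - 1 + (p : ℤ) = m + p - 1 by ring]
  module

theorem nthProduct_covariant {T : Module.End ℂ H} (s : ℂ) (n : ℤ) {A B : FormalField H}
    (hA : IsField A) (hB : IsField B) (hAT : ∀ n, ⁅T, A n⁆ = derivative A n)
    (hBT : ∀ n, ⁅T, B n⁆ = derivative B n) (m : ℤ) :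
    ⁅T, nthProduct s n A B m⁆ = derivative (nthProduct s n A B) m := by
  refine LinearMap.ext fun v => ?_
  have h1 := halfProduct_covariant n hB hAT hBT 0 m v
  have h2 := halfProduct_covariant n hA hBT hAT m 0 v
  simp only [Int.cast_zero, neg_zero, zero_smul, zero_sub, sub_zero] at h1 h2
  simp only [Ring.lie_def, derivative, nthProduct, LinearMap.sub_apply, Module.End.mul_apply,
    LinearMap.smul_apply, map_sub, map_smul]
  rw [sub_sub_sub_comm, ← smul_sub, h1, h2]
  module

theorem nthProduct_vacuum (s : ℂ) (n : ℤ) {A B : FormalField H} {Ω : H} (hA : IsField A)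
    (hB : IsField B) (hAΩ : ∀ n, 0 ≤ n → A n Ω = 0) (hBΩ : ∀ n, 0 ≤ n → B n Ω = 0) (m : ℤ)
    (hm : 0 ≤ m) : nthProduct s n A B m Ω = 0 := by
  obtain ⟨K, hK⟩ := (nthProduct_eventually s n hA hB m Ω).exists
  rw [hK]
  refine Finset.sum_eq_zero fun p _ => ?_
  rw [hAΩ _ (Int.natCast_nonneg p), hBΩ _ (by omega)]
  simp

/-- On the vacuum the modes `A(p)` and, for `p > 0`, `B(p-1)` vanish, so only `p = 0` survives. Thus
products of fields realize modes acting on states. -/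
theorem nthProduct_creation (s : ℂ) (n : ℤ) {A B : FormalField H} {Ω : H} (hA : IsField A)
    (hB : IsField B) (hAΩ : ∀ n, 0 ≤ n → A n Ω = 0) (hBΩ : ∀ n, 0 ≤ n → B n Ω = 0) :
    nthProduct s n A B (-1) Ω = A n (B (-1) Ω) := by
  obtain ⟨K, hK, hK1⟩ := ((nthProduct_eventually s n hA hB (-1) Ω).and
    (Filter.eventually_ge_atTop 1)).exists
  rw [hK, Finset.sum_eq_single_of_mem 0 (Finset.mem_range.mpr hK1)]
  · simp [hAΩ 0 le_rfl]
  · intro p _ hp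
    rw [hAΩ _ (Int.natCast_nonneg p), hBΩ _ (by omega)]
    simp

theorem nthProduct_mem (s : ℂ) (n : ℤ) {A B : FormalField H} (hA : IsField A) (hB : IsField B)
    (m : ℤ) (v : H) (W : Submodule ℂ H) (h : ∀ p : ℕ, A (n - p) (B (m + p) v) ∈ W)
    (h' : ∀ p : ℕ, B (m + n - p) (A p v) ∈ W) : nthProduct s n A B m v ∈ W := by
  obtain ⟨K, hK⟩ := (nthProduct_eventually s n hA hB m v).exists
  rw [hK]
  exact Submodule.sum_mem _ fun p _ => Submodule.smul_mem _ _
    (Submodule.sub_mem _ (h p) (Submodule.smul_mem _ _ (h' p)))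

theorem nthProduct_intertwines {a b s : ℂ} {P : Module.End ℂ H} (n : ℤ) {A B : FormalField H}
    (hA : IsField A) (hB : IsField B) (hAP : ∀ n, P * A n = a • (A n * P))
    (hBP : ∀ n, P * B n = b • (B n * P)) (m : ℤ) :
    P * nthProduct s n A B m = (a * b) • (nthProduct s n A B m * P) := by
  refine LinearMap.ext fun v => ?_
  have hAP' : ∀ n v, P (A n v) = a • A n (P v) := fun n v => LinearMap.congr_fun (hAP n) v
  have hBP' : ∀ n v, P (B n v) = b • B n (P v) := fun n v => LinearMap.congr_fun (hBP n) v
  obtain ⟨K, h1, h2⟩ := ((nthProduct_eventually s n hA hB m v).and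
    (nthProduct_eventually s n hA hB m (P v))).exists
  rw [Module.End.mul_apply, LinearMap.smul_apply, Module.End.mul_apply, h1, h2, map_sum,
    Finset.smul_sum]
  refine Finset.sum_congr rfl fun p _ => ?_
  simp only [map_smul, map_sub, hAP', hBP']
  module

/-- With this, closure under derivatives becomes a special case of closure under products. -/
theorem nthProduct_one (s : ℂ) (A : FormalField H) (hA : IsField A) (hs : s = 1) :
    nthProduct s (-2) A one = derivative A := by
  subst hs
  have h1 : IsField (one : FormalField H) := fun v => ⟨0, fun n hn => by
    rw [one, if_neg (by omega)]; rfl⟩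
  refine funext fun m => LinearMap.ext fun v => ?_
  obtain ⟨K, hK, hK'⟩ := ((nthProduct_eventually 1 (-2) hA h1 m v).and
    (Filter.eventually_ge_atTop (m.natAbs + 2))).exists
  rw [hK]
  have c : ∀ p, signedChoose (-2) p = (p : ℂ) + 1 := fun p => by
    have := signedChoose_neg 1 p
    simpa using this
  simp only [c, derivative, LinearMap.smul_apply, one, one_mul, smul_sub,
    Finset.sum_sub_distrib]
  rcases le_or_gt m (-1) with hm | hm
  · rw [Finset.sum_eq_single_of_mem (-1 - m).toNat (Finset.mem_range.mpr (by omega)),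
      Finset.sum_eq_zero]
    · rw [if_pos (by omega), sub_zero]
      have : (((-1 - m).toNat : ℤ) : ℂ) = -1 - m := by
        rw [Int.toNat_of_nonneg (by omega)]; push_cast; ring
      rw [Int.cast_natCast] at this
      rw [this, show -2 - ((-1 - m).toNat : ℤ) = m - 1 by omega]
      simp only [Module.End.one_apply]
      module
    · intro p _
      rw [if_neg (by omega)]; simp
    · intro p _ hp
      rw [if_neg (by omega)]; simp
  · rw [Finset.sum_eq_zero]
    · rcases eq_or_lt_of_le (show 0 ≤ m by omega) with hm0 | hm0
      · rw [Finset.sum_eq_zero]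
        · simp [← hm0]
        · intro p _
          rw [if_neg (by omega)]; simp
      · rw [Finset.sum_eq_single_of_mem (m - 1).toNat (Finset.mem_range.mpr (by omega))]
        · rw [if_pos (by omega)]
          have : (((m - 1).toNat : ℤ) : ℂ) = m - 1 := by
            rw [Int.toNat_of_nonneg (by omega)]; push_cast; ring
          rw [Int.cast_natCast] at this
          rw [this, show ((m - 1).toNat : ℤ) = m - 1 by omega]
          simp
        · intro p _ hp
          rw [if_neg (by omega)]; simp
    · intro p _
      rw [if_neg (by omega)]; simp

end Covariance

/-! ## From commutation after multiplication by a power of `z - w` to locality -/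

theorem expandOuter_neg (N : ℕ) (p : ℕ) : expandOuter N (-p - N) p = signedChoose (-N) p := by
  rw [expandOuter, if_pos ⟨by omega, by omega⟩, Int.toNat_natCast]
  -- For `N = 0` truncated subtraction gives the right values: `binom(p-1, p)` is `1` at `p = 0` and
  -- `0` for `p > 0`.
  rcases N with _ | N
  · rcases p with _ | p
    · simp
    · simp [signedChoose_zero_succ]
  · rw [show -((N + 1 : ℕ) : ℤ) = -(N : ℤ) - 1 by push_cast; ring, signedChoose_neg]
    congr 2

theorem expandOuter_eq_zero (N : ℕ) (i j : ℤ) (h : ∀ p : ℕ, ¬(i = -p - N ∧ j = p)) :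
    expandOuter N i j = 0 := by
  rw [expandOuter, if_neg]
  rintro ⟨h1, h2⟩
  exact h j.toNat ⟨by omega, by omega⟩

/-- Convolution with the expansion of `(z - w)^{-N}` for `|z| > |w|`. -/
theorem sum_expandOuter (N : ℕ) (P : ℤ × ℤ →₀ ℂ) (i j : ℤ) :
    P.sum (fun q a => a * expandOuter N (i - q.1) (j - q.2)) =
      ∑ᶠ p : ℕ, signedChoose (-N) p * P (i + p + N, j - p) := by
  obtain ⟨K, hK⟩ : ∃ K : ℕ, ∀ q ∈ P.support, j - q.2 < K := by
    refine ⟨(P.support.sup fun q => (j - q.2).toNat) + 1, fun q hq => ?_⟩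
    have := Finset.le_sup (f := fun q : ℤ × ℤ => (j - q.2).toNat) hq
    omega
  rw [finsum_eq_sum_of_support_subset (s := Finset.range K)]
  · have e : ∀ q ∈ P.support, P q * expandOuter N (i - q.1) (j - q.2) =
        ∑ p ∈ Finset.range K, if q = (i + p + N, j - p) then signedChoose (-N) p * P q else 0 := by
      intro q hq
      by_cases h : ∃ p : ℕ, i - q.1 = -p - N ∧ j - q.2 = p
      · obtain ⟨p, h1, h2⟩ := h
        have := hK q hq
        rw [Finset.sum_eq_single_of_mem p (Finset.mem_range.mpr (by omega)), if_pos, h1, h2,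
          expandOuter_neg, mul_comm]
        · exact Prod.ext (by simp only; omega) (by simp only; omega)
        · intro p' _ hp'
          rw [if_neg]
          rintro rfl
          simp only at h2
          omega
      · rw [expandOuter_eq_zero N _ _ (fun p hp => h ⟨p, hp⟩), mul_zero, Finset.sum_eq_zero]
        intro p _
        rw [if_neg]
        rintro rfl
        exact h ⟨p, by simp only; omega, by simp only; omega⟩
    rw [Finsupp.sum, Finset.sum_congr rfl e, Finset.sum_comm]
    refine Finset.sum_congr rfl fun p _ => ?_
    rw [Finset.sum_ite_eq']
    split_ifs with h
    · rfl
    · rw [Finsupp.notMem_support_iff.mp h, mul_zero]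
  · intro p hp
    have h : P (i + p + N, j - p) ≠ 0 := right_ne_zero_of_mul hp
    have := hK _ (Finsupp.mem_support_iff.mpr h)
    rw [Finset.coe_range, Set.mem_Iio]
    omega

section Prehilbert

variable {H : Type*} [NormedAddCommGroup H] [InnerProductSpace ℂ H]

/-- Every matrix coefficient of a mode of sufficiently negative index vanishes. -/
def IsCofield (A : FormalField H) : Prop := ∀ d, ∃ N : ℤ, ∀ n, n ≤ N → ∀ v, inner ℂ d (A n v) = 0

/-- After multiplication by `(z - w)^N` both orders of the matrix coefficient give the same family
`Q`. Each order bounds the support of `Q` on two sides, and together the bounds leave a finite box.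
So `Q` is a Laurent polynomial, and dividing it by `(z - w)^N` in the two domains returns the two
orders. -/
theorem CommutesAfterPower.isLocalWith {ε : ZMod 2} {A B : FormalField H}
    (h : CommutesAfterPower ((-1) ^ ε.val) A B) (hA : IsField A) (hB : IsField B)
    (hA' : IsCofield A) (hB' : IsCofield B) : IsLocalWith ε A B := by
  obtain ⟨N, hN⟩ := h
  refine ⟨N, fun c d => ?_⟩
  let f : ℤ × ℤ → ℂ := fun i => inner ℂ d (A i.1 (B i.2 c))
  let g : ℤ × ℤ → ℂ := fun i => (-1) ^ ε.val * inner ℂ d (B i.2 (A i.1 c))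
  let Q : ℤ × ℤ → ℂ := (diff (1, 0) (0, 1) ^ N) f
  obtain ⟨a₁, ha₁⟩ := hA c
  obtain ⟨b₁, hb₁⟩ := hB c
  obtain ⟨a₀, ha₀⟩ := hA' d
  obtain ⟨b₀, hb₀⟩ := hB' d
  have hf : ∀ i, i.1 ≤ a₀ ∨ b₁ ≤ i.2 → f i = 0 := by
    rintro i (hi | hi)
    · exact ha₀ _ hi _
    · simp only [f]; rw [hb₁ _ hi, map_zero, inner_zero_right]
  have hg : ∀ i, i.2 ≤ b₀ ∨ a₁ ≤ i.1 → g i = 0 := by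
    rintro i (hi | hi)
    · simp only [g]; rw [hb₀ _ hi, mul_zero]
    · simp only [g]; rw [ha₁ _ hi, map_zero, inner_zero_right, mul_zero]
  have hQg : (diff (1, 0) (0, 1) ^ N) g = Q := by
    have e := diff_pow_linearMap (innerₛₗ ℂ d) ((1, 0) : ℤ × ℤ) (0, 1) N
      (fun i : ℤ × ℤ => A i.1 (B i.2 c) - ((-1 : ℂ) ^ ε.val) • B i.2 (A i.1 c))
    rw [hN c] at e
    have e' : (fun i : ℤ × ℤ => innerₛₗ ℂ d
        (A i.1 (B i.2 c) - ((-1 : ℂ) ^ ε.val) • B i.2 (A i.1 c))) = f - g := by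
      funext i
      simp [f, g, inner_sub_right, inner_smul_right]
    rw [e', map_sub] at e
    refine (sub_eq_zero.mp (e.trans ?_)).symm
    funext i; simp
  -- Each factor `z - w` looks one index ahead, so it lowers the lower bound of the support by one
  -- and keeps the upper bound valid.
  have diff_support : ∀ (F : ℤ × ℤ → ℂ) (a b : ℤ) (N : ℕ),
      ((∀ i, i.1 ≤ a ∨ b ≤ i.2 → F i = 0) →
        ∀ i, i.1 ≤ a - N ∨ b ≤ i.2 → (diff (1, 0) (0, 1) ^ N) F i = 0) ∧
      ((∀ i, i.2 ≤ a ∨ b ≤ i.1 → F i = 0) →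
        ∀ i, i.2 ≤ a - N ∨ b ≤ i.1 → (diff (1, 0) (0, 1) ^ N) F i = 0) := by
    intro F a b N
    induction N with
    | zero => simp
    | succ N ih =>
      refine ⟨fun hF i hi => ?_, fun hF i hi => ?_⟩
      · rw [pow_succ', Module.End.mul_apply, diff_apply, ih.1 hF, ih.1 hF, sub_zero] <;>
        · simp only [Prod.fst_add, Prod.snd_add]; push_cast at hi; omega
      · rw [pow_succ', Module.End.mul_apply, diff_apply, ih.2 hF, ih.2 hF, sub_zero] <;>
        · simp only [Prod.fst_add, Prod.snd_add]; push_cast at hi; omega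
  have hQ1 := (diff_support f a₀ b₁ N).1 hf
  have hQ2 := (diff_support g b₀ a₁ N).2 hg
  rw [hQg] at hQ2
  -- Passage from exponents to modes: the mode of index `m` is the coefficient at `z^(-m-1)`.
  let φ : ℤ × ℤ → ℤ × ℤ := fun q => (-q.1 - 1, -q.2 - 1)
  have hfin : (Function.support (Q ∘ φ)).Finite := by
    refine Set.Finite.subset ((Set.finite_Icc (-a₁) (-a₀ + N)).prod
      (Set.finite_Icc (-b₁) (-b₀ + N))) fun q hq => ?_
    have h1 : ¬((φ q).1 ≤ a₀ - N ∨ b₁ ≤ (φ q).2) := fun h => hq (hQ1 (φ q) h)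
    have h2 : ¬((φ q).2 ≤ b₀ - N ∨ a₁ ≤ (φ q).1) := fun h => hq (hQ2 (φ q) h)
    simp only [φ] at h1 h2
    simp only [Set.mem_prod, Set.mem_Icc]
    omega
  have hfT : Truncated (1, 0) (0, 1) f := fun i => by
    filter_upwards [Filter.eventually_ge_atTop (b₁ - i.2).toNat] with p hp
    exact hf _ (Or.inr (by simp; omega))
  have hgT : Truncated (0, 1) (1, 0) g := fun i => by
    filter_upwards [Filter.eventually_ge_atTop (a₁ - i.1).toNat] with p hp
    exact hg _ (Or.inr (by simp; omega))
  refine ⟨Finsupp.ofSupportFinite (Q ∘ φ) hfin, fun m n => ⟨?_, ?_⟩⟩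
  · rw [sum_expandOuter]
    have e := congrFun (expand_neg_diff_pow hfT N) (m, n)
    refine e.symm.trans ?_
    refine finsum_congr fun p => ?_
    rw [smul_eq_mul]
    congr 1
    rw [Finsupp.ofSupportFinite_coe]
    simp only [Function.comp_apply, φ, Q, Prod.smul_mk, Prod.mk_add_mk, smul_eq_mul]
    ring_nf
  · have e := congrFun (expand_neg_diff_pow hgT N) (m, n)
    -- The second order is truncated for the expansion in `w - z`; the resulting sign is the factor
    -- `(-1)^N` in `expandInner`.
    have hswap : (diff (0, 1) (1, 0) ^ N) g = ((-1 : ℂ) ^ N) • Q := by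
      rw [← hQg, show (diff (0, 1) (1, 0) : Module.End ℂ (ℤ × ℤ → ℂ)) =
        (-1 : ℂ) • diff (1, 0) (0, 1) by rw [diff, diff]; module, smul_pow, LinearMap.smul_apply]
    refine e.symm.trans ?_
    let P' : ℤ × ℤ →₀ ℂ := Finsupp.equivMapDomain (Equiv.prodComm ℤ ℤ)
      (Finsupp.ofSupportFinite (Q ∘ φ) hfin)
    have hP' := sum_expandOuter N P' (-n - 1) (-m - 1)
    rw [Finsupp.sum_equivMapDomain] at hP'
    simp only [expandInner]
    have e2 : ((-1 : ℂ) ^ N) * (Finsupp.ofSupportFinite (Q ∘ φ) hfin).sum (fun q a =>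
        a * expandOuter N (-n - 1 - q.2) (-m - 1 - q.1)) =
        (Finsupp.ofSupportFinite (Q ∘ φ) hfin).sum (fun q a =>
        a * ((-1) ^ N * expandOuter N (-n - 1 - q.2) (-m - 1 - q.1))) := by
      rw [Finsupp.mul_sum]
      exact Finsupp.sum_congr fun q _ => by ring
    rw [← e2]
    simp only [Equiv.prodComm_apply, Prod.fst_swap, Prod.snd_swap] at hP'
    rw [hP', hswap, expand, mul_finsum]
    refine finsum_congr fun p => ?_
    · rw [smul_eq_mul, Pi.smul_apply, smul_eq_mul, mul_left_comm]
      congr 2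
      simp only [P', Finsupp.equivMapDomain_apply, Finsupp.ofSupportFinite_coe]
      simp only [Function.comp_apply, φ, Q, Prod.smul_mk, Prod.mk_add_mk, smul_eq_mul, Equiv.prodComm_symm,
        Equiv.prodComm_apply, Prod.swap_prod_mk]
      ring_nf

end Prehilbert

end FormalField

/-! ## The state-field correspondence on the fermion Fock space -/

namespace FockNS

open FormalField

/-! ### Diagonal operators and gradings -/

theorem coord_basisVector (S R : Finset ℕ) : coord (basisVector S) R = if S = R then 1 else 0 := by
  simp [basisVector, Finsupp.single_apply]

theorem sum_coord (v : FockNS) : (coord v).sum (fun S a => a • basisVector S) = v := by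
  apply coord.injective
  simp [Finsupp.sum, basisVector, map_sum]
  exact Finsupp.sum_single (coord v)

theorem map_mem_of_coord {M : Type*} [AddCommGroup M] [Module ℂ M] (f : FockNS →ₗ[ℂ] M)
    (W : Submodule ℂ M) (v : FockNS) (h : ∀ S, coord v S ≠ 0 → f (basisVector S) ∈ W) :
    f v ∈ W := by
  rw [← sum_coord v, Finsupp.sum, map_sum]
  refine Submodule.sum_mem _ fun S hS => ?_
  rw [map_smul]
  exact Submodule.smul_mem _ _ (h S (Finsupp.mem_support_iff.mp hS))

theorem mem_of_coord (W : Submodule ℂ FockNS) (v : FockNS)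
    (h : ∀ S, coord v S ≠ 0 → basisVector S ∈ W) : v ∈ W :=
  map_mem_of_coord LinearMap.id W v h

/-- The operator that multiplies the basis vector of `S` by `f S`. -/
noncomputable def diagonal (f : Finset ℕ → ℂ) : Module.End ℂ FockNS :=
  lift fun S => f S • basisVector S

@[simp] theorem diagonal_basisVector (f : Finset ℕ → ℂ) (S : Finset ℕ) :
    diagonal f (basisVector S) = f S • basisVector S := lift_basisVector _ _

theorem coord_diagonal (f : Finset ℕ → ℂ) (v : FockNS) (S : Finset ℕ) :
    coord (diagonal f v) S = f S * coord v S := by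
  have : (Finsupp.lapply S ∘ₗ coord.toLinearMap) ∘ₗ diagonal f =
      f S • (Finsupp.lapply S ∘ₗ coord.toLinearMap) := by
    refine hom_ext fun R => ?_
    simp only [LinearMap.comp_apply, diagonal_basisVector, map_smul, LinearMap.smul_apply,
      LinearEquiv.coe_coe, Finsupp.lapply_apply, coord_basisVector, smul_eq_mul]
    split_ifs with h
    · rw [h]
    · simp
  exact LinearMap.congr_fun this v

theorem mem_eigenspace_diagonal (f : Finset ℕ → ℂ) (μ : ℂ) (v : FockNS) :
    v ∈ (diagonal f).eigenspace μ ↔ ∀ S, coord v S ≠ 0 → f S = μ := by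
  rw [Module.End.mem_eigenspace_iff, ← coord.injective.eq_iff, Finsupp.ext_iff]
  refine forall_congr' fun S => ?_
  rw [coord_diagonal, map_smul, Finsupp.smul_apply, smul_eq_mul, mul_eq_mul_right_iff]
  tauto

/-- Twice the energy of a basis vector. -/
def degree (S : Finset ℕ) : ℕ := ∑ k ∈ S, (2 * k + 1)

theorem degree_insert {k : ℕ} {S : Finset ℕ} (h : k ∉ S) :
    degree (insert k S) = degree S + (2 * k + 1) := by
  rw [degree, Finset.sum_insert h, add_comm, degree]

theorem degree_erase {k : ℕ} {S : Finset ℕ} (h : k ∈ S) :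
    degree (S.erase k) + (2 * k + 1) = degree S := Finset.sum_erase_add _ _ h

/-- Every fermion contributes an odd doubled energy, so integrality of the energy is parity of the
particle number. -/
theorem degree_mod_two (S : Finset ℕ) : (degree S : ZMod 2) = S.card := by
  rw [degree, Nat.cast_sum, Finset.card_eq_sum_ones, Nat.cast_sum]
  refine Finset.sum_congr rfl fun k _ => ?_
  have : (2 : ZMod 2) = 0 := rfl
  push_cast
  rw [this]; simp

theorem D_eq_diagonal : D = diagonal fun S => (degree S : ℂ) / 2 := by
  refine hom_ext fun S => ?_
  rw [D, lift_basisVector, diagonal_basisVector, degree]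
  congr 1
  push_cast
  rw [Finset.sum_div]
  exact Finset.sum_congr rfl fun k _ => by ring

theorem mem_eigenspace_D (k : ℕ) (v : FockNS) :
    v ∈ D.eigenspace ((k : ℂ) / 2) ↔ ∀ S, coord v S ≠ 0 → degree S = k := by
  rw [D_eq_diagonal, mem_eigenspace_diagonal]
  refine forall_congr' fun S => imp_congr_right fun _ => ?_
  rw [div_left_inj' (by norm_num), Nat.cast_inj]

/-- The vectors all of whose components have twice their energy between `a` and `b`. -/
def band (a b : ℤ) : Submodule ℂ FockNS where
  carrier := {v | ∀ S, coord v S ≠ 0 → a ≤ degree S ∧ (degree S : ℤ) ≤ b}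
  add_mem' := fun {u v} hu hv S h => by
    rw [map_add, Finsupp.add_apply] at h
    by_cases hu' : coord u S = 0
    · exact hv S fun hv' => h (by rw [hu', hv', add_zero])
    · exact hu S hu'
  zero_mem' := fun S h => by simp at h
  smul_mem' := fun c v hv S h => by
    rw [map_smul, Finsupp.smul_apply, smul_eq_mul] at h
    exact hv S (right_ne_zero_of_mul h)

theorem mem_band {a b : ℤ} {v : FockNS} :
    v ∈ band a b ↔ ∀ S, coord v S ≠ 0 → a ≤ degree S ∧ (degree S : ℤ) ≤ b := Iff.rfl

theorem basisVector_mem_band {a b : ℤ} {S : Finset ℕ} :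
    basisVector S ∈ band a b ↔ a ≤ degree S ∧ (degree S : ℤ) ≤ b := by
  simp [mem_band, coord_basisVector]

theorem band_mono {a b a' b' : ℤ} (ha : a' ≤ a) (hb : b ≤ b') : band a b ≤ band a' b' :=
  fun _ hv S hS => ⟨ha.trans (hv S hS).1, (hv S hS).2.trans hb⟩

theorem eq_zero_of_mem_band {a b : ℤ} (hb : b < 0) {v : FockNS} (hv : v ∈ band a b) : v = 0 := by
  apply coord.injective
  rw [map_zero]
  refine Finsupp.ext fun S => ?_
  by_contra h
  have := (hv S h).2
  omega

theorem exists_mem_band (v : FockNS) : ∃ b : ℤ, v ∈ band 0 b := by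
  refine ⟨((coord v).support.sup degree : ℕ), fun S hS => ⟨by omega, ?_⟩⟩
  exact_mod_cast Finset.le_sup (f := degree) (Finsupp.mem_support_iff.mpr hS)

theorem inner_eq_zero_of_mem_band {a b a' b' : ℤ} (h : b < a') {u v : FockNS} (hu : u ∈ band a b)
    (hv : v ∈ band a' b') : inner ℂ u v = 0 := by
  change (coord u).sum (fun S a => (starRingEnd ℂ) a * coord v S) = 0
  refine Finset.sum_eq_zero fun S hS => ?_
  have h1 := (hu S (Finsupp.mem_support_iff.mp hS)).2
  by_cases h0 : coord v S = 0
  · simp only [h0, mul_zero]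
  · have h2 := (hv S h0).1
    omega

/-- The parity operator. -/
noncomputable def parityOp : Module.End ℂ FockNS := diagonal fun S => (-1) ^ S.card

/-- The sign of a parity. -/
theorem neg_one_pow_val_add (ε δ : ZMod 2) :
    (-1 : ℂ) ^ (ε + δ).val = (-1) ^ ε.val * (-1) ^ δ.val := by
  have h : ∀ ε δ : ZMod 2, (-1 : ℤ) ^ (ε + δ).val = (-1) ^ ε.val * (-1) ^ δ.val := by decide
  exact_mod_cast congrArg (Int.cast : ℤ → ℂ) (h ε δ)

theorem neg_one_pow_val_mul_self (ε : ZMod 2) : (-1 : ℂ) ^ ε.val * (-1) ^ ε.val = 1 := by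
  rw [← neg_one_pow_val_add, CharTwo.add_self_eq_zero]; simp

theorem neg_one_pow_val_natCast (n : ℕ) : (-1 : ℂ) ^ (n : ZMod 2).val = (-1) ^ n := by
  rw [ZMod.val_natCast]
  conv_rhs => rw [← Nat.mod_add_div n 2, pow_add, pow_mul]
  simp

theorem neg_one_pow_val_injective {ε δ : ZMod 2} (h : (-1 : ℂ) ^ ε.val = (-1) ^ δ.val) : ε = δ := by
  have h' : ((-1 : ℤ) ^ ε.val) = (-1) ^ δ.val := by exact_mod_cast h
  clear h
  revert ε δ
  decide

theorem mem_eigenspace_parityOp (ε : ZMod 2) (v : FockNS) :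
    v ∈ parityOp.eigenspace ((-1) ^ ε.val) ↔ ∀ S, coord v S ≠ 0 → (S.card : ZMod 2) = ε := by
  rw [parityOp, mem_eigenspace_diagonal]
  refine forall_congr' fun S => imp_congr_right fun _ => ?_
  rw [← neg_one_pow_val_natCast]
  exact ⟨fun h => neg_one_pow_val_injective h, fun h => by rw [h]⟩

theorem parityPart_eq (ε : ZMod 2) : parityPart ε = parityOp.eigenspace ((-1) ^ ε.val) := by
  have hk : ∀ k : ℕ, (k : ℂ) + (ε.val : ℂ) / 2 = ((2 * k + ε.val : ℕ) : ℂ) / 2 := fun k => by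
    push_cast; ring
  have h2 : ((2 : ℕ) : ZMod 2) = 0 := rfl
  refine le_antisymm (iSup_le fun k v hv => ?_) fun v hv => ?_
  · rw [hk, mem_eigenspace_D] at hv
    rw [mem_eigenspace_parityOp]
    intro S hS
    rw [← degree_mod_two, hv S hS, Nat.cast_add, Nat.cast_mul, h2, zero_mul, zero_add,
      ZMod.natCast_zmod_val]
  · rw [mem_eigenspace_parityOp] at hv
    refine mem_of_coord _ _ fun S hS => ?_
    have hS' : (degree S : ZMod 2) = ε := by rw [degree_mod_two, hv S hS]
    refine Submodule.mem_iSup_of_mem (degree S / 2) ?_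
    rw [hk, mem_eigenspace_D]
    intro R hR
    have : S = R := by
      by_contra h
      exact hR (by rw [coord_basisVector, if_neg h])
    rw [← this, ← hS', ZMod.val_natCast]
    omega

/-! ### Vertex fields -/

/-- The fields of parity `ε` on the Fock space that are candidates for `V(a)`. -/
structure IsVertexField (ε : ZMod 2) (A : FormalField FockNS) : Prop where
  -- The mode of index `m` shifts the doubled energy by `-2m` up to an error bounded by `K`. The
  -- upper bound yields `IsField` and the lower one `IsCofield`.
  exists_band : ∃ K : ℤ, ∀ (m a b : ℤ), ∀ v ∈ band a b, A m v ∈ band (a - K - 2 * m) (b + K - 2 * m)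
  vacuum : ∀ n, 0 ≤ n → A n Ω = 0
  covariant : ∀ n, ⁅T, A n⁆ = derivative A n
  parity : ∀ n, parityOp * A n = ((-1 : ℂ) ^ ε.val) • (A n * parityOp)
  -- Only locality with the generator is required; `IsVertexField.commutes` deduces it for every
  -- pair.
  commutes_psi : CommutesAfterPower ((-1) ^ ε.val) A psi

theorem IsVertexField.isField {ε : ZMod 2} {A : FormalField FockNS} (h : IsVertexField ε A) :
    IsField A := fun v => by
  obtain ⟨K, hK⟩ := h.exists_band
  obtain ⟨b, hb⟩ := exists_mem_band v
  exact ⟨(b + K).natAbs + 1, fun n hn => eq_zero_of_mem_band (by omega) (hK n 0 b v hb)⟩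

theorem IsVertexField.isCofield {ε : ZMod 2} {A : FormalField FockNS} (h : IsVertexField ε A) :
    IsCofield A := fun d => by
  obtain ⟨K, hK⟩ := h.exists_band
  obtain ⟨b, hb⟩ := exists_mem_band d
  refine ⟨-((b + K).natAbs + 1), fun n hn v => ?_⟩
  obtain ⟨b', hb'⟩ := exists_mem_band v
  exact inner_eq_zero_of_mem_band (by omega) hb (hK n 0 b' v hb')

/-- The space of vertex fields of parity `ε`. -/
def vertexFields (ε : ZMod 2) : Submodule ℂ (FormalField FockNS) where
  carrier := {A | IsVertexField ε A}
  add_mem' := fun {A B} hA hB => by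
    obtain ⟨K, hK⟩ := hA.exists_band
    obtain ⟨K', hK'⟩ := hB.exists_band
    refine ⟨⟨max K K', fun m a b v hv => Submodule.add_mem _ ?_ ?_⟩, fun n hn => ?_, fun n => ?_,
      fun n => ?_, hA.commutes_psi.add_left hB.commutes_psi⟩
    · exact band_mono (by have := le_max_left K K'; omega) (by have := le_max_left K K'; omega)
        (hK m a b v hv)
    · exact band_mono (by have := le_max_right K K'; omega) (by have := le_max_right K K'; omega)
        (hK' m a b v hv)
    · rw [Pi.add_apply, LinearMap.add_apply, hA.vacuum n hn, hB.vacuum n hn, add_zero]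
    · have h1 := hA.covariant n
      have h2 := hB.covariant n
      simp only [derivative] at h1 h2 ⊢
      rw [Pi.add_apply, lie_add, h1, h2, Pi.add_apply, smul_add]
    · rw [Pi.add_apply, mul_add, hA.parity, hB.parity, add_mul, smul_add]
  zero_mem' := ⟨⟨0, fun _ _ _ _ _ => Submodule.zero_mem _⟩, fun _ _ => rfl, fun n => by
    simp [derivative], fun n => by simp, CommutesAfterPower.zero_left _ _⟩
  smul_mem' := fun c A hA => by
    obtain ⟨K, hK⟩ := hA.exists_band
    refine ⟨⟨K, fun m a b v hv => Submodule.smul_mem _ _ (hK m a b v hv)⟩, fun n hn => ?_,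
      fun n => ?_, fun n => ?_, hA.commutes_psi.smul_left c⟩
    · rw [Pi.smul_apply, LinearMap.smul_apply, hA.vacuum n hn, smul_zero]
    · have h1 := hA.covariant n
      simp only [derivative] at h1 ⊢
      rw [Pi.smul_apply, lie_smul, h1, Pi.smul_apply, smul_comm]
    · rw [Pi.smul_apply, mul_smul_comm, hA.parity, smul_mul_assoc, smul_comm]

theorem IsVertexField.product {ε δ : ZMod 2} {A B : FormalField FockNS} (hA : IsVertexField ε A)
    (hB : IsVertexField δ B) (hAB : CommutesAfterPower ((-1) ^ (ε * δ).val) A B) (n : ℤ) :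
    IsVertexField (ε + δ) (nthProduct ((-1) ^ (ε * δ).val) n A B) where
  exists_band := by
    obtain ⟨K, hK⟩ := hA.exists_band
    obtain ⟨K', hK'⟩ := hB.exists_band
    refine ⟨K + K' + 2 * n.natAbs, fun m a b v hv =>
      nthProduct_mem _ n hA.isField hB.isField m v _ (fun p => ?_) fun p => ?_⟩
    · exact band_mono (by omega) (by omega) (hK _ _ _ _ (hK' (m + p) _ _ _ hv))
    · exact band_mono (by omega) (by omega) (hK' _ _ _ _ (hK p _ _ _ hv))
  vacuum m hm := nthProduct_vacuum _ n hA.isField hB.isField hA.vacuum hB.vacuum m hm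
  covariant m := nthProduct_covariant _ n hA.isField hB.isField hA.covariant hB.covariant m
  parity m := by
    rw [neg_one_pow_val_add]
    exact nthProduct_intertwines n hA.isField hB.isField hA.parity hB.parity m
  commutes_psi := by
    rw [neg_one_pow_val_add]
    exact CommutesAfterPower.product hA.isField hB.isField hAB hA.commutes_psi hB.commutes_psi n

/-! ### The fermion field and the identity are vertex fields. -/

theorem psi_natCast (k : ℕ) : psi k = annihilate k := rfl

theorem psi_neg_sub_one (k : ℕ) : psi (-(k : ℤ) - 1) = create k := by
  rw [show -(k : ℤ) - 1 = Int.negSucc k by omega]; rfl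

theorem annihilate_mem_band (k : ℕ) {a b : ℤ} {v : FockNS} (hv : v ∈ band a b) :
    annihilate k v ∈ band (a - (2 * k + 1)) (b - (2 * k + 1)) := by
  refine map_mem_of_coord _ _ v fun S hS => ?_
  have := hv S hS
  rw [annihilate_basisVector]
  split_ifs with h
  · refine Submodule.smul_mem _ _ (basisVector_mem_band.mpr ?_)
    have := degree_erase h
    omega
  · exact Submodule.zero_mem _

theorem create_mem_band (k : ℕ) {a b : ℤ} {v : FockNS} (hv : v ∈ band a b) :
    create k v ∈ band (a + (2 * k + 1)) (b + (2 * k + 1)) := by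
  refine map_mem_of_coord _ _ v fun S hS => ?_
  have := hv S hS
  rw [create_basisVector]
  split_ifs with h
  · exact Submodule.zero_mem _
  · refine Submodule.smul_mem _ _ (basisVector_mem_band.mpr ?_)
    have := degree_insert h
    omega

theorem psi_mem_band (n : ℤ) {a b : ℤ} {v : FockNS} (hv : v ∈ band a b) :
    psi n v ∈ band (a - (2 * n + 1)) (b - (2 * n + 1)) := by
  rcases n with k | k
  · exact annihilate_mem_band k hv
  · refine band_mono ?_ ?_ (create_mem_band k hv) <;> omega

theorem annihilate_T (k : ℕ) (v : FockNS) :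
    T (annihilate k v) = annihilate k (T v) - (k : ℂ) • annihilate (k - 1) v := by
  have : T * annihilate k = annihilate k * T - (k : ℂ) • annihilate (k - 1) := by
    refine hom_ext fun S => ?_
    simp only [LinearMap.sub_apply, Module.End.mul_apply, LinearMap.smul_apply]
    -- Only `j = k - 1` gives a nonzero anticommutator, so this index is adjoined to the range. For
    -- `k = 0` no such `j` exists, and the truncated `k - 1` is harmless because its coefficient is
    -- zero.
    have h1 : T (annihilate k (basisVector S)) = ∑ j ∈ insert (k - 1) S,
        ((j : ℂ) + 1) • create (j + 1) (annihilate j (annihilate k (basisVector S))) := by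
      rw [annihilate_basisVector]
      split_ifs with hk
      · rw [map_smul, T_basisVector _ (insert (k - 1) S)
          ((Finset.erase_subset k S).trans (Finset.subset_insert _ _)), Finset.smul_sum]
        refine Finset.sum_congr rfl fun j _ => ?_
        simp only [map_smul]
        module
      · simp
    have h2 : ∀ j, create (j + 1) (annihilate j (annihilate k (basisVector S))) =
        annihilate k (create (j + 1) (annihilate j (basisVector S))) -
          if k = j + 1 then annihilate j (basisVector S) else 0 := by
      intro j
      have e1 := LinearMap.congr_fun (annihilate_create k (j + 1)) (annihilate j (basisVector S))
      have e2 := LinearMap.congr_fun (annihilate_annihilate j k) (basisVector S)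
      simp only [LinearMap.add_apply, Module.End.mul_apply, LinearMap.zero_apply] at e1 e2
      rw [eq_neg_of_add_eq_zero_left e2, map_neg, eq_sub_of_add_eq e1]
      split_ifs <;> simp
    rw [h1, T_basisVector S (insert (k - 1) S) (Finset.subset_insert _ _), map_sum]
    simp only [h2, smul_sub, Finset.sum_sub_distrib, map_smul]
    congr 1
    rcases k with _ | k
    · simp
    · simp [Finset.sum_ite_eq]
  exact LinearMap.congr_fun this v

theorem psi_covariant (n : ℤ) : ⁅T, psi n⁆ = derivative psi n := by
  refine LinearMap.ext fun v => ?_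
  rw [Ring.lie_def, LinearMap.sub_apply, Module.End.mul_apply, Module.End.mul_apply, derivative,
    LinearMap.smul_apply, sub_eq_iff_eq_add']
  rcases n with k | k
  · change T (annihilate k v) = annihilate k (T v) + _
    rw [annihilate_T, sub_eq_add_neg, ← neg_smul]
    rcases k with _ | k
    · simp
    · rw [show Int.ofNat (k + 1) - 1 = (k : ℤ) by simp, psi_natCast]
      simp
  · change T (create k v) = create k (T v) + _
    rw [T_create, show Int.negSucc k - 1 = Int.negSucc (k + 1) by omega,
      show psi (Int.negSucc (k + 1)) = create (k + 1) from rfl, Int.cast_negSucc]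
    push_cast
    module

theorem psi_parity (n : ℤ) : parityOp * psi n = (-1 : ℂ) • (psi n * parityOp) := by
  refine hom_ext fun S => ?_
  rcases n with k | k
  · change parityOp (annihilate k (basisVector S)) =
      (-1 : ℂ) • annihilate k (parityOp (basisVector S))
    simp only [parityOp, diagonal_basisVector, map_smul, annihilate_basisVector]
    split_ifs with h
    · rw [map_smul, diagonal_basisVector, ← Finset.card_erase_add_one h, pow_succ]
      module
    · simp
  · change parityOp (create k (basisVector S)) =
      (-1 : ℂ) • create k (parityOp (basisVector S))
    simp only [parityOp, diagonal_basisVector, map_smul, create_basisVector]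
    split_ifs with h
    · simp
    · rw [map_smul, diagonal_basisVector, Finset.card_insert_of_notMem h, pow_succ]
      module

theorem isVertexField_psi : IsVertexField 1 psi where
  exists_band := ⟨1, fun m a b v hv => band_mono (by omega) (by omega) (psi_mem_band m hv)⟩
  vacuum := psi_vacuum
  covariant := psi_covariant
  parity n := by rw [psi_parity, ZMod.val_one, pow_one]
  commutes_psi := by
    refine ⟨1, fun v => funext fun i => ?_⟩
    -- The anticommutator depends only on `m + n`, which both shifts raise by one; hence a single
    -- factor `z - w` suffices.
    have h : ∀ m n : ℤ, psi m (psi n v) - ((-1 : ℂ) ^ (1 : ZMod 2).val) • psi n (psi m v) =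
        if m + n = -1 then v else 0 := fun m n => by
      have := LinearMap.congr_fun (psi_anticommute m n) v
      rw [ZMod.val_one, pow_one, neg_one_smul, sub_neg_eq_add]
      refine this.trans ?_
      split_ifs <;> rfl
    rw [pow_one, diff_apply, h, h]
    simp only [Prod.fst_add, Prod.snd_add, add_zero, Pi.zero_apply]
    rw [add_right_comm, add_assoc, sub_self]

theorem isVertexField_one : IsVertexField 0 (one : FormalField FockNS) where
  exists_band := ⟨2, fun m a b v hv => by
    rw [one]
    split_ifs with h
    · exact band_mono (by omega) (by omega) hv
    · exact Submodule.zero_mem _⟩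
  vacuum n hn := by rw [one, if_neg (by omega)]; rfl
  covariant n := by
    rw [Ring.lie_def, derivative, one, one]
    by_cases h : n = -1
    · rw [if_pos h, if_neg (by omega)]; simp
    · by_cases h0 : n = 0
      · simp [h0]
      · rw [if_neg h, if_neg (by omega)]; simp
  parity n := by
    rw [one]
    split_ifs <;> simp
  commutes_psi := by
    refine ⟨0, fun v => funext fun i => ?_⟩
    by_cases h : i.1 = -1 <;> simp [one, h]

/-- A vertex field is determined by the vector that it creates from the vacuum. -/
theorem IsVertexField.eq_zero {ε : ZMod 2} {A : FormalField FockNS} (h : IsVertexField ε A)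
    (h0 : A (-1) Ω = 0) : A = 0 := by
  -- Since `T Ω = 0`, covariance gives `T A(n) Ω = -n A(n-1) Ω`. For `n < 0` the factor is nonzero,
  -- so vanishing descends from `n = -1`.
  have hΩ : ∀ n, A n Ω = 0 := by
    have : ∀ k : ℕ, A (-(k : ℤ) - 1) Ω = 0 := fun k => by
      induction k with
      | zero => simpa using h0
      | succ k ih =>
        have e := LinearMap.congr_fun (h.covariant (-(k : ℤ) - 1)) Ω
        rw [Ring.lie_def, LinearMap.sub_apply, Module.End.mul_apply, Module.End.mul_apply, ih,
          T_vacuum, map_zero, map_zero, sub_zero, derivative, LinearMap.smul_apply] at e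
        have hne : -((-(k : ℤ) - 1 : ℤ) : ℂ) ≠ 0 := by
          rw [neg_ne_zero, Int.cast_ne_zero]; omega
        have := (smul_eq_zero.mp e.symm).resolve_left hne
        rwa [show -(k : ℤ) - 1 - 1 = -((k + 1 : ℕ) : ℤ) - 1 by push_cast; ring] at this
    intro n
    rcases le_or_gt 0 n with hn | hn
    · exact h.vacuum n hn
    · rw [show n = -((-n - 1).toNat : ℤ) - 1 by omega]
      exact this _
  -- When `A(z) u = 0`, locality reads `(z - w)^N A(z) ψ(w) u = 0`. This family is truncated because
  -- `psi` is a field, so the power can be cancelled.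
  have step : ∀ u, (∀ m, A m u = 0) → ∀ n m, A m (psi n u) = 0 := by
    intro u hu n m
    obtain ⟨N, hN⟩ := h.commutes_psi
    have hN' := hN u
    have hF : (fun i : ℤ × ℤ => A i.1 (psi i.2 u) - ((-1 : ℂ) ^ ε.val) • psi i.2 (A i.1 u)) =
        pairing A psi u := by
      funext i
      simp only [hu, map_zero, smul_zero, sub_zero, pairing]
    rw [hF] at hN'
    have e := expand_neg_diff_pow (isVertexField_psi.isField.truncated_pairing A u) N
    rw [hN', expand_zero_right] at e
    exact (congrFun e (m, n)).symm
  have hb : ∀ S : Finset ℕ, ∀ m, A m (basisVector S) = 0 := fun S => by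
    induction S using Finset.induction_on_min with
    | empty => exact hΩ
    | insert k S hk ih =>
      intro m
      rw [← create_ordered k S hk, ← psi_neg_sub_one]
      exact step _ ih _ _
  exact funext fun m => hom_ext fun S => hb S m

/-- The vector created from the vacuum by a vertex field has the parity of the field. -/
theorem IsVertexField.creation_mem {ε : ZMod 2} {A : FormalField FockNS} (h : IsVertexField ε A)
    (n : ℤ) : A n Ω ∈ parityPart ε := by
  rw [parityPart_eq, Module.End.mem_eigenspace_iff, ← Module.End.mul_apply, h.parity,
    LinearMap.smul_apply, Module.End.mul_apply, Ω, parityOp, diagonal_basisVector]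
  simp

/-- The field of `ψ_{-k-1/2} b` is the product of index `-k-1` of `psi` with the field of `b`.
Locality with every vertex field is carried through the induction: it permits the next product, and
Dong's lemma reproduces it. -/
theorem exists_vertexField (S : Finset ℕ) : ∃ A : FormalField FockNS,
    IsVertexField (S.card : ZMod 2) A ∧ A (-1) Ω = basisVector S ∧ Generated {psi} A ∧
      ∀ (ε : ZMod 2) (C : FormalField FockNS), IsVertexField ε C →
        CommutesAfterPower ((-1) ^ (ε * (S.card : ZMod 2)).val) C A := by
  induction S using Finset.induction_on_min with
  | empty =>
    refine ⟨one, by simpa using isVertexField_one, ?_, Generated.one, fun ε C hC =>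
      ⟨0, fun v => funext fun i => ?_⟩⟩
    · simp [one, Ω]
    · by_cases h : i.2 = -1 <;> simp [one, h]
  | insert k S hk ih =>
    obtain ⟨B, hB, hBΩ, hBg, hBl⟩ := ih
    have hpB := hBl 1 psi isVertexField_psi
    have hcard : ((insert k S).card : ZMod 2) = 1 + S.card := by
      rw [Finset.card_insert_of_notMem fun h => lt_irrefl _ (hk k h)]
      push_cast; ring
    rw [hcard]
    refine ⟨nthProduct ((-1) ^ (1 * (S.card : ZMod 2)).val) (-(k : ℤ) - 1) psi B,
      isVertexField_psi.product hB hpB _, ?_,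
      Generated.product (Generated.base rfl) hBg (hpB.isLocalWith isVertexField_psi.isField
        hB.isField isVertexField_psi.isCofield hB.isCofield)
        (isNthProduct_nthProduct _ _ isVertexField_psi.isField hB.isField), fun ε C hC => ?_⟩
    · rw [nthProduct_creation _ _ isVertexField_psi.isField hB.isField psi_vacuum hB.vacuum, hBΩ,
        psi_neg_sub_one, create_ordered k S hk]
    · refine CommutesAfterPower.symm (neg_one_pow_val_mul_self _) ?_
      rw [mul_add, mul_one, neg_one_pow_val_add]
      exact CommutesAfterPower.product isVertexField_psi.isField hB.isField hpB
        (hC.commutes_psi.symm (neg_one_pow_val_mul_self _))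
        ((hBl ε C hC).symm (neg_one_pow_val_mul_self _)) _

/-- The state-field correspondence. -/
noncomputable def stateField : FockNS →ₗ[ℂ] FormalField FockNS :=
  lift fun S => (exists_vertexField S).choose

theorem stateField_basisVector (S : Finset ℕ) :
    IsVertexField (S.card : ZMod 2) (stateField (basisVector S)) ∧
    stateField (basisVector S) (-1) Ω = basisVector S ∧
    Generated {psi} (stateField (basisVector S)) ∧
      ∀ (ε : ZMod 2) (C : FormalField FockNS), IsVertexField ε C →
        CommutesAfterPower ((-1) ^ (ε * (S.card : ZMod 2)).val) C (stateField (basisVector S)) := by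
  rw [stateField, lift_basisVector]
  exact (exists_vertexField S).choose_spec

theorem stateField_creation (a : FockNS) : stateField a (-1) Ω = a := by
  have : (LinearMap.applyₗ Ω ∘ₗ LinearMap.proj (-1)) ∘ₗ stateField = LinearMap.id :=
    hom_ext fun S => (stateField_basisVector S).2.1
  exact LinearMap.congr_fun this a

theorem isVertexField_stateField {ε : ZMod 2} {a : FockNS} (ha : a ∈ parityPart ε) :
    IsVertexField ε (stateField a) := by
  rw [parityPart_eq, mem_eigenspace_parityOp] at ha
  refine map_mem_of_coord stateField (vertexFields ε) a fun S hS => ?_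
  rw [← ha S hS]
  exact (stateField_basisVector S).1

/-- The difference is a vertex field that creates zero. Identities between vertex fields are thereby
reduced to equalities of vectors. -/
theorem IsVertexField.eq_stateField {ε : ZMod 2} {A : FormalField FockNS} (h : IsVertexField ε A) :
    stateField (A (-1) Ω) = A := by
  have h1 : A - stateField (A (-1) Ω) ∈ vertexFields ε :=
    Submodule.sub_mem _ h (isVertexField_stateField (h.creation_mem (-1)))
  refine (sub_eq_zero.mp (IsVertexField.eq_zero h1 ?_)).symm
  rw [Pi.sub_apply, LinearMap.sub_apply, stateField_creation, sub_self]

/-- The fields that commute with `C` up to the sign `s` after multiplication by a power of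
`z - w`. -/
def commutant (s : ℂ) (C : FormalField FockNS) : Submodule ℂ (FormalField FockNS) where
  carrier := {A | CommutesAfterPower s A C}
  add_mem' := CommutesAfterPower.add_left
  zero_mem' := CommutesAfterPower.zero_left s C
  smul_mem' := fun c _ h => CommutesAfterPower.smul_left h c

/-- By uniqueness `B` is a linear combination of the chosen monomial fields, each of which is local
with every vertex field. -/
theorem IsVertexField.commutes {ε δ : ZMod 2} {A B : FormalField FockNS} (hA : IsVertexField ε A)
    (hB : IsVertexField δ B) : CommutesAfterPower ((-1) ^ (ε * δ).val) A B := by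
  refine CommutesAfterPower.symm (neg_one_pow_val_mul_self _) ?_
  have hb := hB.creation_mem (-1)
  rw [parityPart_eq, mem_eigenspace_parityOp] at hb
  rw [← hB.eq_stateField]
  refine map_mem_of_coord stateField (commutant _ A) _ fun S hS => ?_
  rw [← hb S hS]
  exact ((stateField_basisVector S).2.2.2 ε A hA).symm (neg_one_pow_val_mul_self _)

theorem IsVertexField.isLocalWith {ε δ : ZMod 2} {A B : FormalField FockNS}
    (hA : IsVertexField ε A) (hB : IsVertexField δ B) : IsLocalWith (ε * δ) A B :=
  (hA.commutes hB).isLocalWith hA.isField hB.isField hA.isCofield hB.isCofield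

/-- The product is again a vertex field and creates `a(n)b` from the vacuum, so uniqueness
identifies it. -/
theorem isNthProduct_stateField {ε δ : ZMod 2} {a b : FockNS} (ha : a ∈ parityPart ε)
    (hb : b ∈ parityPart δ) (n : ℤ) : stateField a n b ∈ parityPart (ε + δ) ∧
      IsNthProduct (ε * δ) n (stateField a) (stateField b) (stateField (stateField a n b)) := by
  have hA := isVertexField_stateField ha
  have hB := isVertexField_stateField hb
  have hC := hA.product hB (hA.commutes hB) n
  have e := nthProduct_creation ((-1) ^ (ε * δ).val) n hA.isField hB.isField hA.vacuum hB.vacuum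
  rw [stateField_creation] at e
  refine ⟨e ▸ hC.creation_mem (-1), ?_⟩
  rw [← e, hC.eq_stateField]
  exact isNthProduct_nthProduct _ _ hA.isField hB.isField

end FockNS

/-! ## The fields generated by the fermion field -/

namespace FormalField

/-! ### From locality back to commutation after a power of `z - w`. -/

theorem expandOuter_eq (N : ℕ) (i j : ℤ) : expandOuter N i j =
    if 0 ≤ j ∧ i = -j - N then signedChoose (-N) j.toNat else 0 := by
  split_ifs with h
  · obtain ⟨h1, rfl⟩ := h
    obtain ⟨p, rfl⟩ := Int.eq_ofNat_of_zero_le h1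
    exact expandOuter_neg N p
  · exact expandOuter_eq_zero N i j fun p hp => h ⟨by omega, by omega⟩

theorem expandOuter_succ (N : ℕ) (i j : ℤ) :
    expandOuter (N + 1) (i - 1) j - expandOuter (N + 1) i (j - 1) = expandOuter N i j := by
  simp only [expandOuter_eq]
  by_cases h : 0 ≤ j ∧ i = -j - N
  · obtain ⟨hj, rfl⟩ := h
    obtain ⟨p, rfl⟩ := Int.eq_ofNat_of_zero_le hj
    rw [if_pos (show 0 ≤ (p : ℤ) ∧ -(p : ℤ) - N - 1 = -(p : ℤ) - (N + 1 : ℕ) from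
        ⟨hj, by push_cast; ring⟩),
      if_pos (show 0 ≤ (p : ℤ) ∧ -(p : ℤ) - N = -(p : ℤ) - N from ⟨hj, rfl⟩)]
    rcases p with _ | p
    · rw [if_neg (by simp)]
      simp
    · rw [if_pos ⟨by push_cast; omega, by push_cast; ring⟩]
      have := signedChoose_succ_succ (-((N + 1 : ℕ) : ℤ)) p
      rw [show -((N + 1 : ℕ) : ℤ) + 1 = -N by push_cast; ring] at this
      rw [show ((p + 1 : ℕ) : ℤ) - 1 = p by push_cast; ring, Int.toNat_natCast, Int.toNat_natCast,
        this]
  · rw [if_neg h, if_neg fun h' => h ⟨h'.1, by have := h'.2; push_cast at this; omega⟩,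
      if_neg fun h' => h ⟨by omega, by have := h'.2; push_cast at this; omega⟩, sub_zero]

theorem expandInner_succ (N : ℕ) (i j : ℤ) :
    expandInner (N + 1) (i - 1) j - expandInner (N + 1) i (j - 1) = expandInner N i j := by
  simp only [expandInner, ← expandOuter_succ N j i, pow_succ]
  ring

theorem expandOuter_zero (i j : ℤ) : expandOuter 0 i j = if i = 0 ∧ j = 0 then 1 else 0 := by
  rw [expandOuter_eq]
  by_cases h : 0 ≤ j ∧ i = -j - (0 : ℕ)
  · obtain ⟨hj, rfl⟩ := h
    obtain ⟨p, rfl⟩ := Int.eq_ofNat_of_zero_le hj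
    rw [if_pos ⟨hj, rfl⟩]
    rcases p with _ | p
    · simp
    · rw [if_neg (by push_cast; omega), Int.toNat_natCast]
      exact signedChoose_zero_succ p
  · rw [if_neg h, if_neg (by push_cast at h; omega)]

theorem expandInner_zero (i j : ℤ) : expandInner 0 i j = expandOuter 0 i j := by
  rw [expandInner, expandOuter_zero, expandOuter_zero, pow_zero, one_mul]
  exact if_congr and_comm rfl rfl

/-- Stated for an abstract family `E` so that it clears the denominator in both expansions; the
common result is the numerator `P`. -/
theorem diff_pow_sum (P : ℤ × ℤ →₀ ℂ) (E : ℕ → ℤ → ℤ → ℂ)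
    (hE : ∀ N i j, E (N + 1) (i - 1) j - E (N + 1) i (j - 1) = E N i j) (N : ℕ) :
    (diff (1, 0) (0, 1) ^ N) (fun m : ℤ × ℤ =>
      P.sum fun q a => a * E N (-m.1 - 1 - q.1) (-m.2 - 1 - q.2)) =
      fun m => P.sum fun q a => a * E 0 (-m.1 - 1 - q.1) (-m.2 - 1 - q.2) := by
  induction N with
  | zero => rfl
  | succ N ih =>
    rw [pow_succ, Module.End.mul_apply, ← ih]
    congr 1
    funext m
    rw [diff_apply, ← Finsupp.sum_sub]
    refine Finsupp.sum_congr fun q _ => ?_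
    rw [← mul_sub, ← hE N]
    simp only [Prod.fst_add, Prod.snd_add, add_zero]
    rw [show -(m.1 + 1) - 1 - q.1 = -m.1 - 1 - q.1 - 1 by ring,
      show -(m.2 + 1) - 1 - q.2 = -m.2 - 1 - q.2 - 1 by ring]

variable {H : Type*} [NormedAddCommGroup H] [InnerProductSpace ℂ H]

theorem IsLocalWith.exists_diff_pow_eq_zero {ε : ZMod 2} {A B : FormalField H}
    (h : IsLocalWith ε A B) : ∃ N₀ : ℕ, ∀ N, N₀ ≤ N → ∀ c d, (diff (1, 0) (0, 1) ^ N)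
      ((fun i : ℤ × ℤ => inner ℂ d (A i.1 (B i.2 c))) -
        fun i : ℤ × ℤ => (-1 : ℂ) ^ ε.val * inner ℂ d (B i.2 (A i.1 c))) = 0 := by
  obtain ⟨N, h⟩ := h
  refine ⟨N, fun N' hN' c d => diff_pow_eq_zero_of_le ?_ hN'⟩
  obtain ⟨P, hP⟩ := h c d
  have h1 : (fun i : ℤ × ℤ => inner ℂ d (A i.1 (B i.2 c))) = fun i : ℤ × ℤ =>
      P.sum fun q a => a * expandOuter N (-i.1 - 1 - q.1) (-i.2 - 1 - q.2) :=
    funext fun i => (hP i.1 i.2).1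
  have h2 : (fun i : ℤ × ℤ => (-1 : ℂ) ^ ε.val * inner ℂ d (B i.2 (A i.1 c))) = fun i : ℤ × ℤ =>
      P.sum fun q a => a * expandInner N (-i.1 - 1 - q.1) (-i.2 - 1 - q.2) :=
    funext fun i => (hP i.1 i.2).2
  rw [map_sub, h1, h2, diff_pow_sum P expandOuter expandOuter_succ,
    diff_pow_sum P expandInner expandInner_succ]
  simp only [expandInner_zero, sub_self]

/-- Fields that are local with both signs have vanishing products. -/
theorem IsLocalWith.mul_eq_zero {ε δ : ZMod 2} (hne : ε ≠ δ) {A B : FormalField H}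
    (hA : IsField A) (hB : IsField B) (h : IsLocalWith ε A B) (h' : IsLocalWith δ A B)
    (m n : ℤ) (c : H) : A m (B n c) = 0 ∧ B n (A m c) = 0 := by
  obtain ⟨N, hN⟩ := h.exists_diff_pow_eq_zero
  obtain ⟨N', hN'⟩ := h'.exists_diff_pow_eq_zero
  have hs : (-1 : ℂ) ^ δ.val = -(-1) ^ ε.val := by
    have : ∀ ε δ : ZMod 2, ε ≠ δ → (-1 : ℤ) ^ δ.val = -(-1) ^ ε.val := by decide
    exact_mod_cast congrArg (Int.cast : ℤ → ℂ) (this ε δ hne)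
  have hs0 : (-1 : ℂ) ^ ε.val ≠ 0 := pow_ne_zero _ (by norm_num)
  obtain ⟨a, ha⟩ := hA c
  obtain ⟨b, hb⟩ := hB c
  have key : ∀ d, inner ℂ d (A m (B n c)) = 0 ∧ (-1 : ℂ) ^ ε.val * inner ℂ d (B n (A m c)) = 0 := by
    intro d
    let f : ℤ × ℤ → ℂ := fun i => inner ℂ d (A i.1 (B i.2 c))
    let g : ℤ × ℤ → ℂ := fun i => (-1 : ℂ) ^ ε.val * inner ℂ d (B i.2 (A i.1 c))
    -- The two signs are opposite, so a power of `z - w` kills both `f - g` and `f + g`, hence `f`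
    -- and `g` separately. Each is truncated in its own domain and therefore zero.
    have e1 : (diff (1, 0) (0, 1) ^ (N + N')) (f - g) = 0 := hN _ (by omega) c d
    have e2 : (diff (1, 0) (0, 1) ^ (N + N')) (f + g) = 0 := by
      have := hN' (N + N') (by omega) c d
      have e : (f + g) = f - fun i : ℤ × ℤ => (-1 : ℂ) ^ δ.val * inner ℂ d (B i.2 (A i.1 c)) := by
        funext i
        simp only [f, g, Pi.add_apply, Pi.sub_apply, hs]; ring
      rw [e]; exact this
    rw [map_sub] at e1
    rw [map_add] at e2
    have hg0 : (diff (1, 0) (0, 1) ^ (N + N')) g = 0 := by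
      rw [sub_eq_zero.mp e1] at e2
      exact self_eq_neg.mp (eq_neg_of_add_eq_zero_left e2)
    have hf0 : (diff (1, 0) (0, 1) ^ (N + N')) f = 0 := (sub_eq_zero.mp e1).trans hg0
    have hfT : Truncated (1, 0) (0, 1) f := fun i => by
      filter_upwards [Filter.eventually_ge_atTop (b - i.2).toNat] with p hp
      simp only [f]
      rw [hb _ (by simp; omega), map_zero, inner_zero_right]
    have hgT : Truncated (0, 1) (1, 0) g := fun i => by
      filter_upwards [Filter.eventually_ge_atTop (a - i.1).toNat] with p hp
      simp only [g]
      rw [ha _ (by simp; omega), map_zero, inner_zero_right, mul_zero]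
    have hg0' : (diff (0, 1) (1, 0) ^ (N + N')) g = 0 := by
      rw [show (diff (0, 1) (1, 0) : Module.End ℂ (ℤ × ℤ → ℂ)) = -diff (1, 0) (0, 1) by
        rw [diff, diff]; module]
      exact neg_pow_apply_eq_zero hg0
    have r1 := expand_neg_diff_pow hfT (N + N')
    have r2 := expand_neg_diff_pow hgT (N + N')
    rw [hf0, expand_zero_right] at r1
    rw [hg0', expand_zero_right] at r2
    exact ⟨(congrFun r1 (m, n)).symm, (congrFun r2 (m, n)).symm⟩
  refine ⟨?_, ?_⟩
  · exact inner_self_eq_zero.mp (key _).1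
  · exact inner_self_eq_zero.mp ((_root_.mul_eq_zero.mp (key _).2).resolve_left hs0)

end FormalField

namespace FockNS

open FormalField

/-! ### The generated fields are exactly the fields of states. -/

theorem basis_induction {p : FockNS → Prop} (basis : ∀ S, p (basisVector S)) (zero : p 0)
    (add : ∀ u v, p u → p v → p (u + v)) (smul : ∀ (a : ℂ) v, p v → p (a • v)) (v : FockNS) :
    p v := by
  have hv : v ∈ Submodule.span ℂ (Set.range basisVector) := span_basisVector ▸ Submodule.mem_top
  induction hv using Submodule.span_induction with
  | zero => exact zero
  | add x y _ _ hx hy => exact add x y hx hy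
  | smul a x _ hx => exact smul a x hx
  | mem x hx => obtain ⟨S, rfl⟩ := hx; exact basis S

theorem IsVertexField.derivative {ε : ZMod 2} {A : FormalField FockNS} (h : IsVertexField ε A) :
    IsVertexField ε (derivative A) := by
  have := h.product isVertexField_one (h.commutes isVertexField_one) (-2)
  rwa [nthProduct_one _ _ h.isField (by simp), add_zero] at this

theorem exists_isVertexField_of_generated {A : FormalField FockNS} (h : Generated {psi} A) :
    ∃ ε, IsVertexField ε A := by
  induction h with
  | one => exact ⟨0, isVertexField_one⟩
  | base hA => rw [Set.mem_singleton_iff.mp hA]; exact ⟨1, isVertexField_psi⟩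
  | derivative _ ih => obtain ⟨ε, h⟩ := ih; exact ⟨ε, h.derivative⟩
  | @product A B C δ n _ _ hl hp ihA ihB =>
    obtain ⟨ε₁, hA⟩ := ihA
    obtain ⟨ε₂, hB⟩ := ihB
    by_cases hδ : δ = ε₁ * ε₂
    · subst hδ
      rw [hp.unique (isNthProduct_nthProduct _ n hA.isField hB.isField)]
      exact ⟨_, hA.product hB (hA.commutes hB) n⟩
    -- The generation rule allows any sign for which the fields are local. A sign other than the one
    -- given by the parities forces all products of modes to vanish, and `C` is zero.
    · have h0 := hl.mul_eq_zero hδ hA.isField hB.isField (hA.isLocalWith hB)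
      suffices C = 0 from ⟨0, this ▸ (vertexFields 0).zero_mem⟩
      refine funext fun m => LinearMap.ext fun v => ?_
      rcases le_or_gt 0 n with hn | hn
      · rw [hp.1 hn m, LinearMap.sum_apply]
        refine Finset.sum_eq_zero fun p _ => ?_
        simp [superBracket, (h0 _ _ _).1, (h0 _ _ _).2]
      · obtain ⟨M, hM⟩ := (hp.2 hn m v).exists
        rw [hM]
        refine Finset.sum_eq_zero fun p _ => ?_
        simp [(h0 _ _ _).1, (h0 _ _ _).2]

theorem range_stateField : LinearMap.range stateField = generatedSpace {psi} := by
  refine le_antisymm ?_ (Submodule.span_le.mpr fun A hA => ?_)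
  · rintro _ ⟨a, rfl⟩
    exact map_mem_of_coord stateField _ a fun S _ =>
      Submodule.subset_span (stateField_basisVector S).2.2.1
  · obtain ⟨ε, h⟩ := exists_isVertexField_of_generated hA
    exact ⟨_, h.eq_stateField⟩

theorem stateField_creation_of_mem {A : FormalField FockNS} (hA : A ∈ generatedSpace {psi}) :
    stateField (A (-1) Ω) = A := by
  rw [← range_stateField] at hA
  obtain ⟨a, rfl⟩ := hA
  rw [stateField_creation]

theorem stateField_psi : stateField (psi (-1) Ω) = psi := isVertexField_psi.eq_stateField

theorem stateField_vacuum : stateField Ω = one := by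
  have := isVertexField_one.eq_stateField
  simpa [one] using this

theorem stateField_annihilates_vacuum (a : FockNS) (n : ℤ) (hn : 0 ≤ n) :
    stateField a n Ω = 0 := by
  induction a using basis_induction with
  | basis S => exact (stateField_basisVector S).1.vacuum n hn
  | zero => simp
  | add u v hu hv => rw [map_add, Pi.add_apply, LinearMap.add_apply, hu, hv, add_zero]
  | smul c v hv => rw [map_smul, Pi.smul_apply, LinearMap.smul_apply, hv, smul_zero]

theorem stateField_covariant (a : FockNS) (n : ℤ) :
    ⁅T, stateField a n⁆ = derivative (stateField a) n := by
  induction a using basis_induction with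
  | basis S => exact (stateField_basisVector S).1.covariant n
  | zero => simp [derivative]
  | add u v hu hv =>
    simp only [derivative] at hu hv ⊢
    rw [map_add, Pi.add_apply, lie_add, hu, hv, Pi.add_apply, smul_add]
  | smul c v hv =>
    simp only [derivative] at hv ⊢
    rw [map_smul, Pi.smul_apply, lie_smul, hv, Pi.smul_apply, smul_comm]

/-- For a basis vector both sides are vertex fields, and covariance applied to the vacuum shows that
`A'` creates `T A(-1) Ω`. -/
theorem derivative_stateField (a : FockNS) :
    derivative (stateField a) = stateField (T a) := by
  induction a using basis_induction with
  | basis S =>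
    have h := (stateField_basisVector S).1
    rw [← h.derivative.eq_stateField, ← h.covariant, Ring.lie_def, LinearMap.sub_apply,
      Module.End.mul_apply, Module.End.mul_apply, T_vacuum, map_zero, sub_zero,
      stateField_creation]
  | zero =>
    rw [map_zero, map_zero, map_zero]
    funext n
    simp [derivative]
  | add u v hu hv =>
    rw [map_add, map_add, map_add, ← hu, ← hv]
    funext n
    simp [derivative]
  | smul c v hv =>
    rw [map_smul, map_smul, map_smul, ← hv]
    funext n
    simp [derivative, smul_comm c]

/-! ### Irreducibility -/

theorem create_annihilate (k : ℕ) :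
    create k * annihilate k = diagonal fun S => if k ∈ S then 1 else 0 := by
  refine hom_ext fun S => ?_
  rw [Module.End.mul_apply, annihilate_basisVector, diagonal_basisVector]
  split_ifs with h
  · rw [map_smul, create_basisVector, if_neg (Finset.notMem_erase k S), Finset.insert_erase h,
      sign_erase _ _ _ h, if_neg (lt_irrefl k), smul_smul, sign_mul_self]
  · simp

/-- A vector annihilated by all annihilation operators is a multiple of the vacuum. -/
theorem eq_smul_vacuum {v : FockNS} (h : ∀ k, annihilate k v = 0) : v = coord v ∅ • Ω := by
  apply coord.injective
  refine Finsupp.ext fun S => ?_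
  rw [map_smul, Finsupp.smul_apply, Ω, coord_basisVector, smul_eq_mul]
  split_ifs with hS
  · rw [← hS, mul_one]
  · obtain ⟨k, hk⟩ := Finset.nonempty_iff_ne_empty.mpr (Ne.symm hS)
    have := congrArg (fun u => coord u S) (LinearMap.congr_fun (create_annihilate k) v)
    simp only [Module.End.mul_apply, h k, map_zero, coord_diagonal, if_pos hk, one_mul] at this
    rw [← this, mul_zero]; rfl

/-- Annihilation operators strictly lower the energy, so a nonzero vector of `W` can be lowered
until they all kill it; it is then a nonzero multiple of the vacuum. -/
theorem vacuum_mem_of_ne_bot {W : Submodule ℂ FockNS} (hW : ∀ k, ∀ w ∈ W, annihilate k w ∈ W)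
    (h : W ≠ ⊥) : Ω ∈ W := by
  have key : ∀ (b : ℕ) (v : FockNS), v ∈ W → v ≠ 0 → v ∈ band 0 b → Ω ∈ W := by
    intro b
    induction b using Nat.strong_induction_on with
    | _ b ih =>
      intro v hv hv0 hb
      by_cases hk : ∀ k, annihilate k v = 0
      · have e := eq_smul_vacuum hk
        have hc : coord v ∅ ≠ 0 := fun hc => hv0 (by rw [e, hc, zero_smul])
        rw [e] at hv
        exact (W.smul_mem_iff hc).mp hv
      · push Not at hk
        obtain ⟨k, hk⟩ := hk
        have hb' := annihilate_mem_band k hb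
        have hlt : 2 * k + 1 ≤ b := by
          by_contra hlt
          exact hk (eq_zero_of_mem_band (by omega) hb')
        refine ih (b - (2 * k + 1)) (by omega) _ (hW k v hv) hk fun S hS => ⟨by omega, ?_⟩
        have := (hb' S hS).2
        omega
  obtain ⟨v, hv, hv0⟩ := Submodule.exists_mem_ne_zero_of_ne_bot h
  obtain ⟨b, hb⟩ := exists_mem_band v
  exact key b.toNat v hv hv0 (band_mono le_rfl (Int.self_le_toNat b) hb)

theorem eq_top_of_vacuum_mem {W : Submodule ℂ FockNS} (hW : ∀ k, ∀ w ∈ W, create k w ∈ W)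
    (h : Ω ∈ W) : W = ⊤ := by
  have hb : ∀ S : Finset ℕ, basisVector S ∈ W := fun S => by
    induction S using Finset.induction_on_min with
    | empty => exact h
    | insert k S hk ih =>
      rw [← create_ordered k S hk]
      exact hW k _ ih
  exact top_unique fun v _ => mem_of_coord W v fun S _ => hb S

/-- An operator that commutes with the fermions and annihilates the vacuum vanishes. -/
theorem eq_zero_of_commute {X : Module.End ℂ FockNS} (h : ∀ n, ⁅X, psi n⁆ = 0) (h0 : X Ω = 0) :
    X = 0 := by
  have := eq_top_of_vacuum_mem (W := LinearMap.ker X) (fun k w hw => ?_) h0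
  · exact LinearMap.ker_eq_top.mp this
  · have e := LinearMap.congr_fun (h (-(k : ℤ) - 1)) w
    rw [psi_neg_sub_one, Ring.lie_def, LinearMap.sub_apply, Module.End.mul_apply,
      Module.End.mul_apply, LinearMap.mem_ker.mp hw, map_zero, sub_zero] at e
    exact e

theorem inner_vacuum (v : FockNS) : inner ℂ Ω v = coord v ∅ := by
  change (coord (basisVector ∅)).sum (fun S a => (starRingEnd ℂ) a * coord v S) = _
  simp [basisVector]

/-- Schur's lemma. -/
theorem eq_smul_one_of_commute {X : Module.End ℂ FockNS} (h : ∀ n, ⁅X, psi n⁆ = 0) :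
    X = (inner ℂ Ω (X Ω) : ℂ) • (1 : Module.End ℂ FockNS) := by
  refine sub_eq_zero.mp (eq_zero_of_commute (fun n => ?_) ?_)
  · rw [sub_lie, h, smul_lie]
    simp [Ring.lie_def]
  -- `X Ω` is killed by all annihilation operators because `X` commutes with them, so it lies on the
  -- vacuum line.
  · have e := eq_smul_vacuum (v := X Ω) fun k => by
      have e := LinearMap.congr_fun (h k) Ω
      rw [Ring.lie_def, LinearMap.sub_apply, Module.End.mul_apply, Module.End.mul_apply,
        psi_vacuum _ (Int.natCast_nonneg k), map_zero, zero_sub] at e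
      exact neg_eq_zero.mp e
    rw [LinearMap.sub_apply, inner_vacuum, LinearMap.smul_apply, Module.End.one_apply, ← e,
      sub_self]

end FockNS

/-! ## The Virasoro field of the fermion -/

namespace FockNS

open FormalField

theorem stateField_ω :
    stateField ω = (1 / 2 : ℂ) • nthProduct (-1) (-2) psi psi := by
  have hp := isVertexField_psi
  have h := hp.product hp (hp.commutes hp) (-2)
  have e := h.eq_stateField
  rw [nthProduct_creation _ _ hp.isField hp.isField psi_vacuum psi_vacuum] at e
  rw [ω, map_smul, e]
  simp [ZMod.val_one]

/-- The modes `L_n` of the Virasoro field. -/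
noncomputable abbrev vir (n : ℤ) : Module.End ℂ FockNS := virasoroMode stateField ω n

theorem vir_eventually (n : ℤ) (v : FockNS) : ∀ᶠ K : ℕ in Filter.atTop, vir n v =
    (1 / 2 : ℂ) • ∑ p ∈ Finset.range K, ((p : ℂ) + 1) •
      (psi (-2 - p) (psi (n + 1 + p) v) + psi (n - 1 - p) (psi p v)) := by
  have hp := isVertexField_psi
  filter_upwards [nthProduct_eventually (-1) (-2) hp.isField hp.isField (n + 1) v] with K hK
  rw [vir, virasoroMode, stateField_ω, Pi.smul_apply, LinearMap.smul_apply, hK]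
  congr 1
  refine Finset.sum_congr rfl fun p _ => ?_
  have c : signedChoose (-2) p = (p : ℂ) + 1 := by simpa using signedChoose_neg 1 p
  rw [c, show n + 1 + -2 - (p : ℤ) = n - 1 - p by ring]
  simp [zpow_neg]

theorem psi_psi_apply (m n : ℤ) (v : FockNS) :
    psi m (psi n v) = (if m + n = -1 then v else 0) - psi n (psi m v) := by
  have := LinearMap.congr_fun (psi_anticommute m n) v
  rw [LinearMap.add_apply, Module.End.mul_apply, Module.End.mul_apply] at this
  rw [eq_sub_of_add_eq this]
  split_ifs <;> rfl

theorem sum_range_delta (K : ℕ) (x : ℤ) (hx : x < K) (F : ℤ → FockNS) :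
    ∑ p ∈ Finset.range K, ((p : ℂ) + 1) • (if (p : ℤ) = x then F p else 0) =
      if 0 ≤ x then ((x : ℂ) + 1) • F x else 0 := by
  split_ifs with h
  · obtain ⟨p, rfl⟩ := Int.eq_ofNat_of_zero_le h
    rw [Finset.sum_eq_single_of_mem p (Finset.mem_range.mpr (by omega)), if_pos rfl]
    · simp
    · intro q _ hq
      rw [if_neg (by exact_mod_cast hq), smul_zero]
  · refine Finset.sum_eq_zero fun p _ => ?_
    rw [if_neg (by omega), smul_zero]

/-- `[L_n, ψ_m] = -(m + n/2) ψ_{m+n}`. -/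
theorem vir_psi (n q : ℤ) :
    ⁅vir n, psi q⁆ = (-((q : ℂ) + (n + 1) / 2)) • psi (n + q) := by
  refine LinearMap.ext fun v => ?_
  obtain ⟨K, h1, h2, hK⟩ := ((vir_eventually n (psi q v)).and ((vir_eventually n v).and
    (Filter.eventually_gt_atTop (n.natAbs + q.natAbs + 2)))).exists
  rw [Ring.lie_def, LinearMap.sub_apply, Module.End.mul_apply, Module.End.mul_apply, h1, h2,
    map_smul, ← smul_sub, map_sum, ← Finset.sum_sub_distrib, LinearMap.smul_apply]
  -- Moving `psi q` through two quadratic terms leaves four Kronecker deltas, each selecting at most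
  -- one `p`.
  have e : ∀ p : ℕ, ((p : ℂ) + 1) • (psi (-2 - p) (psi (n + 1 + p) (psi q v)) +
        psi (n - 1 - p) (psi p (psi q v))) -
      psi q (((p : ℂ) + 1) • (psi (-2 - p) (psi (n + 1 + p) v) + psi (n - 1 - p) (psi p v))) =
      ((p : ℂ) + 1) • (if (p : ℤ) = -2 - n - q then psi (-2 - p) v else 0) -
      ((p : ℂ) + 1) • (if (p : ℤ) = q - 1 then psi (n + 1 + p) v else 0) +
      ((p : ℂ) + 1) • (if (p : ℤ) = -1 - q then psi (n - 1 - p) v else 0) -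
      ((p : ℂ) + 1) • (if (p : ℤ) = n + q then psi p v else 0) := by
    intro p
    rw [psi_psi_apply (n + 1 + p) q v, psi_psi_apply p q v, map_sub, map_sub,
      psi_psi_apply (-2 - p) q, psi_psi_apply (n - 1 - p) q, map_smul, map_add]
    rw [if_congr (show n + 1 + (p : ℤ) + q = -1 ↔ (p : ℤ) = -2 - n - q by omega) rfl rfl,
      if_congr (show (-2 - (p : ℤ) + q = -1) ↔ (p : ℤ) = q - 1 by omega) rfl rfl,
      if_congr (show (p : ℤ) + q = -1 ↔ (p : ℤ) = -1 - q by omega) rfl rfl,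
      if_congr (show n - 1 - (p : ℤ) + q = -1 ↔ (p : ℤ) = n + q by omega) rfl rfl]
    simp only [apply_ite (psi _), map_zero]
    module
  simp only [e, Finset.sum_add_distrib, Finset.sum_sub_distrib]
  rw [sum_range_delta K _ (by omega) (fun p => psi (-2 - p) v),
    sum_range_delta K _ (by omega) (fun p => psi (n + 1 + p) v),
    sum_range_delta K _ (by omega) (fun p => psi (n - 1 - p) v),
    sum_range_delta K _ (by omega) (fun p => psi p v)]
  rw [show -2 - (-2 - n - q) = n + q by ring, show n + 1 + (q - 1) = n + q by ring,
    show n - 1 - (-1 - q) = n + q by ring]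
  -- The two ranges give the same linear expression, and the uncovered value `n + q = -1` is its
  -- zero. `s2` has the same pattern around `q = 0`, and half the sum is the claimed coefficient.
  have s1 : (if 0 ≤ -2 - n - q then (((-2 - n - q : ℤ) : ℂ) + 1) • psi (n + q) v else 0) -
      (if 0 ≤ n + q then (((n + q : ℤ) : ℂ) + 1) • psi (n + q) v else 0) =
      (-((n : ℂ) + q + 1)) • psi (n + q) v := by
    push_cast
    rcases lt_trichotomy (n + q) (-1) with h | h | h
    · rw [if_pos (by omega), if_neg (by omega)]; module
    · rw [if_neg (by omega), if_neg (by omega)]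
      have : (n : ℂ) + q = -1 := by exact_mod_cast h
      rw [this]; simp
    · rw [if_neg (by omega), if_pos (by omega)]; module
  have s2 : (if 0 ≤ -1 - q then (((-1 - q : ℤ) : ℂ) + 1) • psi (n + q) v else 0) -
      (if 0 ≤ q - 1 then (((q - 1 : ℤ) : ℂ) + 1) • psi (n + q) v else 0) =
      (-(q : ℂ)) • psi (n + q) v := by
    push_cast
    rcases lt_trichotomy q 0 with h | h | h
    · rw [if_pos (by omega), if_neg (by omega)]; module
    · rw [if_neg (by omega), if_neg (by omega)]
      simp [h]
    · rw [if_neg (by omega), if_pos (by omega)]; module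
  rw [show ∀ a b c d : FockNS, a - b + c - d = (a - d) + (c - b) by intros; abel, s1, s2]
  module

theorem vir_vacuum (n : ℤ) (hn : -1 ≤ n) : vir n Ω = 0 :=
  stateField_annihilates_vacuum ω _ (by omega)

theorem vir_neg_two_vacuum : vir (-2) Ω = ω := stateField_creation ω

theorem inner_psi_right (n : ℤ) (u v : FockNS) :
    inner ℂ u (psi n v) = inner ℂ (psi (-n - 1) u) v := by
  rw [inner_psi, show -(-n - 1) - 1 = n by ring]

theorem inner_vacuum_psi (n : ℤ) (hn : n < 0) (v : FockNS) : inner ℂ Ω (psi n v) = 0 := by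
  rw [inner_psi_right, psi_vacuum _ (by omega), inner_zero_left]

theorem inner_vacuum_vir (n : ℤ) : inner ℂ Ω (vir n Ω) = 0 := by
  obtain ⟨K, hK⟩ := (vir_eventually n Ω).exists
  rw [hK, inner_smul_right, inner_sum, Finset.sum_eq_zero, mul_zero]
  intro p _
  rw [psi_vacuum p (Int.natCast_nonneg p), map_zero, add_zero, inner_smul_right,
    inner_vacuum_psi _ (by omega), mul_zero]

theorem vir_psi_apply (n q : ℤ) (v : FockNS) :
    vir n (psi q v) = psi q (vir n v) - ((q : ℂ) + (n + 1) / 2) • psi (n + q) v := by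
  have := LinearMap.congr_fun (vir_psi n q) v
  rw [Ring.lie_def, LinearMap.sub_apply, Module.End.mul_apply, Module.End.mul_apply,
    LinearMap.smul_apply, neg_smul] at this
  rw [sub_eq_iff_eq_add'.mp this, sub_eq_add_neg]

/-- `L_n^* = L_{-n}`. -/
theorem inner_vir (n : ℤ) (u v : FockNS) : inner ℂ (vir n u) v = inner ℂ u (vir (-n) v) := by
  -- The defect `(L_n u, v) - (u, L_{-n} v)` is unchanged when a fermion moves from `u` to its
  -- adjoint on `v`. So `u` reduces to `Ω`; a creation operator on `v` then moves back as an
  -- annihilator of `Ω`, and only the pair `(Ω, Ω)` remains.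
  have step : ∀ (q : ℤ) (u v : FockNS), inner ℂ (vir n (psi q u)) v -
      inner ℂ (psi q u) (vir (-n) v) = inner ℂ (vir n u) (psi (-q - 1) v) -
        inner ℂ u (vir (-n) (psi (-q - 1) v)) := by
    intro q u v
    rw [vir_psi_apply, vir_psi_apply, inner_sub_left, inner_smul_left, inner_psi, inner_psi,
      inner_psi, inner_sub_right, inner_smul_right,
      show -n + (-q - 1) = -(n + q) - 1 by ring]
    have : (starRingEnd ℂ) ((q : ℂ) + (n + 1) / 2) = (q : ℂ) + (n + 1) / 2 := by
      simp [Complex.conj_ofNat]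
    rw [this]
    push_cast
    ring
  have h0 : ∀ v, inner ℂ (vir n Ω) v - inner ℂ Ω (vir (-n) v) = (0 : ℂ) := by
    intro v
    induction v using basis_induction with
    | basis S =>
      rcases S.eq_empty_or_nonempty with rfl | hS
      · change inner ℂ (vir n Ω) Ω - inner ℂ Ω (vir (-n) Ω) = (0 : ℂ)
        rw [← inner_conj_symm, inner_vacuum_vir, inner_vacuum_vir]; simp
      · have hk : ∀ j ∈ S.erase (S.min' hS), S.min' hS < j := fun j hj =>
          lt_of_le_of_ne (S.min'_le j (Finset.mem_of_mem_erase hj))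
            (Finset.ne_of_mem_erase hj).symm
        have e := create_ordered _ _ hk
        rw [Finset.insert_erase (S.min'_mem hS), ← psi_neg_sub_one] at e
        have := step (S.min' hS) Ω (basisVector (S.erase (S.min' hS)))
        rw [e, psi_vacuum _ (Int.natCast_nonneg _), map_zero, inner_zero_left, inner_zero_left,
          sub_zero] at this
        exact this.symm
    | zero => simp
    | add a b ha hb =>
      rw [map_add, inner_add_right, inner_add_right]
      linear_combination ha + hb
    | smul c a ha =>
      rw [map_smul, inner_smul_right, inner_smul_right]
      linear_combination c * ha
  have key : ∀ S : Finset ℕ, ∀ v, inner ℂ (vir n (basisVector S)) v -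
      inner ℂ (basisVector S) (vir (-n) v) = (0 : ℂ) := fun S => by
    induction S using Finset.induction_on_min with
    | empty => exact h0
    | insert k S hk ih =>
      intro v
      rw [← create_ordered k S hk, ← psi_neg_sub_one, step]
      exact ih _
  rw [← sub_eq_zero]
  induction u using basis_induction with
  | basis S => exact key S v
  | zero => simp
  | add a b ha hb =>
    rw [map_add, inner_add_left, inner_add_left]
    linear_combination ha + hb
  | smul c a ha =>
    rw [map_smul, inner_smul_left, inner_smul_left]
    linear_combination (starRingEnd ℂ c) * ha

/-! ### Identification of `L_0` and `L_{-1}`, and the central term. -/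

theorem D_psi (n : ℤ) : ⁅D, psi n⁆ = (-((n : ℂ) + 1 / 2)) • psi n := by
  rw [Ring.lie_def, sub_eq_iff_eq_add]
  rcases n with k | k
  · change D * annihilate k = _ • annihilate k + annihilate k * D
    refine hom_ext fun S => ?_
    simp only [LinearMap.add_apply, Module.End.mul_apply, LinearMap.smul_apply, D_eq_diagonal,
      diagonal_basisVector, annihilate_basisVector, map_smul]
    split_ifs with h
    · rw [map_smul, diagonal_basisVector, ← degree_erase h]
      push_cast
      simp only [Int.ofNat_eq_natCast, Int.cast_natCast]
      module
    · simp
  · change D * create k = _ • create k + create k * D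
    refine LinearMap.ext fun v => ?_
    rw [Module.End.mul_apply, D_create, LinearMap.add_apply, LinearMap.smul_apply,
      Module.End.mul_apply, Int.cast_negSucc]
    push_cast
    module

/-- Both operators have the same brackets with the fermions and kill the vacuum, which determines
them. -/
theorem vir_zero : vir 0 = D := by
  refine sub_eq_zero.mp (eq_zero_of_commute (fun n => ?_) ?_)
  · rw [sub_lie, vir_psi, D_psi, zero_add]
    simp
  · rw [LinearMap.sub_apply, vir_vacuum 0 (by omega), D_vacuum, sub_zero]

theorem vir_neg_one : vir (-1) = T := by
  refine sub_eq_zero.mp (eq_zero_of_commute (fun n => ?_) ?_)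
  · rw [sub_lie, vir_psi, psi_covariant, derivative, neg_add_eq_sub]
    simp
  · rw [LinearMap.sub_apply, vir_vacuum (-1) (by omega), T_vacuum, sub_zero]

theorem vir_bracket_commute (m n q : ℤ) :
    ⁅⁅vir m, vir n⁆ - ((m : ℂ) - n) • vir (m + n), psi q⁆ = 0 := by
  rw [sub_lie, smul_lie, vir_psi, lie_lie, vir_psi, vir_psi, lie_smul, lie_smul, vir_psi, vir_psi,
    show n + (m + q) = m + n + q by ring, show m + (n + q) = m + n + q by ring]
  push_cast
  module

/-- The cocycle, as a vacuum expectation value. -/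
theorem vir_bracket_eq_inner (m n : ℤ) : ⁅vir m, vir n⁆ = ((m : ℂ) - n) • vir (m + n) +
    (inner ℂ Ω (⁅vir m, vir n⁆ Ω) : ℂ) • (1 : Module.End ℂ FockNS) := by
  have h := eq_smul_one_of_commute (vir_bracket_commute m n)
  rw [LinearMap.sub_apply, inner_sub_right, LinearMap.smul_apply, inner_smul_right,
    inner_vacuum_vir, mul_zero, sub_zero] at h
  exact (sub_eq_iff_eq_add'.mp h)

/-- The scalar term vanishes because `L_0` is self-adjoint and kills `Ω`. -/
theorem vir_zero_bracket (n : ℤ) : ⁅vir 0, vir n⁆ = (-(n : ℂ)) • vir n := by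
  rw [vir_bracket_eq_inner, Ring.lie_def, LinearMap.sub_apply, Module.End.mul_apply,
    Module.End.mul_apply, vir_vacuum 0 (by omega), map_zero, sub_zero,
    show vir 0 (vir n Ω) = vir (-0) (vir n Ω) by rw [neg_zero], ← inner_vir,
    vir_vacuum 0 (by omega), inner_zero_left]
  simp

theorem sum_cocycle (x : ℂ) (j : ℕ) : ∑ p ∈ Finset.range j, ((p : ℂ) + 1) * ((p : ℂ) + 2 - x) =
    j * (j + 1) * (j + 2) / 3 - x * (j * (j + 1) / 2) := by
  induction j with
  | zero => simp
  | succ j ih =>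
    rw [Finset.sum_range_succ, ih]
    push_cast
    ring

/-- Only the terms with `p < j` survive in `L_{-(j+1)} Ω`. Moving `L_{j+1}` through the left fermion
of each contracts the pair to a multiple of `Ω`, and `sum_cocycle` adds up the factors. -/
theorem inner_vacuum_bracket_of_pos (j : ℕ) :
    inner ℂ Ω (⁅vir ((j : ℤ) + 1), vir (-((j : ℤ) + 1))⁆ Ω) =
      (1 / 24 : ℂ) * (((j : ℂ) + 1) * (((j : ℂ) + 1) ^ 2 - 1)) := by
  obtain ⟨K, hK, hjK⟩ := ((vir_eventually (-((j : ℤ) + 1)) Ω).and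
    (Filter.eventually_ge_atTop j)).exists
  rw [Ring.lie_def, LinearMap.sub_apply, Module.End.mul_apply, Module.End.mul_apply,
    vir_vacuum ((j : ℤ) + 1) (by omega), map_zero, sub_zero, hK, map_smul, map_sum,
    inner_smul_right, inner_sum]
  have e : ∀ p : ℕ, (inner ℂ Ω (vir ((j : ℤ) + 1) (((p : ℂ) + 1) •
      (psi (-2 - p) (psi (-((j : ℤ) + 1) + 1 + p) Ω) +
        psi (-((j : ℤ) + 1) - 1 - p) (psi p Ω)))) : ℂ) =
      if p < j then ((p : ℂ) + 1) * ((p : ℂ) + 2 - ((j : ℂ) + 2) / 2) else 0 := by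
    intro p
    rw [psi_vacuum p (Int.natCast_nonneg p), map_zero, add_zero]
    split_ifs with h
    · rw [map_smul, inner_smul_right, vir_psi_apply, inner_sub_right,
        inner_vacuum_psi _ (by omega), inner_smul_right, psi_psi_apply, if_pos (by ring),
        psi_vacuum ((j : ℤ) + 1 + (-2 - p)) (by omega), map_zero, sub_zero,
        inner_self_eq_norm_sq_to_K, norm_vacuum]
      push_cast
      ring
    · rw [psi_vacuum (-((j : ℤ) + 1) + 1 + p) (by omega)]
      simp
  simp only [e]
  rw [← Finset.sum_filter, show (Finset.range K).filter (fun p => p < j) = Finset.range j by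
    ext p; simp; omega, sum_cocycle]
  ring

theorem vir_bracket (m n : ℤ) : ⁅vir m, vir n⁆ = ((m : ℂ) - n) • vir (m + n) +
    (if m + n = 0 then ((1 / 2 : ℂ) / 12 * ((m : ℂ) * ((m : ℂ) ^ 2 - 1))) •
      (1 : Module.End ℂ FockNS) else 0) := by
  rw [vir_bracket_eq_inner]
  congr 1
  split_ifs with h
  · congr 1
    obtain rfl : n = -m := by omega
    have key : ∀ j : ℕ, inner ℂ Ω (⁅vir (j : ℤ), vir (-(j : ℤ))⁆ Ω) =
        (1 / 24 : ℂ) * ((j : ℂ) * ((j : ℂ) ^ 2 - 1)) := by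
      intro j
      rcases j with _ | j
      · simp
      · have := inner_vacuum_bracket_of_pos j
        push_cast
        exact this
    rcases le_total 0 m with hm | hm
    · obtain ⟨j, rfl⟩ := Int.eq_ofNat_of_zero_le hm
      rw [key]
      push_cast; ring
    · obtain ⟨j, hj⟩ := Int.eq_ofNat_of_zero_le (Int.neg_nonneg.mpr hm)
      obtain rfl : m = -j := by omega
      rw [neg_neg, ← lie_skew, LinearMap.neg_apply, inner_neg_right, key]
      push_cast; ring
  · set c : ℂ := inner ℂ Ω (⁅vir m, vir n⁆ Ω) with hc
    -- By the Jacobi identity the scalar term has weight `-(m + n)` under `L_0`; the identity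
    -- operator has weight zero, so `(m + n) c = 0`.
    have h1 : ⁅vir 0, ⁅vir m, vir n⁆⁆ = (-((m : ℂ) + n)) • ⁅vir m, vir n⁆ := by
      rw [leibniz_lie, vir_zero_bracket, vir_zero_bracket, smul_lie, lie_smul]
      module
    rw [vir_bracket_eq_inner, lie_add, lie_smul, vir_zero_bracket, lie_smul, ← hc] at h1
    have h2 : ⁅vir 0, (1 : Module.End ℂ FockNS)⁆ = 0 := by simp [Ring.lie_def]
    rw [h2, smul_zero, add_zero, smul_add] at h1
    have h3 : (((m : ℂ) + n) * c) • (1 : Module.End ℂ FockNS) = 0 := by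
      push_cast at h1
      have : ((m : ℂ) - n) • (-((m : ℂ) + n)) • vir (m + n) -
        (-((m : ℂ) + n)) • ((m : ℂ) - n) • vir (m + n) =
        (-((m : ℂ) + n)) • c • (1 : Module.End ℂ FockNS) := sub_eq_iff_eq_add'.mpr h1
      have e0 : ((m : ℂ) - n) • (-((m : ℂ) + n)) • vir (m + n) -
        (-((m : ℂ) + n)) • ((m : ℂ) - n) • vir (m + n) = 0 := by module
      rw [e0] at this
      rw [mul_smul, ← neg_eq_zero, ← neg_smul]
      exact this.symm
    have h4 : ((m : ℂ) + n) * c = 0 := by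
      have := congrArg (fun X : Module.End ℂ FockNS => (inner ℂ Ω (X Ω) : ℂ)) h3
      simpa [inner_smul_right, inner_self_eq_norm_sq_to_K, norm_vacuum] using this
    have h5 : ((m : ℂ) + n) ≠ 0 := by exact_mod_cast h
    rw [(mul_eq_zero.mp h4).resolve_left h5, zero_smul]

end FockNS

/-! ## The vertex operator superalgebra -/

namespace FockNS

open FormalField

theorem basisVector_mem_eigenspace (S : Finset ℕ) :
    basisVector S ∈ D.eigenspace ((degree S : ℂ) / 2) := by
  rw [mem_eigenspace_D]
  intro R hR
  by_contra h
  exact hR (by rw [coord_basisVector, if_neg fun e => h (by rw [e])])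

theorem isInternal_eigenspace_D :
    DirectSum.IsInternal fun k : ℕ => D.eigenspace ((k : ℂ) / 2) := by
  refine DirectSum.isInternal_submodule_of_iSupIndep_of_iSup_eq_top ?_ (top_unique fun v _ => ?_)
  · refine (Module.End.eigenspaces_iSupIndep D).comp (f := fun k : ℕ => (k : ℂ) / 2) fun j k h => ?_
    have := (div_left_inj' (two_ne_zero' ℂ)).mp h
    exact_mod_cast this
  · exact mem_of_coord _ v fun S _ =>
      Submodule.mem_iSup_of_mem (degree S) (basisVector_mem_eigenspace S)

theorem finiteDimensional_eigenspace_D (k : ℕ) :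
    FiniteDimensional ℂ (D.eigenspace ((k : ℂ) / 2)) := by
  let s : Set FockNS := basisVector '' ((Finset.range k).powerset : Set (Finset ℕ))
  have hs : s.Finite := (Finset.finite_toSet _).image _
  have := FiniteDimensional.span_of_finite ℂ hs
  refine Submodule.finiteDimensional_of_le (S₂ := Submodule.span ℂ s) fun v hv => ?_
  rw [mem_eigenspace_D] at hv
  refine mem_of_coord _ v fun S hS => Submodule.subset_span ⟨S, ?_, rfl⟩
  rw [Finset.mem_coe, Finset.mem_powerset]
  intro j hj
  have h1 : 2 * j + 1 ≤ degree S := Finset.single_le_sum (f := fun k => 2 * k + 1)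
    (fun _ _ => Nat.zero_le _) hj
  rw [hv S hS] at h1
  exact Finset.mem_range.mpr (by omega)

theorem eigenspace_D_orthogonal (j k : ℕ) (h : j ≠ k) :
    D.eigenspace ((j : ℂ) / 2) ⟂ D.eigenspace ((k : ℂ) / 2) := by
  have hb : ∀ (k : ℕ), ∀ v ∈ D.eigenspace ((k : ℂ) / 2), v ∈ band k k := fun k v hv S hS => by
    rw [(mem_eigenspace_D k v).mp hv S hS]; simp
  rw [Submodule.isOrtho_iff_inner_eq]
  intro u hu v hv
  rcases lt_or_gt_of_ne h with h | h
  · exact inner_eq_zero_of_mem_band (by exact_mod_cast h) (hb j u hu) (hb k v hv)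
  · rw [← inner_conj_symm, inner_eq_zero_of_mem_band (by exact_mod_cast h) (hb k v hv) (hb j u hu),
      map_zero]

theorem isInternal_parityPart : DirectSum.IsInternal parityPart := by
  have e : parityPart = fun ε : ZMod 2 => parityOp.eigenspace ((-1) ^ ε.val) :=
    funext parityPart_eq
  rw [e]
  refine DirectSum.isInternal_submodule_of_iSupIndep_of_iSup_eq_top ?_ (top_unique fun v _ => ?_)
  · exact (Module.End.eigenspaces_iSupIndep parityOp).comp
      (f := fun ε : ZMod 2 => (-1 : ℂ) ^ ε.val) fun _ _ h => neg_one_pow_val_injective h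
  · refine mem_of_coord _ v fun S _ => Submodule.mem_iSup_of_mem (S.card : ZMod 2) ?_
    rw [mem_eigenspace_parityOp]
    intro R hR
    by_contra h
    exact hR (by rw [coord_basisVector, if_neg fun e => h (by rw [e])])

theorem psi_modes_mem {W : Submodule ℂ FockNS}
    (hW : ∀ (a : FockNS) (n : ℤ), ∀ w ∈ W, stateField a n w ∈ W) (n : ℤ) :
    ∀ w ∈ W, psi n w ∈ W := fun w hw => by
  have := hW (psi (-1) Ω) n w hw
  rwa [stateField_psi] at this

theorem vacuum_mem_eigenspace : Ω ∈ D.eigenspace 0 := by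
  rw [Module.End.mem_eigenspace_iff, D_vacuum, zero_smul]

theorem ω_eq : ω = (1 / 2 : ℂ) • create 1 (create 0 Ω) := rfl

theorem ω_mem_eigenspace : ω ∈ D.eigenspace 2 := by
  rw [Module.End.mem_eigenspace_iff, ω_eq, map_smul, D_create, D_create, D_vacuum, map_zero,
    zero_add, map_smul]
  push_cast
  module

theorem ω_mem_parityPart : ω ∈ parityPart 0 := by
  have h := ω_mem_eigenspace
  refine Submodule.mem_iSup_of_mem 2 ?_
  simpa using h

/-- This reconciles the central charge `2‖ω‖²` of the axioms with the value `1/2` from the bracket.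
-/
theorem norm_ω_sq : ‖ω‖ ^ 2 = 1 / 4 := by
  have h : (inner ℂ ω ω : ℂ) = 1 / 4 := by
    have e1 := LinearMap.congr_fun (annihilate_create 1 1) (create 0 Ω)
    have e2 := LinearMap.congr_fun (annihilate_create 1 0) Ω
    have e3 := LinearMap.congr_fun (annihilate_create 0 0) Ω
    have v0 : annihilate 0 Ω = 0 := psi_vacuum 0 le_rfl
    have v1 : annihilate 1 Ω = 0 := psi_vacuum 1 (by norm_num)
    simp only [LinearMap.add_apply, Module.End.mul_apply, v0, v1, map_zero, add_zero] at e1 e2 e3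
    rw [if_neg (by norm_num)] at e2
    rw [e2] at e1
    simp only [if_true, Module.End.one_apply, LinearMap.zero_apply, map_zero, add_zero] at e1 e3
    rw [ω_eq, inner_smul_left, inner_smul_right, inner_create, e1, inner_create, e3,
      inner_self_eq_norm_sq_to_K, norm_vacuum]
    simp [Complex.conj_ofNat]
    norm_num
  rw [inner_self_eq_norm_sq_to_K] at h
  apply Complex.ofReal_injective
  push_cast
  exact h

theorem mem_parityPart_of_mem_eigenspace {k : ℕ} {a : FockNS}
    (ha : a ∈ D.eigenspace ((k : ℂ) / 2)) : a ∈ parityPart (k : ZMod 2) := by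
  rw [parityPart_eq, mem_eigenspace_parityOp]
  rw [mem_eigenspace_D] at ha
  intro S hS
  rw [← degree_mod_two, ha S hS]

/-- The product of index `1` of `V(ω)` and `V(a)` has modes `[L_0, a(n)] - [L_{-1}, a(n+1)]`, and it
is the field of `L_0 a`, a multiple of `a`. -/
theorem energy_bracket_stateField (k : ℕ) (a : FockNS) (ha : a ∈ D.eigenspace ((k : ℂ) / 2))
    (n : ℤ) : ⁅D, stateField a n⁆ =
      derivative (stateField a) (n + 1) + ((k : ℂ) / 2) • stateField a n := by
  have h := (isNthProduct_stateField ω_mem_parityPart (mem_parityPart_of_mem_eigenspace ha)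
    1).2.1 zero_le_one n
  have hD : stateField ω 1 = D := vir_zero
  have hT : stateField ω 0 = T := vir_neg_one
  have hc := stateField_covariant a (n + 1)
  rw [hD, Module.End.mem_eigenspace_iff.mp ha, map_smul] at h
  simp only [Int.toNat_one, Finset.sum_range_succ, Finset.range_zero, Finset.sum_empty,
    superBracket, zero_mul, ZMod.val_zero, pow_zero, one_smul, Nat.choose_zero_right,
    Nat.choose_one_right, Nat.cast_one, Nat.cast_zero, sub_zero, add_zero, zero_add, pow_one,
    sub_self, mul_one, hD, hT] at h
  rw [Ring.lie_def] at hc ⊢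
  rw [hc, Pi.smul_apply] at h
  rw [h]
  module

theorem isVertexOperatorSuperalgebra :
    IsVertexOperatorSuperalgebra parityPart stateField Ω ω where
  superspace := isInternal_parityPart
  vacuum_annihilated := stateField_annihilates_vacuum
  vacuum_creation := stateField_creation
  vacuum_field := stateField_vacuum
  nontrivial := ⟨Ω, 0, fun h => by simpa [h] using norm_vacuum⟩
  irreducible W hW := by
    refine or_iff_not_imp_left.mpr fun h => eq_top_of_vacuum_mem (fun k w hw => ?_)
      (vacuum_mem_of_ne_bot (fun k w hw => psi_modes_mem hW k w hw) h)
    rw [← psi_neg_sub_one]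
    exact psi_modes_mem hW _ w hw
  cyclic W hΩ hW := by
    refine eq_top_of_vacuum_mem (fun k w hw => ?_) hΩ
    rw [← psi_neg_sub_one]
    exact psi_modes_mem hW _ w hw
  locality _ _ _ ha _ hb := (isVertexField_stateField ha).isLocalWith (isVertexField_stateField hb)
  products _ _ _ ha _ hb n := ⟨_, isNthProduct_stateField ha hb n⟩
  virasoro_vacuum_zero := vir_vacuum 0 (by norm_num)
  virasoro_vacuum_neg_one := vir_vacuum (-1) le_rfl
  virasoro_vacuum_neg_two := vir_neg_two_vacuum
  virasoro_bracket m n := by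
    rw [norm_ω_sq, vir_bracket]
    norm_num
  energy_decomposition := by rw [show virasoroMode stateField ω 0 = D from vir_zero]; exact isInternal_eigenspace_D
  energy_finite := by rw [show virasoroMode stateField ω 0 = D from vir_zero]; exact finiteDimensional_eigenspace_D
  energy_orthogonal := by rw [show virasoroMode stateField ω 0 = D from vir_zero]; exact eigenspace_D_orthogonal
  parity ε := by rw [show virasoroMode stateField ω 0 = D from vir_zero]; rfl
  vacuum_energy := by rw [show virasoroMode stateField ω 0 = D from vir_zero]; exact vacuum_mem_eigenspace
  virasoro_energy := by rw [show virasoroMode stateField ω 0 = D from vir_zero]; exact ω_mem_eigenspace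
  energy_bracket := by rw [show virasoroMode stateField ω 0 = D from vir_zero]; exact energy_bracket_stateField
  translation_bracket := by rw [show virasoroMode stateField ω (-1) = T from vir_neg_one]; exact stateField_covariant
  translation_field := by rw [show virasoroMode stateField ω (-1) = T from vir_neg_one]; exact derivative_stateField

end FockNS

/-! ## Highest weight modules of the Virasoro algebra -/

/-- The universal property maps the enveloping algebra into this subalgebra; composed with the
inclusion the map is the identity, by uniqueness. -/
theorem UniversalEnvelopingAlgebra.adjoin_range_ι (R L : Type*) [CommRing R] [LieRing L]
    [LieAlgebra R L] :
    Algebra.adjoin R (Set.range (UniversalEnvelopingAlgebra.ι R : L → _)) = ⊤ := by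
  let A := Algebra.adjoin R
    (Set.range (UniversalEnvelopingAlgebra.ι R : L → UniversalEnvelopingAlgebra R L))
  let j : L →ₗ⁅R⁆ A :=
    { toFun := fun x => ⟨UniversalEnvelopingAlgebra.ι R x, Algebra.subset_adjoin ⟨x, rfl⟩⟩
      map_add' := fun x y => Subtype.ext (map_add _ x y)
      map_smul' := fun a x => Subtype.ext (map_smul _ a x)
      map_lie' := fun {x y} => Subtype.ext (LieHom.map_lie _ x y) }
  have h : A.val.comp (UniversalEnvelopingAlgebra.lift R j) =
      AlgHom.id R (UniversalEnvelopingAlgebra R L) := by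
    refine UniversalEnvelopingAlgebra.hom_ext R (LieHom.ext fun x => ?_)
    change ((UniversalEnvelopingAlgebra.lift R j (UniversalEnvelopingAlgebra.ι R x) : A) :
      UniversalEnvelopingAlgebra R L) = UniversalEnvelopingAlgebra.ι R x
    rw [UniversalEnvelopingAlgebra.lift_ι_apply]
    rfl
  refine top_unique fun y _ => ?_
  have := AlgHom.congr_fun h y
  rw [AlgHom.id_apply] at this
  rw [← this]
  exact Subtype.property _

namespace Virasoro

theorem smul_mem_of_stable {M : Type*} [AddCommGroup M] [Module ℂ M] [Module Enveloping M]
    [IsScalarTower ℂ Enveloping M] (W : Submodule ℂ M)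
    (h : ∀ x : Virasoro, ∀ w ∈ W, UniversalEnvelopingAlgebra.ι ℂ x • w ∈ W) (y : Enveloping) :
    ∀ w ∈ W, y • w ∈ W := by
  have hy : y ∈ Algebra.adjoin ℂ (Set.range (UniversalEnvelopingAlgebra.ι ℂ : Virasoro → _)) := by
    rw [UniversalEnvelopingAlgebra.adjoin_range_ι]; trivial
  induction hy using Algebra.adjoin_induction with
  | mem x hx => obtain ⟨x, rfl⟩ := hx; exact h x
  | algebraMap r => intro w hw; rw [algebraMap_smul]; exact W.smul_mem r hw
  | add a b _ _ ha hb => intro w hw; rw [add_smul]; exact W.add_mem (ha w hw) (hb w hw)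
  | mul a b _ _ ha hb => intro w hw; rw [mul_smul]; exact ha _ (hb w hw)

theorem eq_linearCombination (x : Virasoro) : ∃ (f : ℤ →₀ ℂ) (a : ℂ),
    x = f.sum (fun n b => b • L n) + a • C := by
  obtain ⟨f, a⟩ := x
  refine ⟨f, a, ?_⟩
  have h : f.sum (fun n b => b • L n) = ((f, 0) : (ℤ →₀ ℂ) × ℂ) := by
    induction f using Finsupp.induction_linear with
    | zero => rfl
    | add f g hf hg =>
      rw [Finsupp.sum_add_index' (by simp) (by intros; rw [add_smul]), hf, hg]
      exact Prod.ext rfl (add_zero _)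
    | single n b =>
      rw [Finsupp.sum_single_index (by simp)]
      refine Prod.ext ?_ (mul_zero b)
      change b • Finsupp.single n (1 : ℂ) = Finsupp.single n b
      simp
  rw [h]
  refine Prod.ext ?_ ?_
  · change f = f + a • 0
    simp
  · change a = 0 + a • 1
    simp

theorem linear_mem_of_basis {M : Type*} [AddCommGroup M] [Module ℂ M] (f : Virasoro →ₗ[ℂ] M)
    (W : Submodule ℂ M) (hL : ∀ n, f (L n) ∈ W) (hC : f C ∈ W) (x : Virasoro) : f x ∈ W := by
  obtain ⟨g, a, rfl⟩ := eq_linearCombination x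
  rw [map_add, map_smul, Finsupp.sum, map_sum]
  refine W.add_mem (W.sum_mem fun n _ => ?_) (W.smul_mem _ hC)
  rw [map_smul]
  exact W.smul_mem _ (hL n)

/-! ### Weight decomposition of the Verma module. -/

section Verma

variable (c h : ℂ)

/-- The highest weight vector of the Verma module. -/
noncomputable def vermaVector : Verma c h := Submodule.Quotient.mk 1

variable {c h}

theorem mk_eq_smul_vermaVector (y : Enveloping) :
    (Submodule.Quotient.mk y : Verma c h) = y • vermaVector c h := by
  rw [vermaVector, ← Submodule.Quotient.mk_smul, smul_eq_mul, mul_one]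

theorem L_smul_vermaVector_of_pos (n : ℤ) (hn : 0 < n) :
    UniversalEnvelopingAlgebra.ι ℂ (L n) • vermaVector c h = 0 := by
  rw [← mk_eq_smul_vermaVector, Submodule.Quotient.mk_eq_zero]
  exact Submodule.subset_span (Or.inl ⟨n, hn, rfl⟩)

theorem L_zero_smul_vermaVector :
    UniversalEnvelopingAlgebra.ι ℂ (L 0) • vermaVector c h = h • vermaVector c h := by
  rw [← algebraMap_smul Enveloping h, ← sub_eq_zero, ← sub_smul, ← mk_eq_smul_vermaVector,
    Submodule.Quotient.mk_eq_zero]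
  exact Submodule.subset_span (Or.inr (Or.inl rfl))

theorem C_smul_vermaVector :
    UniversalEnvelopingAlgebra.ι ℂ C • vermaVector c h = c • vermaVector c h := by
  rw [← algebraMap_smul Enveloping c, ← sub_eq_zero, ← sub_smul, ← mk_eq_smul_vermaVector,
    Submodule.Quotient.mk_eq_zero]
  exact Submodule.subset_span (Or.inr (Or.inr rfl))

theorem ι_smul_comm {M : Type*} [AddCommGroup M] [Module Enveloping M] (x y : Virasoro) (v : M) :
    UniversalEnvelopingAlgebra.ι ℂ x • UniversalEnvelopingAlgebra.ι ℂ y • v =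
      UniversalEnvelopingAlgebra.ι ℂ y • UniversalEnvelopingAlgebra.ι ℂ x • v +
        UniversalEnvelopingAlgebra.ι ℂ ⁅x, y⁆ • v := by
  rw [LieHom.map_lie, Ring.lie_def, sub_smul, mul_smul, mul_smul]
  abel

/-- The monomials in `L_{-1}, L_{-2}, …` applied to the highest weight vector, graded by weight. -/
inductive IsMonomial : ℕ → Verma c h → Prop
  | vector : IsMonomial 0 (vermaVector c h)
  -- The order of the factors is free: the monomials only have to span, so no basis theorem is
  -- needed.
  | lower {w : ℕ} {v : Verma c h} (a : ℕ) : IsMonomial w v →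
      IsMonomial (w + (a + 1)) (UniversalEnvelopingAlgebra.ι ℂ (L (-((a : ℤ) + 1))) • v)

variable (c h) in
/-- The span of the monomials of weight `w`; it vanishes for `w < 0`. -/
noncomputable def monomialSpan (w : ℤ) : Submodule ℂ (Verma c h) :=
  Submodule.span ℂ {v | ∃ k : ℕ, (k : ℤ) = w ∧ IsMonomial k v}

theorem IsMonomial.mem {w : ℕ} {v : Verma c h} (hv : IsMonomial w v) :
    v ∈ monomialSpan c h w := Submodule.subset_span ⟨w, rfl, hv⟩

theorem lower_mem_monomialSpan (a : ℕ) (w : ℤ) (v : Verma c h) (hv : v ∈ monomialSpan c h w) :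
    UniversalEnvelopingAlgebra.ι ℂ (L (-((a : ℤ) + 1))) • v ∈ monomialSpan c h (w + (a + 1)) := by
  induction hv using Submodule.span_induction with
  | mem x hx =>
    obtain ⟨k, rfl, hx⟩ := hx
    exact Submodule.subset_span ⟨k + (a + 1), by push_cast; ring, hx.lower a⟩
  | zero => rw [smul_zero]; exact Submodule.zero_mem _
  | add x y _ _ hx hy => rw [smul_add]; exact Submodule.add_mem _ hx hy
  | smul b x _ hx => rw [smul_comm]; exact Submodule.smul_mem _ _ hx

theorem IsMonomial.C_smul {w : ℕ} {v : Verma c h} (hv : IsMonomial w v) :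
    UniversalEnvelopingAlgebra.ι ℂ C • v = c • v := by
  induction hv with
  | vector => exact C_smul_vermaVector
  | lower a _ ih =>
    rw [ι_smul_comm, ih, ← lie_skew, lie_C, neg_zero, map_zero, zero_smul, add_zero, smul_comm]

theorem ι_lie_L_smul {M : Type*} [AddCommGroup M] [Module ℂ M] [Module Enveloping M]
    [IsScalarTower ℂ Enveloping M] (m n : ℤ) (v : M) :
    UniversalEnvelopingAlgebra.ι ℂ ⁅L m, L n⁆ • v =
      ((m : ℂ) - n) • UniversalEnvelopingAlgebra.ι ℂ (L (m + n)) • v +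
      (if m + n = 0 then ((m : ℂ) ^ 3 - m) / 12 else 0 : ℂ) •
        UniversalEnvelopingAlgebra.ι ℂ C • v := by
  rw [lie_L_L, map_add, map_smul, map_smul, add_smul, smul_assoc, smul_assoc]

/-- Commuting `L_n` past the leading factor leaves another `L` and a central scalar acting on a
shorter monomial. When `w < n` the target is zero. -/
theorem IsMonomial.L_smul_mem {w : ℕ} {v : Verma c h} (hv : IsMonomial w v) (n : ℤ) :
    UniversalEnvelopingAlgebra.ι ℂ (L n) • v ∈ monomialSpan c h (w - n) := by
  induction hv generalizing n with
  | vector =>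
    rcases lt_trichotomy n 0 with hn | rfl | hn
    · obtain ⟨a, rfl⟩ : ∃ a : ℕ, n = -((a : ℤ) + 1) := ⟨(-n - 1).toNat, by omega⟩
      refine Submodule.subset_span ⟨0 + (a + 1), by push_cast; ring, IsMonomial.vector.lower a⟩
    · rw [L_zero_smul_vermaVector]
      exact Submodule.smul_mem _ _ (by simpa using IsMonomial.vector.mem)
    · rw [L_smul_vermaVector_of_pos n hn]
      exact Submodule.zero_mem _
  | @lower w v a hv ih =>
    rw [ι_smul_comm, ι_lie_L_smul, hv.C_smul]
    refine Submodule.add_mem _ ?_ (Submodule.add_mem _ (Submodule.smul_mem _ _ ?_) ?_)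
    · have := lower_mem_monomialSpan a _ _ (ih n)
      rwa [show (w : ℤ) - n + (a + 1) = ((w + (a + 1) : ℕ) : ℤ) - n by push_cast; ring] at this
    · have := ih (n + -((a : ℤ) + 1))
      rwa [show (w : ℤ) - (n + -((a : ℤ) + 1)) = ((w + (a + 1) : ℕ) : ℤ) - n by
        push_cast; ring] at this
    · split_ifs with h0
      · refine Submodule.smul_mem _ _ (Submodule.smul_mem _ _ ?_)
        rw [show ((w + (a + 1) : ℕ) : ℤ) - n = w by push_cast; omega]
        exact hv.mem
      · rw [zero_smul]; exact Submodule.zero_mem _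

theorem IsMonomial.L_zero_smul {w : ℕ} {v : Verma c h} (hv : IsMonomial w v) :
    UniversalEnvelopingAlgebra.ι ℂ (L 0) • v = (h + w) • v := by
  induction hv with
  | vector => rw [L_zero_smul_vermaVector]; simp
  | @lower w v a hv ih =>
    rw [ι_smul_comm, ι_lie_L_smul, ih, zero_add, if_neg (by omega), zero_smul, add_zero,
      smul_comm _ (h + (w : ℂ)), ← add_smul]
    congr 1
    push_cast; ring

theorem iSup_monomialSpan : ⨆ w : ℤ, monomialSpan c h w = ⊤ := by
  have hv : vermaVector c h ∈ ⨆ w : ℤ, monomialSpan c h w :=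
    Submodule.mem_iSup_of_mem 0 IsMonomial.vector.mem
  have key : ∀ x : Virasoro, ∀ v ∈ ⨆ w : ℤ, monomialSpan c h w,
      UniversalEnvelopingAlgebra.ι ℂ x • v ∈ ⨆ w : ℤ, monomialSpan c h w := by
    intro x v hv
    induction hv using Submodule.iSup_induction' with
    | mem w v hv =>
      induction hv using Submodule.span_induction with
      | mem v hv =>
        obtain ⟨k, rfl, hv⟩ := hv
        let f : Virasoro →ₗ[ℂ] Verma c h :=
          { toFun := fun x => UniversalEnvelopingAlgebra.ι ℂ x • v
            map_add' := fun x y => by rw [map_add, add_smul]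
            map_smul' := fun a x => by rw [map_smul, smul_assoc]; rfl }
        refine linear_mem_of_basis f _ (fun n => ?_) ?_ x
        · exact Submodule.mem_iSup_of_mem _ (hv.L_smul_mem n)
        · change UniversalEnvelopingAlgebra.ι ℂ C • v ∈ _
          rw [hv.C_smul]
          exact Submodule.smul_mem _ _ (Submodule.mem_iSup_of_mem _ hv.mem)
      | zero => rw [smul_zero]; exact Submodule.zero_mem _
      | add x y _ _ hx hy => rw [smul_add]; exact Submodule.add_mem _ hx hy
      | smul b x _ hx => rw [smul_comm]; exact Submodule.smul_mem _ _ hx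
    | zero => rw [smul_zero]; exact Submodule.zero_mem _
    | add x y _ _ hx hy => rw [smul_add]; exact Submodule.add_mem _ hx hy
  refine top_unique fun v _ => ?_
  obtain ⟨y, rfl⟩ := Submodule.Quotient.mk_surjective _ v
  rw [mk_eq_smul_vermaVector]
  exact smul_mem_of_stable _ key y _ hv

/-- The weight spaces of positive degree in the Verma module. -/
theorem exists_eq_smul_vermaVector_add (v : Verma c h) : ∃ (a : ℂ) (u : Verma c h),
    v = a • vermaVector c h + u ∧
      u ∈ ⨆ k : ℕ, Module.End.eigenspace
        (Module.toModuleEnd ℂ (S := Enveloping) (Verma c h) (UniversalEnvelopingAlgebra.ι ℂ (L 0)))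
          (h + ((k : ℂ) + 1)) := by
  have hv : v ∈ ⨆ w : ℤ, monomialSpan c h w := by rw [iSup_monomialSpan]; trivial
  suffices (⨆ w : ℤ, monomialSpan c h w) ≤ Submodule.span ℂ {vermaVector c h} ⊔
      ⨆ k : ℕ, Module.End.eigenspace
        (Module.toModuleEnd ℂ (S := Enveloping) (Verma c h) (UniversalEnvelopingAlgebra.ι ℂ (L 0)))
          (h + ((k : ℂ) + 1)) by
    obtain ⟨x, hx, u, hu, e⟩ := Submodule.mem_sup.mp (this hv)
    obtain ⟨a, rfl⟩ := Submodule.mem_span_singleton.mp hx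
    exact ⟨a, u, e.symm, hu⟩
  refine iSup_le fun w => Submodule.span_le.mpr ?_
  rintro x ⟨k, rfl, hx⟩
  rcases k with _ | k
  · refine Submodule.mem_sup_left (Submodule.mem_span_singleton.mpr ⟨1, ?_⟩)
    rw [one_smul]
    -- Each lowering factor raises the weight by at least one, so weight zero contains only the
    -- highest weight vector.
    generalize hk : 0 = k at hx
    cases hx with
    | vector => rfl
    | lower a _ => omega
  · refine Submodule.mem_sup_right (Submodule.mem_iSup_of_mem k ?_)
    rw [Module.End.mem_eigenspace_iff]
    have := hx.L_zero_smul
    push_cast at this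
    exact this

end Verma

/-- Projection to the kernel along eigenvectors with nonzero eigenvalues preserves invariant
submodules. -/
theorem mem_of_add_mem_of_mem_iSup_eigenspace {M : Type*} [AddCommGroup M] [Module ℂ M]
    (f : Module.End ℂ M) (W : Submodule ℂ M) (hW : ∀ w ∈ W, f w ∈ W) {ι : Type*} (μ : ι → ℂ)
    (hμ : ∀ i, μ i ≠ 0) (v u : M) (hv : f v = 0) (hu : u ∈ ⨆ i, f.eigenspace (μ i))
    (h : v + u ∈ W) : v ∈ W := by
  -- A product of factors `X - μ i` kills `u`, while on the kernel vector `v` it acts by its nonzero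
  -- constant term.
  have hq : ∃ q : Polynomial ℂ, q.eval 0 ≠ 0 ∧ Polynomial.aeval f q u = 0 := by
    clear h
    induction hu using Submodule.iSup_induction' with
    | mem i x hx =>
      refine ⟨Polynomial.X - Polynomial.C (μ i), by simpa using hμ i, ?_⟩
      rw [map_sub, Polynomial.aeval_X, Polynomial.aeval_C, LinearMap.sub_apply,
        Module.End.mem_eigenspace_iff.mp hx, Module.algebraMap_end_apply, sub_self]
    | zero => exact ⟨1, by simp, by simp⟩
    | add x y _ _ hx hy =>
      obtain ⟨p, hp, hpx⟩ := hx
      obtain ⟨q, hq, hqy⟩ := hy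
      refine ⟨p * q, by simpa using ⟨hp, hq⟩, ?_⟩
      rw [map_add, map_mul, Module.End.mul_apply, Module.End.mul_apply, hqy, map_zero, add_zero,
        ← Module.End.mul_apply, ← map_mul, mul_comm, map_mul, Module.End.mul_apply, hpx, map_zero]
  obtain ⟨q, hq0, hq⟩ := hq
  have h1 : Polynomial.aeval f q (v + u) ∈ W := by
    have : ∀ p : Polynomial ℂ, ∀ w ∈ W, Polynomial.aeval f p w ∈ W := by
      intro p
      induction p using Polynomial.induction_on' with
      | add p q hp hq =>
        intro w hw
        rw [map_add]
        exact W.add_mem (hp w hw) (hq w hw)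
      | monomial n a =>
        intro w hw
        rw [Polynomial.aeval_monomial, Module.End.mul_apply, Module.algebraMap_end_apply]
        refine W.smul_mem _ ?_
        induction n with
        | zero => exact hw
        | succ n ih => rw [pow_succ', Module.End.mul_apply]; exact hW _ ih
    exact this q _ h
  rw [map_add, hq, add_zero] at h1
  have h2 : Polynomial.aeval f q v = q.eval 0 • v := by
    have : f.HasEigenvector 0 v ∨ v = 0 := by
      by_cases h0 : v = 0
      · exact Or.inr h0
      · exact Or.inl ⟨Module.End.mem_eigenspace_iff.mpr (by rw [hv, zero_smul]), h0⟩
    rcases this with h | rfl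
    · exact Module.End.aeval_apply_of_hasEigenvector h
    · simp
  rw [h2] at h1
  exact (W.smul_mem_iff hq0).mp h1

end Virasoro

/-! ## The Virasoro action on the Fock space -/

namespace FockNS

open Virasoro

/-- The action of the Virasoro algebra on the Fock space as a linear map. -/
noncomputable def virasoroLinear : Virasoro →ₗ[ℂ] Module.End ℂ FockNS :=
  LinearMap.coprod (M := ℤ →₀ ℂ) (M₂ := ℂ) (Finsupp.linearCombination ℂ vir)
    (LinearMap.toSpanSingleton ℂ _ ((1 / 2 : ℂ) • (1 : Module.End ℂ FockNS)))

theorem virasoroLinear_L (n : ℤ) : virasoroLinear (L n) = vir n := by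
  change Finsupp.linearCombination ℂ vir (Finsupp.single n 1) + (0 : ℂ) • _ = _
  simp

theorem virasoroLinear_C : virasoroLinear C = (1 / 2 : ℂ) • (1 : Module.End ℂ FockNS) := by
  change Finsupp.linearCombination ℂ vir 0 + (1 : ℂ) • _ = _
  simp

theorem virasoroLinear_lie (x y : Virasoro) :
    virasoroLinear ⁅x, y⁆ = ⁅virasoroLinear x, virasoroLinear y⁆ := by
  have hC : ∀ z : Virasoro, ⁅z, C⁆ = 0 := lie_C
  have hE : ∀ z : Module.End ℂ FockNS, ⁅z, virasoroLinear C⁆ = 0 := fun z => by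
    rw [virasoroLinear_C, Ring.lie_def]
    simp
  have hLL : ∀ m n, virasoroLinear ⁅L m, L n⁆ = ⁅virasoroLinear (L m), virasoroLinear (L n)⁆ := by
    intro m n
    rw [lie_L_L, map_add, map_smul, map_smul, virasoroLinear_L, virasoroLinear_L,
      virasoroLinear_L, virasoroLinear_C, vir_bracket, ite_smul, zero_smul, smul_smul]
    congr 2
    congr 1
    ring
  have hL : ∀ m y, virasoroLinear ⁅L m, y⁆ = ⁅virasoroLinear (L m), virasoroLinear y⁆ := by
    intro m y
    obtain ⟨g, b, rfl⟩ := eq_linearCombination y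
    simp only [lie_add, map_add, lie_smul, map_smul, hC, hE, Finsupp.sum, lie_sum, map_sum, hLL,
      map_zero]
  have hC' : ∀ y, virasoroLinear ⁅C, y⁆ = ⁅virasoroLinear C, virasoroLinear y⁆ := by
    intro y
    rw [← lie_skew, hC, ← lie_skew, hE, neg_zero, neg_zero, map_zero]
  obtain ⟨f, a, rfl⟩ := eq_linearCombination x
  simp only [add_lie, map_add, smul_lie, map_smul, hC', hL, Finsupp.sum, sum_lie, map_sum]

/-- The action of the Virasoro algebra on the Fock space. -/
noncomputable def virasoroAction : Virasoro →ₗ⁅ℂ⁆ Module.End ℂ FockNS :=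
  { virasoroLinear with map_lie' := fun {x y} => virasoroLinear_lie x y }

theorem virasoroAction_L (n : ℤ) : virasoroAction (L n) = vir n := virasoroLinear_L n

theorem virasoroAction_C : virasoroAction C = (1 / 2 : ℂ) • (1 : Module.End ℂ FockNS) :=
  virasoroLinear_C

/-- The Fock space as a module over the enveloping algebra of the Virasoro algebra. -/
noncomputable instance envelopingModule : Module Enveloping FockNS :=
  Module.compHom FockNS (UniversalEnvelopingAlgebra.lift ℂ virasoroAction).toRingHom

theorem enveloping_smul_def (y : Enveloping) (v : FockNS) :
    y • v = UniversalEnvelopingAlgebra.lift ℂ virasoroAction y v := rfl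

theorem ι_smul (x : Virasoro) (v : FockNS) :
    UniversalEnvelopingAlgebra.ι ℂ x • v = virasoroAction x v := by
  rw [enveloping_smul_def, UniversalEnvelopingAlgebra.lift_ι_apply]

instance : IsScalarTower ℂ Enveloping FockNS where
  smul_assoc a y v := by
    rw [enveloping_smul_def, map_smul, LinearMap.smul_apply, ← enveloping_smul_def]

theorem vermaIdeal_le_ker :
    vermaIdeal (1 / 2) 0 ≤ LinearMap.ker (LinearMap.toSpanSingleton Enveloping FockNS Ω) := by
  refine Submodule.span_le.mpr ?_
  rintro x (⟨n, hn, rfl⟩ | rfl | rfl) <;>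
    rw [SetLike.mem_coe, LinearMap.mem_ker, LinearMap.toSpanSingleton_apply]
  · rw [ι_smul, virasoroAction_L, vir_vacuum n (by omega)]
  · rw [map_zero, sub_zero, ι_smul, virasoroAction_L, vir_vacuum 0 (by omega)]
  · rw [sub_smul, ι_smul, virasoroAction_C, algebraMap_smul, LinearMap.smul_apply,
      Module.End.one_apply, sub_self]

/-- The homomorphism from the Verma module that takes the highest weight vector to the vacuum. -/
noncomputable def fromVerma : Verma (1 / 2) 0 →ₗ[Enveloping] FockNS :=
  (vermaIdeal (1 / 2) 0).liftQ (LinearMap.toSpanSingleton Enveloping FockNS Ω) vermaIdeal_le_ker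

theorem fromVerma_vermaVector : fromVerma (vermaVector (1 / 2) 0) = Ω :=
  (Submodule.liftQ_apply _ _ _).trans (one_smul _ _)

/-- `L_0` is symmetric and kills `Ω`, so its eigenvectors with nonzero eigenvalue are orthogonal to
`Ω`. -/
theorem inner_vacuum_fromVerma (u : Verma (1 / 2) 0)
    (hu : u ∈ ⨆ k : ℕ, Module.End.eigenspace
      (Module.toModuleEnd ℂ (S := Enveloping) (Verma (1 / 2) 0)
        (UniversalEnvelopingAlgebra.ι ℂ (L 0))) (0 + ((k : ℂ) + 1))) :
    inner ℂ Ω (fromVerma u) = 0 := by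
  induction hu using Submodule.iSup_induction' with
  | zero => rw [map_zero, inner_zero_right]
  | add x y _ _ hx hy => rw [map_add, inner_add_right, hx, hy, add_zero]
  | mem k x hx =>
    have h : UniversalEnvelopingAlgebra.ι ℂ (L 0) • x = ((k : ℂ) + 1) • x := by
      rw [Module.End.mem_eigenspace_iff, zero_add] at hx
      exact hx
    have h1 : vir 0 (fromVerma x) = ((k : ℂ) + 1) • fromVerma x := by
      rw [← virasoroAction_L, ← ι_smul, ← map_smul, h, ← algebraMap_smul Enveloping, map_smul,
        algebraMap_smul]
    have h2 := inner_vir 0 Ω (fromVerma x)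
    rw [neg_zero, h1, vir_vacuum 0 (by omega), inner_zero_left, inner_smul_right] at h2
    exact (mul_eq_zero.mp h2.symm).resolve_left (by exact_mod_cast Nat.succ_ne_zero k)

/-- If some element of `W` had a component along the highest weight vector, weight projection would
put that vector in `W`, and it generates the module. -/
theorem inner_vacuum_fromVerma_of_mem (W : Submodule Enveloping (Verma (1 / 2) 0)) (hW : W ≠ ⊤)
    (w : Verma (1 / 2) 0) (hw : w ∈ W) : inner ℂ Ω (fromVerma w) = 0 := by
  obtain ⟨a, u, rfl, hu⟩ := exists_eq_smul_vermaVector_add w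
  by_cases ha : a = 0
  · rw [ha, zero_smul, zero_add]
    exact inner_vacuum_fromVerma u hu
  refine absurd ?_ hW
  have h := mem_of_add_mem_of_mem_iSup_eigenspace
    (Module.toModuleEnd ℂ (S := Enveloping) (Verma (1 / 2) 0)
      (UniversalEnvelopingAlgebra.ι ℂ (L 0))) (W.restrictScalars ℂ)
    (fun w hw => W.smul_mem _ hw) (fun k : ℕ => (0 : ℂ) + ((k : ℂ) + 1))
    (fun k => by rw [zero_add]; exact_mod_cast Nat.succ_ne_zero k)
    (a • vermaVector (1 / 2) 0) u (by
      rw [map_smul]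
      change a • UniversalEnvelopingAlgebra.ι ℂ (L 0) • vermaVector (1 / 2) 0 = 0
      rw [L_zero_smul_vermaVector, zero_smul, smul_zero]) hu hw
  have hv : vermaVector (1 / 2) 0 ∈ W :=
    ((W.restrictScalars ℂ).smul_mem_iff ha).mp h
  refine top_unique fun v _ => ?_
  obtain ⟨y, rfl⟩ := Submodule.Quotient.mk_surjective _ v
  rw [mk_eq_smul_vermaVector]
  exact W.smul_mem y hv

/-- The orthogonal complement of the image of `W` contains `Ω` and is Virasoro-stable by `L_n^* =
L_{-n}`. It therefore contains the whole image of the Verma module, so the image of `W` is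
orthogonal to itself. -/
theorem le_ker_fromVerma (W : Submodule Enveloping (Verma (1 / 2) 0)) (hW : W ≠ ⊤) :
    W ≤ LinearMap.ker fromVerma := by
  let U : Submodule ℂ FockNS := (Submodule.map (fromVerma.restrictScalars ℂ)
    (W.restrictScalars ℂ))ᗮ
  have hU : ∀ u, u ∈ U ↔ ∀ w ∈ W, inner ℂ (fromVerma w) u = 0 := fun u => by
    rw [Submodule.mem_orthogonal]
    exact ⟨fun h w hw => h _ ⟨w, hw, rfl⟩, by rintro h _ ⟨w, hw, rfl⟩; exact h w hw⟩
  have hΩ : Ω ∈ U := (hU Ω).mpr fun w hw => by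
    rw [← inner_conj_symm, inner_vacuum_fromVerma_of_mem W hW w hw, map_zero]
  have hstable : ∀ x : Virasoro, ∀ u ∈ U, UniversalEnvelopingAlgebra.ι ℂ x • u ∈ U := by
    intro x u hu
    rw [ι_smul]
    let f : Virasoro →ₗ[ℂ] FockNS :=
      { toFun := fun x => virasoroAction x u
        map_add' := fun x y => by rw [map_add, LinearMap.add_apply]
        map_smul' := fun a x => by rw [map_smul]; rfl }
    refine linear_mem_of_basis f U (fun n => ?_) ?_ x
    · change virasoroAction (L n) u ∈ U
      rw [virasoroAction_L, hU]
      intro w hw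
      have h := inner_vir (-n) (fromVerma w) u
      rw [neg_neg] at h
      rw [← h, ← virasoroAction_L, ← ι_smul, ← map_smul]
      exact (hU u).mp hu _ (W.smul_mem _ hw)
    · change virasoroAction C u ∈ U
      rw [virasoroAction_C]
      exact U.smul_mem _ hu
  intro w hw
  obtain ⟨y, rfl⟩ := Submodule.Quotient.mk_surjective _ w
  rw [mk_eq_smul_vermaVector] at hw ⊢
  have h : fromVerma (y • vermaVector (1 / 2) 0) ∈ U := by
    rw [map_smul, fromVerma_vermaVector]
    exact smul_mem_of_stable U hstable y Ω hΩ
  exact inner_self_eq_zero.mp ((hU _).mp h _ hw)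

/-- The kernel is proper because `Ω ≠ 0`, and it contains every proper submodule. -/
theorem ker_fromVerma : LinearMap.ker fromVerma = vermaMaximal (1 / 2) 0 := by
  refine le_antisymm (le_sSup fun h => ?_) (sSup_le le_ker_fromVerma)
  have : vermaVector (1 / 2) 0 ∈ LinearMap.ker fromVerma := by rw [h]; trivial
  rw [LinearMap.mem_ker, fromVerma_vermaVector] at this
  have h1 : coord Ω ∅ = 1 := by rw [Ω, coord_basisVector, if_pos rfl]
  rw [this, map_zero, Finsupp.zero_apply] at h1
  exact zero_ne_one h1

theorem range_fromVerma : (LinearMap.range fromVerma).restrictScalars ℂ =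
    submoduleGenerated virasoroAction Ω := by
  refine le_antisymm ?_ (sInf_le ⟨⟨_, fromVerma_vermaVector⟩, ?_⟩)
  · rintro _ ⟨v, rfl⟩
    obtain ⟨y, rfl⟩ := Submodule.Quotient.mk_surjective _ v
    rw [mk_eq_smul_vermaVector, map_smul, fromVerma_vermaVector]
    refine smul_mem_of_stable _ (fun x w hw => ?_) y Ω ?_
    · rw [ι_smul]
      exact submoduleGenerated_stable _ _ x w hw
    · exact Submodule.mem_sInf.mpr fun W hW => hW.1
  · rintro x _ ⟨v, rfl⟩
    exact ⟨UniversalEnvelopingAlgebra.ι ℂ x • v, by rw [map_smul, ι_smul]⟩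

/-- The irreducible highest weight module as a submodule of the Fock space. -/
noncomputable def highestWeightEquiv :
    HighestWeight (1 / 2) 0 ≃ₗ[ℂ] submoduleGenerated virasoroAction Ω :=
  (((Submodule.quotEquivOfEq _ _ ker_fromVerma.symm).trans
    fromVerma.quotKerEquivRange).restrictScalars ℂ).trans
    (LinearEquiv.ofEq _ _ range_fromVerma)

theorem highestWeightEquiv_mk (v : Verma (1 / 2) 0) :
    (highestWeightEquiv (Submodule.Quotient.mk v) : FockNS) = fromVerma v := rfl

end FockNS

theorem mainTheorem9 :
    ∃ V : FockNS →ₗ[ℂ] FormalField FockNS,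
      -- `V` is the state-field correspondence onto the space of fields generated by `ψ`
      LinearMap.range V = FormalField.generatedSpace {FockNS.psi} ∧
      (∀ a : FockNS, V a (-1) FockNS.Ω = a) ∧
      (∀ A ∈ FormalField.generatedSpace {FockNS.psi}, V (A (-1) FockNS.Ω) = A) ∧
      V (FockNS.psi (-1) FockNS.Ω) = FockNS.psi ∧
      -- vertex operator superalgebra with Virasoro vector `ω`
      IsVertexOperatorSuperalgebra FockNS.parityPart V FockNS.Ω FockNS.ω ∧
      -- Virasoro relations with `c = 1/2`, `L_0 = D`, `L_{-1} = T`
      (∀ m n : ℤ, ⁅virasoroMode V FockNS.ω m, virasoroMode V FockNS.ω n⁆ =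
        ((m : ℂ) - n) • virasoroMode V FockNS.ω (m + n) +
          (if m + n = 0 then
            ((1 / 2 : ℂ) / 12 * ((m : ℂ) * ((m : ℂ) ^ 2 - 1))) • (1 : Module.End ℂ FockNS)
           else 0)) ∧
      virasoroMode V FockNS.ω 0 = FockNS.D ∧
      virasoroMode V FockNS.ω (-1) = FockNS.T ∧
      -- the modes act unitarily: `L_n^* = L_{-n}`
      (∀ (n : ℤ) (u v : FockNS), inner ℂ (virasoroMode V FockNS.ω n u) v =
        inner ℂ u (virasoroMode V FockNS.ω (-n) v)) ∧
      -- the Virasoro algebra acts, and the submodule generated by `Ω` is `L(1/2, 0)`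
      ∃ ρ : Virasoro →ₗ⁅ℂ⁆ Module.End ℂ FockNS,
        (∀ n : ℤ, ρ (Virasoro.L n) = virasoroMode V FockNS.ω n) ∧
        ρ Virasoro.C = (1 / 2 : ℂ) • (1 : Module.End ℂ FockNS) ∧
        ∃ φ : Virasoro.HighestWeight (1 / 2) 0 ≃ₗ[ℂ]
            Virasoro.submoduleGenerated ρ FockNS.Ω,
          (φ (Virasoro.highestWeightVector (1 / 2) 0) : FockNS) = FockNS.Ω ∧
          ∀ (x : Virasoro) (v : Virasoro.HighestWeight (1 / 2) 0),
            (φ (UniversalEnvelopingAlgebra.ι ℂ x • v) : FockNS) = ρ x (φ v) := by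
  refine ⟨FockNS.stateField, FockNS.range_stateField, FockNS.stateField_creation,
    fun A hA => FockNS.stateField_creation_of_mem hA, FockNS.stateField_psi,
    FockNS.isVertexOperatorSuperalgebra, FockNS.vir_bracket, FockNS.vir_zero, FockNS.vir_neg_one,
    FockNS.inner_vir, FockNS.virasoroAction, FockNS.virasoroAction_L, FockNS.virasoroAction_C,
    FockNS.highestWeightEquiv, FockNS.fromVerma_vermaVector, fun x v => ?_⟩
  obtain ⟨v, rfl⟩ := Submodule.Quotient.mk_surjective _ v
  rw [← Submodule.Quotient.mk_smul, FockNS.highestWeightEquiv_mk, FockNS.highestWeightEquiv_mk,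
    map_smul, FockNS.ι_smul]
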